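/- **Setting.** Fix $\mu,\sigma$ with $\sigma>0$ and $0<\mu<\sigma^2$, and put $\theta=\mu/\sigma^2\in(0,1)$. For a time step $\delta>0$ consider the binomial model with $S_0=1$, down factor $d=e^{-\sigma\sqrt\delta}$, up factor $u=1/d$ and up-probability $p=\frac12+\frac{\mu-\sigma^2/2}{2\sigma}\sqrt\delta$, in which the stock is bought at $S_t$ and sold at $(1-\lambda)S_t$, $0<\lambda<1$. Let $\bar c=\frac{1-p-pd}{p+pd-d}$ and $r(c)=\frac{[c(p+pd-d)+d(2p-1)][1-p-pd-c(2p-1)]}{c(1-d)^2(1-p)^2}$. For $p\ne\frac12$ let $$F(c)=1-\Big(\tfrac{c(p+pd-d)+d(2p-1)}{(1-d)(1-p)}\Big)^2 r(c)^{\frac{\log d}{\log((1-p)/p)}-1},\qquad k(c)=\frac{\log r(c)}{\log((1-p)/p)},$$ and for $p=\frac12$ let $k(c)=\frac{(c+d)(c-1)}{c(1-d)}$, $F(c)=1-c^2d^{k(c)}$. The optimal ratio $c=c(\delta,\lambda)$ of bond and stock wealth is the solution of $F(c)=\lambda$ in $(\bar c,\infty)$ if $p\le\frac12$, and in $\big(\bar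 c,\frac{1-p-pd}{2p-1}\big)$ if $p>\frac12$. With $\bar s=u^{k(c)}$, the boundaries of the no-trade region are $\underline\theta=\frac1{1+c}$ and $\overline\theta=\frac1{1+c/\bar s}$. Let $R$ be the optimal growth rate per period, that is, $R=\limsup_{T\to\infty}\frac1T\sup E[\log V_T]$, where the supremum is over the self-financing strategies on $\{0,\dots,T\}$ that start with $x>0$ in bonds and no stock and whose liquidation value $V_t$ is non-negative for all $t\le T$ (with $\log 0=-\infty$). **Theorem.** There are functions $\underline\theta_0,\underline\theta_1,\overline\theta_0,\overline\theta_1,w,R_0,R_1$ of $\delta>0$ which satisfy, as $\delta\downarrow0$, $$\underline\theta_0=\theta+\tfrac{\sigma^2}{24}(2\theta-1)\delta+O(\delta^{3/2}),\qquad \overline\theta_0=\theta+\tfrac{\sigma^2}{24}(2\theta-1)\delta+O(\delta^{3/2}),$$ $$\underline\theta_1=-\Big(\tfrac{3\theta^2(1-\theta)^2}{4}\Big)^{1/3}+\Big(\tfrac{3\theta^2(1-\theta)^2}{32}\Big)^{1/3}(4\theta-3)\sigma\delta^{1/2}+O(\delta),$$ $$\overline\theta_1=\Big(\tfrac{3\theta^2(1-\theta)^2}{4}\Big)^{1/3}+\Big(\tfrac{3\theta^2(1-\theta)^2}{32}\Big)^{1/3}\sigma\delta^{1/2}+O(\delta),\qquad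 w=1+(1-\theta)\sigma\delta^{1/2}+O(\delta),$$ $$R_0=\tfrac{\mu^2}{2\sigma^2}+\tfrac{\sigma^4}{24}\theta(\theta-1)(2\theta^2-2\theta+1)\delta+O(\delta^{3/2}),\qquad R_1=-\big(\tfrac3{32}\big)^{1/3}\sigma^3(\theta(1-\theta))^{5/3}\delta^{1/2}+O(\delta),$$ and for which (i) and (ii) hold. (i) *Regime $\delta\ll\lambda^2$.* There are $\varepsilon,C>0$, depending only on $\mu,\sigma$, such that for all $0<\lambda<\varepsilon$ and $0<\delta<\varepsilon\lambda^2$ the optimal ratio $c$ exists and is unique, the quantities $$|\underline\theta-(\underline\theta_0+\underline\theta_1\lambda^{1/3})|,\quad |\overline\theta-(\overline\theta_0+\overline\theta_1\lambda^{1/3})|,\quad \big|(\overline\theta-\underline\theta)-(6\theta^2(1-\theta)^2)^{1/3}\,w\,\lambda^{1/3}\big|$$ are at most $C\lambda^{2/3}$, and, if $k(c)$ is a positive integer, then for every $x>0$ the growth rate $R$ is finite and $|R/\delta-(R_0+R_1\lambda^{1/3})|\le C\lambda^{2/3}$. (ii) *The coefficients are those of the truncated expansion.* Let $F_2(c)=F(c)-F'(\bar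 c)(c-\bar c)-\frac12F''(\bar c)(c-\bar c)^2$. There are $\rho,\delta_0,\lambda_0,C>0$, depending only on $\mu,\sigma$, such that for all $0<\delta<\delta_0$ and $0<\lambda<\lambda_0$ the equation $F_2(c)=\lambda$ has exactly one solution $c\in(\bar c,\bar c+\rho)$, and for this $c$ the four estimates of (i) hold with $\underline\theta=\frac1{1+c}$, $\overline\theta=\frac1{1+c/\bar s}$, $\bar s=u^{k(c)}$, and with $R$ replaced by the closed form $$\frac{1-2p}{(1-p)\big(1-(\frac p{1-p})^{k(c)+1}\big)}\Big[(1-p)\log\tfrac{c+d}{c+1}+p\big(\tfrac p{1-p}\big)^{k(c)}\log\tfrac{(c+d)p}{(c+1)(1-p)d}\Big]$$ if $p\neq\frac12$, and $\frac{c(1-d)}{c^2-d}\log\frac{c+d}{\sqrt d\,(c+1)}$ if $p=\frac12$. -/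

import Mathlib

open Filter Topology Asymptotics Set

noncomputable section

namespace ShadowBinomial

/-! ### The binomial model approximating the Black–Scholes model -/

/-- Probability of an up-move for drift `μ`, volatility `σ` and time step `δ`. -/
def upProb (μ σ δ : ℝ) : ℝ := 1 / 2 + (μ - σ ^ 2 / 2) / (2 * σ) * √δ

/-- Down factor `d = exp(-σ √δ)`; the up factor is `u = 1 / d`. -/
def downFactor (σ δ : ℝ) : ℝ := Real.exp (-σ * √δ)

/-! ### The optimal ratio of bond and stock holdings, and the no-trade region -/

/-- Optimal ratio of bond and stock wealth in the frictionless binomial model. -/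
def cBar (p d : ℝ) : ℝ := (1 - p - p * d) / (p + p * d - d)

/-- The quantity `r(c)`. -/
def rFn (p d c : ℝ) : ℝ :=
  ((c * (p + p * d - d) + d * (2 * p - 1)) * (1 - p - p * d - c * (2 * p - 1))) /
    (c * (1 - d) ^ 2 * (1 - p) ^ 2)

open Classical in
/-- The function `F`: the transaction cost for which `c` is the optimal ratio. -/
def costFn (p d c : ℝ) : ℝ :=
  if p = 1 / 2 then
    1 - c ^ 2 * d ^ ((c + d) * (c - 1) / (c * (1 - d)))
  else
    1 - ((c * (p + p * d - d) + d * (2 * p - 1)) / ((1 - d) * (1 - p))) ^ 2 *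
      rFn p d c ^ (Real.log d / Real.log ((1 - p) / p) - 1)

/-- `c` is the optimal ratio for transaction cost `lam`: the solution of `F(c) = lam` in
`(c̄, ∞)` if `p ≤ 1/2`, and in `(c̄, (1 - p - p d) / (2 p - 1))` if `p > 1/2`. -/
def IsOptimalRatio (p d lam c : ℝ) : Prop :=
  cBar p d < c ∧ (1 / 2 < p → c < (1 - p - p * d) / (2 * p - 1)) ∧ costFn p d c = lam

open Classical in
/-- The number `k` of net up-moves that lead from the lower to the upper boundary. -/
def stepCount (p d c : ℝ) : ℝ :=
  if p = 1 / 2 then (c + d) * (c - 1) / (c * (1 - d))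
  else Real.log (rFn p d c) / Real.log ((1 - p) / p)

/-- `s̄ = u ^ k`. -/
def sBar (p d c : ℝ) : ℝ := (d⁻¹) ^ stepCount p d c

/-- Lower boundary `1 / (1 + c)` of the no-trade region. -/
def lowerBd (c : ℝ) : ℝ := 1 / (1 + c)

/-- Upper boundary `1 / (1 + c / s̄)` of the no-trade region. -/
def upperBd (p d c : ℝ) : ℝ := 1 / (1 + c / sBar p d c)

/-- `F₂`: the function `F` without the first and second order terms of its Taylor expansion
at `c̄`. -/
def truncCostFn (p d c : ℝ) : ℝ :=
  costFn p d c - deriv (costFn p d) (cBar p d) * (c - cBar p d)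
    - iteratedDeriv 2 (costFn p d) (cBar p d) / 2 * (c - cBar p d) ^ 2

/-! ### Trading with proportional transaction costs in the binomial tree

A node of the tree is the list of the moves made so far, the most recent one first, `true` being
an up-move.  Adapted processes are functions of the node.  The initial stock price is `1`. -/

/-- The stock (ask) price at a node. -/
def price (d : ℝ) : List Bool → ℝ
  | [] => 1
  | true :: h => d⁻¹ * price d h
  | false :: h => d * price d h

/-- The probability of reaching a node. -/
def nodeProb (p : ℝ) : List Bool → ℝ
  | [] => 1
  | true :: h => p * nodeProb p h
  | false :: h => (1 - p) * nodeProb p h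

/-- A trading strategy: numbers of bonds and of stocks held at each node, after trading there. -/
structure Strategy where
  bond : List Bool → ℝ
  stock : List Bool → ℝ

/-- Bonds held just before trading at a node; the initial holdings are `x` bonds. -/
def Strategy.bondBefore (φ : Strategy) (x : ℝ) : List Bool → ℝ
  | [] => x
  | _ :: h => φ.bond h

/-- Stocks held just before trading at a node; initially there are none. -/
def Strategy.stockBefore (φ : Strategy) : List Bool → ℝ
  | [] => 0
  | _ :: h => φ.stock h

/-- The self-financing condition up to time `T`, for ask price `S` and bid price
`(1 - lam) S`. -/
def Strategy.SelfFinancing (φ : Strategy) (d lam x : ℝ) (T : ℕ) : Prop :=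
  ∀ h : List Bool, h.length ≤ T →
    φ.bond h - φ.bondBefore x h + (φ.stock h - φ.stockBefore h) * price d h ≤ 0 ∧
    φ.bond h - φ.bondBefore x h
      + (φ.stock h - φ.stockBefore h) * ((1 - lam) * price d h) ≤ 0

/-- Liquidation wealth at a node. -/
def Strategy.wealth (φ : Strategy) (d lam : ℝ) (h : List Bool) : ℝ :=
  φ.bond h + max (φ.stock h) 0 * ((1 - lam) * price d h) - max (-φ.stock h) 0 * price d h

/-- Self-financing strategies with non-negative liquidation wealth up to time `T`. -/
def Strategy.Admissible (φ : Strategy) (d lam x : ℝ) (T : ℕ) : Prop :=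
  φ.SelfFinancing d lam x T ∧ ∀ h : List Bool, h.length ≤ T → 0 ≤ φ.wealth d lam h

/-- Expected logarithmic utility of the wealth at time `T`, where `log 0 = -∞`. -/
def Strategy.expectedLog (φ : Strategy) (p d lam : ℝ) (T : ℕ) : EReal :=
  ∑ w : Fin T → Bool, ((nodeProb p (List.ofFn w) : ℝ) : EReal) *
    ENNReal.log (ENNReal.ofReal (φ.wealth d lam (List.ofFn w)))

/-- The maximal expected logarithmic utility for the horizon `T`, i.e. the utility of the
log-optimal portfolio for this horizon. -/
def optimalUtility (p d lam x : ℝ) (T : ℕ) : EReal :=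
  ⨆ (φ : Strategy) (_ : φ.Admissible d lam x T), φ.expectedLog p d lam T

/-- The optimal growth rate (per period) with initial capital `x`. -/
def optimalGrowthRate (p d lam x : ℝ) : EReal :=
  limsup (fun T : ℕ => (((T : ℝ)⁻¹ : ℝ) : EReal) * optimalUtility p d lam x T) atTop

open Classical in
/-- The closed form of the optimal growth rate as a function of the ratio `c`, which makes sense
for every real value of `k`. -/
def growthFormula (p d c : ℝ) : ℝ :=
  if p = 1 / 2 then
    c * (1 - d) / (c ^ 2 - d) * Real.log ((c + d) / (√d * (c + 1)))
  else
    (1 - 2 * p) / ((1 - p) * (1 - (p / (1 - p)) ^ (stepCount p d c + 1))) *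
      ((1 - p) * Real.log ((c + d) / (c + 1)) +
        p * (p / (1 - p)) ^ stepCount p d c *
          Real.log ((c + d) * p / ((c + 1) * (1 - p) * d)))

end ShadowBinomial

end

open ShadowBinomial

/-! The proof has a probabilistic half, which identifies the growth rate exactly, and an analytic
half, which expands the resulting formulas. Throughout, β is the odds `p / (1 - p)`, and A, B are
`numFactor` and `denFactor`.

Growth rate. Suppose that k is a positive integer n. The stock price is tracked by its base price
(the price at the lower boundary) and by a level in 0, ..., n: the level follows the price and is
reflected at both ends, the base price moves only when a reflection occurs. Holding c times the base
price in bonds per unit of stock, let ω_j (`invWealth`) be the reciprocal of the wealth, per unit of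
stock and base price, at level j, valued at a fictitious price; that price is then (1 - cω_j)/ω_j
times the base price. The affine recursion for ω makes both the reciprocal wealth and the price
times the reciprocal wealth martingales. The equation for n (`steps`) is smooth pasting at the top,
and the equation F(c) = λ (`cost`) makes the fictitious price there equal to the bid. A convexity
argument keeps it between bid and ask at all levels, so it is a shadow price: every admissible
wealth times the reciprocal shadow wealth is a supermartingale, and log z ≤ z - 1 bounds the
expected log utility from above. The reflected strategy trades only when the shadow price equals the
true price, is therefore admissible, and attains the bound up to a constant. Its log wealth plus the
solution of a Poisson equation has constant drift, and this drift is the growth rate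
(`IntegerStep.optimalGrowthRate_eq`, `meanReward_eq_growthFormula`).

Expansion. Put h = σ√δ and a = θ - 1/2, so that p = (1 + ah)/2 and d = exp(-h). The formulas have
removable singularities at h = 0 and at p = 1/2. Rewritten with divided differences of exp and log,
the cost function, the boundaries and the growth rate divided by h² become analytic functions of (c,
h) near (c̄(0), 0), with no case distinction. Taylor expansion in x = c - c̄(h) is then uniform in
h. The first two derivatives of F at c̄ are O(h), while the third, t(h), has a positive limit. Hence
F₂ = t x³/6 + O(x⁴), and F₂(c) = λ gives x = (6/t)^(1/3) λ^(1/3) + O(λ^(2/3))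
(`exists_root_estimate`). Inserting this into the first order Taylor formula of each quantity gives
all four estimates (`exists_estimates`); the coefficients are values and c-derivatives at c̄(h), and
their own expansions in h are one-variable calculus.

Two equations. For F₂ the root near c̄ is unique because F₂ is increasing there
(`exists_truncCostFn_expansion`). For F one has F - F₂ = O(hx). If δ is at most a constant times λ²
then h ≤ λ, so this error is O(λx), of relative size x, and changes x only by O(λ^(2/3)). Global
uniqueness comes from the logarithmic derivative of 1 - F, whose numerator is quadratic in x with
two O(h) coefficients and a negative leading one: it is negative as soon as x³ exceeds a multiple of
h, and every root satisfies this (`exists_logSlope_neg`, `exists_root_lower_bound`,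
`exists_costFn_expansion`). -/

noncomputable section

namespace ShadowBinomial

/-! ### Expectations over the binomial tree -/

/-- Expectation at time `T` of an adapted process. -/
def treeExp (p : ℝ) (T : ℕ) (X : List Bool → ℝ) : ℝ :=
  ∑ w : Fin T → Bool, nodeProb p (List.ofFn w) * X (List.ofFn w)

theorem treeExp_zero (p : ℝ) (X : List Bool → ℝ) : treeExp p 0 X = X [] := by
  simp [treeExp, nodeProb]

/-- Coordinate 0 of `Fin (T + 1) → Bool` becomes the head of the list, which is the most recent
move. Splitting it off averages over the last period, as a conditional expectation does. -/
theorem treeExp_succ (p : ℝ) (T : ℕ) (X : List Bool → ℝ) :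
    treeExp p (T + 1) X =
      treeExp p T (fun h => p * X (true :: h) + (1 - p) * X (false :: h)) := by
  unfold treeExp
  rw [← (Fin.consEquiv (fun _ : Fin (T + 1) => Bool)).sum_comp, Fintype.sum_prod_type,
    Fintype.sum_bool, ← Finset.sum_add_distrib]
  refine Finset.sum_congr rfl fun w _ => ?_
  simp [Fin.consEquiv, nodeProb]
  ring

theorem nodeProb_pos {p : ℝ} (h0 : 0 < p) (h1 : p < 1) : ∀ h, 0 < nodeProb p h
  | [] => one_pos
  | true :: h => mul_pos h0 (nodeProb_pos h0 h1 h)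
  | false :: h => mul_pos (sub_pos.2 h1) (nodeProb_pos h0 h1 h)

theorem treeExp_mono {p : ℝ} (h0 : 0 < p) (h1 : p < 1) {T : ℕ} {X Y : List Bool → ℝ}
    (hXY : ∀ h, h.length = T → X h ≤ Y h) : treeExp p T X ≤ treeExp p T Y :=
  Finset.sum_le_sum fun _ _ =>
    mul_le_mul_of_nonneg_left (hXY _ (by simp)) (nodeProb_pos h0 h1 _).le

theorem treeExp_add (p : ℝ) (T : ℕ) (X Y : List Bool → ℝ) :
    treeExp p T (fun h => X h + Y h) = treeExp p T X + treeExp p T Y := by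
  simp [treeExp, mul_add, Finset.sum_add_distrib]

theorem treeExp_const (p : ℝ) (T : ℕ) (a : ℝ) : treeExp p T (fun _ => a) = a := by
  induction T with
  | zero => rw [treeExp_zero]
  | succ T ih => rw [treeExp_succ, ← ih]; congr 1; ext h; rw [ih]; ring

theorem treeExp_le_of_supermartingale {p : ℝ} (h0 : 0 < p) (h1 : p < 1) {X : List Bool → ℝ} :
    ∀ T : ℕ, (∀ h, h.length < T → p * X (true :: h) + (1 - p) * X (false :: h) ≤ X h) →
      treeExp p T X ≤ X []
  | 0, _ => (treeExp_zero p X).le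
  | T + 1, hX => by
    rw [treeExp_succ]
    exact (treeExp_mono h0 h1 fun h hh => hX h (by omega)).trans
      (treeExp_le_of_supermartingale h0 h1 T fun h hh => hX h (by omega))

theorem treeExp_eq_of_drift {p R : ℝ} {X : List Bool → ℝ}
    (hX : ∀ h, p * X (true :: h) + (1 - p) * X (false :: h) = X h + R) (T : ℕ) :
    treeExp p T X = X [] + T * R := by
  induction T with
  | zero => simp [treeExp_zero]
  | succ T ih =>
    rw [treeExp_succ, funext hX, treeExp_add, treeExp_const, ih]; push_cast; ring

/-! ### The shadow price -/

/-- The odds of an up-move. -/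
def odds (p : ℝ) : ℝ := p / (1 - p)

/-- The factor `A` in `1 - F(c) = c (A / B) d ^ k`. -/
def numFactor (β d c : ℝ) : ℝ := (c * (β - d) + d * (β - 1)) / (1 - d)

/-- The factor `B` in `1 - F(c) = c (A / B) d ^ k`. -/
def denFactor (β d c : ℝ) : ℝ := (1 - β * d - c * (β - 1)) / (1 - d)

/-- The geometric sum `∑_{1 ≤ i ≤ k} β ^ (-i)` as a function of the ratio `c`. -/
def geomSum (β d c : ℝ) : ℝ := ((β - d) * c - (1 - β * d)) * (c + d) / (c * (1 - d) ^ 2)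

/-- Reciprocal of the shadow wealth per unit of stock and base price, when the stock price is
`j` up-moves above the lower boundary. -/
def invWealth (β d c : ℝ) (j : ℕ) : ℝ :=
  1 / (c + 1) - (1 - d) / ((c + 1) * (c + d)) * ∑ i ∈ Finset.range j, β⁻¹ ^ (i + 1)

/-- The parameters of a market in which the optimal no-trade region has exactly `n` steps. -/
structure IntegerStep (p d lam c : ℝ) (n : ℕ) : Prop where
  p_pos : 0 < p
  p_lt : p < 1
  d_pos : 0 < d
  d_lt : d < 1
  c_pos : 0 < c
  num_pos : 0 < numFactor (odds p) d c
  den_pos : 0 < denFactor (odds p) d c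
  n_pos : 0 < n
  lam_pos : 0 < lam
  lam_lt : lam < 1
  steps : ∑ i ∈ Finset.range n, (odds p)⁻¹ ^ (i + 1) = geomSum (odds p) d c
  cost : 1 - lam = c * (numFactor (odds p) d c / denFactor (odds p) d c) * d ^ n

theorem odds_pos {p : ℝ} (h0 : 0 < p) (h1 : p < 1) : 0 < odds p := div_pos h0 (sub_pos.2 h1)

theorem invWealth_zero (β d c : ℝ) : invWealth β d c 0 = 1 / (c + 1) := by simp [invWealth]

/-- In this affine form increments are multiplied by β⁻¹ at each step, which is the martingale
relation inside the no-trade region. Read backwards from level 0, it assigns 1/(c + d) to a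
fictitious level -1. -/
theorem invWealth_succ {β d c : ℝ} (hcd : c + d ≠ 0) (hc1 : c + 1 ≠ 0) (j : ℕ) :
    invWealth β d c (j + 1) = 1 / (c + 1) + β⁻¹ * (invWealth β d c j - 1 / (c + d)) := by
  have : ∑ i ∈ Finset.range (j + 1), β⁻¹ ^ (i + 1)
      = β⁻¹ + β⁻¹ * ∑ i ∈ Finset.range j, β⁻¹ ^ (i + 1) := by
    rw [Finset.sum_range_succ', Finset.mul_sum, add_comm]
    simp [pow_succ']
  unfold invWealth
  rw [this]
  field_simp
  ring

theorem invWealth_antitone {β d c : ℝ} (hβ : 0 < β) (hd0 : 0 < d) (hd1 : d < 1) (hc : 0 < c) :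
    Antitone (invWealth β d c) := by
  refine antitone_nat_of_succ_le fun j => ?_
  unfold invWealth
  rw [Finset.sum_range_succ]
  have : 0 ≤ (1 - d) / ((c + 1) * (c + d)) :=
    div_nonneg (by linarith) (by positivity)
  have h2 : 0 ≤ β⁻¹ ^ (j + 1) := by positivity
  nlinarith [mul_nonneg this h2]

theorem convex_quadratic_nonpos {L b e x y z : ℝ} (hL : 0 ≤ L)
    (hx : L * x ^ 2 + b * x + e = 0) (hz : L * z ^ 2 + b * z + e = 0) (hxz : x < z)
    (hxy : x ≤ y) (hyz : y ≤ z) : L * y ^ 2 + b * y + e ≤ 0 := by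
  have h : (L * y ^ 2 + b * y + e) * (z - x) = -(L * (z - y) * (y - x)) * (z - x) := by
    linear_combination (z - y) * hx + (y - x) * hz
  have h2 := mul_right_cancel₀ (sub_ne_zero.2 hxz.ne') h
  rw [h2, neg_nonpos]
  exact mul_nonneg (mul_nonneg hL (by linarith)) (by linarith)

namespace IntegerStep

variable {p d lam c : ℝ} {n : ℕ}

theorem odds_pos (H : IntegerStep p d lam c n) : 0 < odds p :=
  ShadowBinomial.odds_pos H.p_pos H.p_lt

/-- The place where `steps` enters: it turns the geometric sum at the top level into a rational
function of c. -/
theorem invWealth_top (H : IntegerStep p d lam c n) :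
    invWealth (odds p) d c n = denFactor (odds p) d c / (c * (c + 1)) := by
  have hc := H.c_pos
  have hd := H.d_pos
  have h1 : 1 - d ≠ 0 := (sub_pos.2 H.d_lt).ne'
  unfold invWealth
  rw [H.steps, geomSum, denFactor]
  field_simp
  ring

/-- The value at the fictitious level n + 1 encodes smooth pasting: passing from n to n + 1 would
multiply the shadow price by exactly the up factor. Its ratio to the value at n is the factor in
`scale` for a reflection at the top. -/
theorem invWealth_top_succ (H : IntegerStep p d lam c n) :
    invWealth (odds p) d c (n + 1)
      = d * denFactor (odds p) d c / (c * odds p * (c + d)) := by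
  have hc := H.c_pos
  have hd := H.d_pos
  have h1 : 1 - d ≠ 0 := (sub_pos.2 H.d_lt).ne'
  have hβ := H.odds_pos
  rw [invWealth_succ (by positivity) (by positivity), H.invWealth_top, denFactor]
  field_simp
  ring

theorem invWealth_pos (H : IntegerStep p d lam c n) {j : ℕ} (hj : j ≤ n) :
    0 < invWealth (odds p) d c j := by
  have hc := H.c_pos
  have := H.den_pos
  refine lt_of_lt_of_le ?_ (invWealth_antitone H.odds_pos H.d_pos H.d_lt H.c_pos hj)
  rw [H.invWealth_top]
  positivity

/-- The shadow price grows by at most the up factor. -/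
theorem shadow_step (H : IntegerStep p d lam c n) {j : ℕ} (hj : j ≤ n) :
    d * (1 - c * invWealth (odds p) d c (j + 1)) * invWealth (odds p) d c j
      ≤ (1 - c * invWealth (odds p) d c j) * invWealth (odds p) d c (j + 1) := by
  have hc := H.c_pos
  have hd := H.d_pos
  have hd1 : 0 < 1 - d := sub_pos.2 H.d_lt
  have hβ := H.odds_pos
  have hB := H.den_pos
  have hanti := invWealth_antitone H.odds_pos H.d_pos H.d_lt H.c_pos
  have h0 : invWealth (odds p) d c j ≤ 1 / (c + 1) := by
    rw [← invWealth_zero (odds p) d c]; exact hanti (Nat.zero_le _)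
  have h1 : 1 / (c + 1) < 1 / (c + d) :=
    one_div_lt_one_div_of_lt (by positivity) (by linarith)
  have hn : invWealth (odds p) d c n ≤ invWealth (odds p) d c j := hanti hj
  have hn0 : invWealth (odds p) d c n ≤ 1 / (c + 1) := hn.trans h0
  have hs := @invWealth_succ (odds p) d c (by positivity) (by positivity)
  rw [hs j]
  -- Since the next value is affine in ω_j, the claim is that a convex quadratic in ω_j is
  -- nonpositive. Its zeros are ω_n (smooth pasting at the top) and 1/(c + d), the value at level -1
  -- (smooth pasting at the bottom), and ω_j lies between them.
  have hq := @convex_quadratic_nonpos (c * (odds p)⁻¹ * (1 - d))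
    (d - d * c * (1 / (c + 1) - (odds p)⁻¹ / (c + d)) - (odds p)⁻¹
      + c * (1 / (c + 1) - (odds p)⁻¹ / (c + d)))
    (-(1 / (c + 1) - (odds p)⁻¹ / (c + d)))
    (invWealth (odds p) d c n) (invWealth (odds p) d c j) (1 / (c + d)) (by positivity)
    ?_ ?_ (hn0.trans_lt h1) hn (h0.trans h1.le)
  · rw [← sub_nonpos]
    refine le_trans (le_of_eq ?_) hq
    ring
  · have e1 := H.invWealth_top
    have e2 := H.invWealth_top_succ
    have e3 : d * (1 - c * invWealth (odds p) d c (n + 1)) * invWealth (odds p) d c n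
      - (1 - c * invWealth (odds p) d c n) * invWealth (odds p) d c (n + 1) = 0 := by
      rw [e1, e2, denFactor]
      field_simp
      ring
    rw [hs n] at e3
    refine Eq.trans ?_ e3
    ring
  · field_simp
    ring

/-- The quantity compared is the shadow price divided by the ask price. It starts at 1 on level 0
and ends at 1 - λ on level n, so monotonicity places the shadow price inside the bid-ask spread. -/
theorem shadow_ratio_antitone (H : IntegerStep p d lam c n) {i j : ℕ} (hij : i ≤ j) (hj : j ≤ n) :
    d ^ j * (1 - c * invWealth (odds p) d c j) / invWealth (odds p) d c j
      ≤ d ^ i * (1 - c * invWealth (odds p) d c i) / invWealth (odds p) d c i := by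
  induction j, hij using Nat.le_induction with
  | base => exact le_rfl
  | succ j hij ih =>
    refine le_trans ?_ (ih (by omega))
    rw [div_le_div_iff₀ (H.invWealth_pos hj) (H.invWealth_pos (by omega))]
    have := mul_le_mul_of_nonneg_left (H.shadow_step (j := j) (by omega))
      (pow_nonneg H.d_pos.le j)
    rw [pow_succ]
    linarith

theorem shadow_le_ask (H : IntegerStep p d lam c n) {j : ℕ} (hj : j ≤ n) :
    d ^ j * (1 - c * invWealth (odds p) d c j) ≤ invWealth (odds p) d c j := by
  have h := H.shadow_ratio_antitone (Nat.zero_le j) hj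
  have hc := H.c_pos
  rw [div_le_iff₀ (H.invWealth_pos hj), invWealth_zero] at h
  refine h.trans (le_of_eq ?_)
  field_simp
  ring

theorem bid_le_shadow (H : IntegerStep p d lam c n) {j : ℕ} (hj : j ≤ n) :
    (1 - lam) * invWealth (odds p) d c j ≤ d ^ j * (1 - c * invWealth (odds p) d c j) := by
  have h := H.shadow_ratio_antitone hj le_rfl
  have hc := H.c_pos
  have hB := H.den_pos
  have hd1 : 0 < 1 - d := sub_pos.2 H.d_lt
  rw [le_div_iff₀ (H.invWealth_pos hj)] at h
  refine le_trans (le_of_eq ?_) h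
  congr 1
  have e : c + 1 - denFactor (odds p) d c = numFactor (odds p) d c := by
    unfold denFactor numFactor; field_simp; ring
  rw [H.cost, H.invWealth_top, ← e]
  field_simp

end IntegerStep

/-! ### The reflected walk, the optimal strategy and its deflators -/

/-- Number of up-moves above the lower boundary, reflected at `0` and at `n`. -/
def level (n : ℕ) : List Bool → ℕ
  | [] => 0
  | true :: h => if level n h = n then n else level n h + 1
  | false :: h => level n h - 1

/-- Reciprocal of the number of stocks (per unit of `x`) times the base price. -/
def scale (β d c : ℝ) (n : ℕ) : List Bool → ℝ
  | [] => c + 1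
  | true :: h => if level n h = n then scale β d c n h * (d * (c + 1) / (β * (c + d)))
      else scale β d c n h
  | false :: h => if level n h = 0 then scale β d c n h * ((c + 1) / (c + d))
      else scale β d c n h

/-- The price at the lower boundary. -/
def basePrice (d : ℝ) (n : ℕ) (h : List Bool) : ℝ := price d h * d ^ level n h

/-- The shadow price deflator. -/
def deflator (β d c : ℝ) (n : ℕ) (h : List Bool) : ℝ :=
  scale β d c n h * invWealth β d c (level n h)

/-- The deflated shadow price. -/
def deflatedShadow (β d c : ℝ) (n : ℕ) (h : List Bool) : ℝ :=
  scale β d c n h * basePrice d n h * (1 - c * invWealth β d c (level n h))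

/-- The strategy that keeps the fraction of stock in the no-trade region. -/
def reflectedStrategy (β d c x : ℝ) (n : ℕ) : Strategy where
  bond h := c * x / scale β d c n h
  stock h := x / (scale β d c n h * basePrice d n h)

theorem level_true (n : ℕ) (h : List Bool) :
    level n (true :: h) = if level n h = n then n else level n h + 1 := rfl

theorem level_false (n : ℕ) (h : List Bool) : level n (false :: h) = level n h - 1 := rfl

theorem scale_true (β d c : ℝ) (n : ℕ) (h : List Bool) :
    scale β d c n (true :: h) = if level n h = n
      then scale β d c n h * (d * (c + 1) / (β * (c + d))) else scale β d c n h := rfl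

theorem scale_false (β d c : ℝ) (n : ℕ) (h : List Bool) :
    scale β d c n (false :: h) = if level n h = 0
      then scale β d c n h * ((c + 1) / (c + d)) else scale β d c n h := rfl

theorem price_true (d : ℝ) (h : List Bool) : price d (true :: h) = d⁻¹ * price d h := rfl

theorem price_false (d : ℝ) (h : List Bool) : price d (false :: h) = d * price d h := rfl

theorem level_le (n : ℕ) : ∀ h, level n h ≤ n
  | [] => Nat.zero_le n
  | true :: h => by
    have := level_le n h
    unfold level; split_ifs <;> omega
  | false :: h => by
    have := level_le n h
    unfold level; omega

theorem price_pos {d : ℝ} (hd : 0 < d) : ∀ h, 0 < price d h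
  | [] => one_pos
  | true :: h => mul_pos (inv_pos.2 hd) (price_pos hd h)
  | false :: h => mul_pos hd (price_pos hd h)

theorem scale_pos {β d c : ℝ} (hβ : 0 < β) (hd : 0 < d) (hc : 0 < c) (n : ℕ) :
    ∀ h, 0 < scale β d c n h
  | [] => by unfold scale; positivity
  | true :: h => by
    have := scale_pos hβ hd hc n h
    unfold scale; split_ifs <;> positivity
  | false :: h => by
    have := scale_pos hβ hd hc n h
    unfold scale; split_ifs <;> positivity

/-! ### The Poisson equation of the reflected walk -/

/-- Reward of the reflection at the lower boundary. -/
def lowerReward (d c : ℝ) : ℝ := Real.log ((c + d) / (c + 1))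

/-- Reward of the reflection at the upper boundary. -/
def upperReward (β d c : ℝ) : ℝ := Real.log (β * (c + d) / (d * (c + 1)))

/-- The mean reward per period of the reflected walk. -/
def meanReward (p d c : ℝ) (n : ℕ) : ℝ :=
  p * (upperReward (odds p) d c + (odds p)⁻¹ ^ (n + 1) * lowerReward d c) /
    ∑ i ∈ Finset.range (n + 1), (odds p)⁻¹ ^ i

/-- Increment of the solution of the Poisson equation. -/
def poissonIncr (p d c : ℝ) (n j : ℕ) : ℝ :=
  -((odds p)⁻¹ ^ (j + 1) * lowerReward d c) +
    meanReward p d c n / p * ∑ i ∈ Finset.range (j + 1), (odds p)⁻¹ ^ i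

/-- Solution of the Poisson equation of the reflected walk. -/
def poissonSol (p d c : ℝ) (n j : ℕ) : ℝ := ∑ i ∈ Finset.range j, poissonIncr p d c n i

theorem log_scale_true {β d c : ℝ} (hβ : 0 < β) (hd : 0 < d) (hc : 0 < c) (n : ℕ)
    (h : List Bool) : Real.log (scale β d c n (true :: h)) =
      Real.log (scale β d c n h) - if level n h = n then upperReward β d c else 0 := by
  have := scale_pos hβ hd hc n h
  rw [scale_true]
  split_ifs
  · rw [Real.log_mul this.ne' (by positivity), upperReward,
      show β * (c + d) / (d * (c + 1)) = (d * (c + 1) / (β * (c + d)))⁻¹ by rw [inv_div],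
      Real.log_inv]
    ring
  · ring

theorem log_scale_false {β d c : ℝ} (hβ : 0 < β) (hd : 0 < d) (hc : 0 < c) (n : ℕ)
    (h : List Bool) : Real.log (scale β d c n (false :: h)) =
      Real.log (scale β d c n h) - if level n h = 0 then lowerReward d c else 0 := by
  have := scale_pos hβ hd hc n h
  rw [scale_false]
  split_ifs
  · rw [Real.log_mul this.ne' (by positivity), lowerReward,
      show (c + d) / (c + 1) = ((c + 1) / (c + d))⁻¹ by rw [inv_div], Real.log_inv]
    ring
  · ring

/-- The Poisson equation at an interior level, written for the increments of its solution. Together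
with the boundary equation `poissonIncr_zero` it determines all increments from the mean reward. -/
theorem poissonIncr_succ {p : ℝ} (h0 : 0 < p) (h1 : p < 1) (d c : ℝ) (n j : ℕ) :
    p * poissonIncr p d c n (j + 1) - (1 - p) * poissonIncr p d c n j = meanReward p d c n := by
  have h2 : 1 - p ≠ 0 := (sub_pos.2 h1).ne'
  have e : p * (odds p)⁻¹ = 1 - p := by unfold odds; field_simp
  have : ∑ i ∈ Finset.range (j + 2), (odds p)⁻¹ ^ i
      = (odds p)⁻¹ * ∑ i ∈ Finset.range (j + 1), (odds p)⁻¹ ^ i + 1 := by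
    rw [Finset.sum_range_succ', Finset.mul_sum]
    simp [pow_succ']
  unfold poissonIncr
  rw [this, ← e, pow_succ' _ (j + 1)]
  field_simp
  ring

theorem poissonIncr_zero {p : ℝ} (h0 : 0 < p) (h1 : p < 1) (d c : ℝ) (n : ℕ) :
    p * poissonIncr p d c n 0 + (1 - p) * lowerReward d c = meanReward p d c n := by
  have h2 : 1 - p ≠ 0 := (sub_pos.2 h1).ne'
  have e : p * (odds p)⁻¹ = 1 - p := by unfold odds; field_simp
  unfold poissonIncr
  rw [← e]
  simp
  field_simp
  ring

/-- The equation at the upper boundary is the interior one with the reward of the reflection in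
place of the increment from n to n + 1. This matching condition is what fixes the value of
`meanReward`. -/
theorem poissonIncr_top {p : ℝ} (h0 : 0 < p) (h1 : p < 1) (d c : ℝ) (n : ℕ) :
    poissonIncr p d c n n = upperReward (odds p) d c := by
  have hβ := odds_pos h0 h1
  have hs : 0 < ∑ i ∈ Finset.range (n + 1), (odds p)⁻¹ ^ i :=
    Finset.sum_pos (fun i _ => by positivity) ⟨0, by simp⟩
  unfold poissonIncr meanReward
  field_simp
  ring

namespace IntegerStep

variable {p d lam c : ℝ} {n : ℕ}

/-- Up to a bounded term, minus the logarithm of `scale` is the log wealth of the reflected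
strategy, and it changes only by the rewards of reflections. The Poisson correction spreads these
rewards evenly over time. -/
theorem drift (H : IntegerStep p d lam c n) (h : List Bool) :
    p * (-Real.log (scale (odds p) d c n (true :: h)) + poissonSol p d c n (level n (true :: h)))
      + (1 - p) * (-Real.log (scale (odds p) d c n (false :: h))
          + poissonSol p d c n (level n (false :: h)))
      = -Real.log (scale (odds p) d c n h) + poissonSol p d c n (level n h)
        + meanReward p d c n := by
  have hn := H.n_pos
  have hl := level_le n h
  rw [log_scale_true H.odds_pos H.d_pos H.c_pos, log_scale_false H.odds_pos H.d_pos H.c_pos,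
    level_true, level_false]
  rcases Nat.eq_zero_or_pos (level n h) with h0 | h0
  · have hn' : (0 : ℕ) ≠ n := hn.ne
    simp only [h0, hn', if_true, if_false]
    rw [← poissonIncr_zero H.p_pos H.p_lt d c n]
    simp [poissonSol]
    ring
  · obtain ⟨j, hj⟩ : ∃ j, level n h = j + 1 := ⟨level n h - 1, by omega⟩
    rw [hj] at hl ⊢
    have e := poissonIncr_succ H.p_pos H.p_lt d c n j
    by_cases hjn : j + 1 = n
    · have e2 := poissonIncr_top H.p_pos H.p_lt d c n
      rw [← hjn] at e2
      rw [← hjn] at e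
      rw [← hjn]
      simp only [if_true, add_tsub_cancel_right, Nat.succ_ne_zero, if_false, poissonSol,
        Finset.sum_range_succ]
      rw [e2] at e
      linear_combination e
    · simp only [hjn, if_false, add_tsub_cancel_right, Nat.succ_ne_zero, poissonSol,
        Finset.sum_range_succ]
      linear_combination e

/-- A reflection rescales `scale` so that the deflator takes the value it would have had if the walk
had gone on to level -1 or n + 1. Hence the recursion of `invWealth` gives the martingale property
on the boundary as well. -/
theorem deflator_martingale (H : IntegerStep p d lam c n) (h : List Bool) :
    p * deflator (odds p) d c n (true :: h) + (1 - p) * deflator (odds p) d c n (false :: h)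
      = deflator (odds p) d c n h := by
  have hc := H.c_pos
  have hd := H.d_pos
  have hβ := H.odds_pos
  have hp := H.p_pos
  have hp1 : 0 < 1 - p := sub_pos.2 H.p_lt
  have hl := level_le n h
  have e : p = odds p / (1 + odds p) := by unfold odds; field_simp; ring
  have hs := @invWealth_succ (odds p) d c (by positivity) (by positivity)
  -- Both cases of an up-move become one: at the top the change of scale replaces the step to level
  -- n + 1.
  have hup : scale (odds p) d c n (true :: h)
      * invWealth (odds p) d c (level n (true :: h))
      = scale (odds p) d c n h * invWealth (odds p) d c (level n h + 1) := by
    rw [level_true, scale_true]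
    split_ifs with h1
    · rw [h1, H.invWealth_top, H.invWealth_top_succ]
      field_simp
    · rfl
  unfold deflator
  rw [hup, level_false, scale_false]
  rcases Nat.eq_zero_or_pos (level n h) with h0 | h0
  · simp only [h0, if_true, Nat.zero_sub]
    rw [hs 0, invWealth_zero]
    generalize odds p = β at *
    rw [e]
    field_simp
    ring
  · obtain ⟨j, hj⟩ : ∃ j, level n h = j + 1 := ⟨level n h - 1, by omega⟩
    simp only [hj, Nat.succ_ne_zero, if_false, add_tsub_cancel_right]
    rw [hs (j + 1), hs j]
    generalize odds p = β at *
    rw [e]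
    field_simp
    ring

/-- Here the base price also moves at a reflection, by the same factor as the stock. Smooth pasting
says that the shadow price would move by this factor too, so the continuation to the fictitious
levels is consistent. -/
theorem deflatedShadow_martingale (H : IntegerStep p d lam c n) (h : List Bool) :
    p * deflatedShadow (odds p) d c n (true :: h)
        + (1 - p) * deflatedShadow (odds p) d c n (false :: h)
      = deflatedShadow (odds p) d c n h := by
  have hc := H.c_pos
  have hd := H.d_pos
  have hβ := H.odds_pos
  have hp := H.p_pos
  have hp1 : 0 < 1 - p := sub_pos.2 H.p_lt
  have hd1 : 0 < 1 - d := sub_pos.2 H.d_lt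
  have hl := level_le n h
  have e : p = odds p / (1 + odds p) := by unfold odds; field_simp; ring
  have hs := @invWealth_succ (odds p) d c (by positivity) (by positivity)
  have hup : deflatedShadow (odds p) d c n (true :: h)
      = scale (odds p) d c n h * basePrice d n h
        * (1 - c * invWealth (odds p) d c (level n h + 1)) := by
    unfold deflatedShadow basePrice
    rw [level_true, scale_true, price_true]
    split_ifs with h1
    · rw [h1, H.invWealth_top, H.invWealth_top_succ, denFactor]
      field_simp
      ring
    · rw [pow_succ]
      field_simp
  rw [hup]
  unfold deflatedShadow basePrice
  rw [level_false, scale_false, price_false]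
  rcases Nat.eq_zero_or_pos (level n h) with h0 | h0
  · simp only [h0, if_true, Nat.zero_sub, pow_zero]
    rw [hs 0, invWealth_zero]
    generalize odds p = β at *
    rw [e]
    field_simp
    ring
  · obtain ⟨j, hj⟩ : ∃ j, level n h = j + 1 := ⟨level n h - 1, by omega⟩
    simp only [hj, Nat.succ_ne_zero, if_false, add_tsub_cancel_right]
    rw [hs (j + 1), hs j, pow_succ]
    generalize odds p = β at *
    rw [e]
    field_simp
    ring

theorem deflator_pos (H : IntegerStep p d lam c n) (h : List Bool) :
    0 < deflator (odds p) d c n h :=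
  mul_pos (scale_pos H.odds_pos H.d_pos H.c_pos n h) (H.invWealth_pos (level_le n h))

theorem deflatedShadow_le (H : IntegerStep p d lam c n) (h : List Bool) :
    deflatedShadow (odds p) d c n h ≤ deflator (odds p) d c n h * price d h := by
  have h1 := scale_pos H.odds_pos H.d_pos H.c_pos n h
  have h2 := price_pos H.d_pos h
  have := mul_le_mul_of_nonneg_left (H.shadow_le_ask (level_le n h)) (mul_pos h1 h2).le
  unfold deflatedShadow deflator basePrice
  linarith

theorem le_deflatedShadow (H : IntegerStep p d lam c n) (h : List Bool) :
    deflator (odds p) d c n h * ((1 - lam) * price d h) ≤ deflatedShadow (odds p) d c n h := by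
  have h1 := scale_pos H.odds_pos H.d_pos H.c_pos n h
  have h2 := price_pos H.d_pos h
  have := mul_le_mul_of_nonneg_left (H.bid_le_shadow (level_le n h)) (mul_pos h1 h2).le
  unfold deflatedShadow deflator basePrice
  linarith

/-- Trading at the shadow price is at least as good as trading with transaction costs. -/
theorem deflated_trade_nonpos (H : IntegerStep p d lam c n) {h : List Bool} {Δb Δs : ℝ}
    (h1 : Δb + Δs * price d h ≤ 0) (h2 : Δb + Δs * ((1 - lam) * price d h) ≤ 0) :
    Δb * deflator (odds p) d c n h + Δs * deflatedShadow (odds p) d c n h ≤ 0 := by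
  have hY := H.deflator_pos h
  rcases le_total 0 Δs with hs | hs
  · have := mul_le_mul_of_nonneg_left (H.deflatedShadow_le h) hs
    nlinarith [mul_nonpos_of_nonneg_of_nonpos hY.le h1]
  · have := mul_le_mul_of_nonpos_left (H.le_deflatedShadow h) hs
    nlinarith [mul_nonpos_of_nonneg_of_nonpos hY.le h2]

theorem wealth_mul_deflator_le (H : IntegerStep p d lam c n) (φ : Strategy) (h : List Bool) :
    φ.wealth d lam h * deflator (odds p) d c n h
      ≤ φ.bond h * deflator (odds p) d c n h + φ.stock h * deflatedShadow (odds p) d c n h := by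
  have hY := H.deflator_pos h
  unfold Strategy.wealth
  rcases le_total 0 (φ.stock h) with hs | hs
  · rw [max_eq_left hs, max_eq_right (neg_nonpos.2 hs)]
    have := mul_le_mul_of_nonneg_left (H.le_deflatedShadow h) hs
    linarith
  · rw [max_eq_right hs, max_eq_left (neg_nonneg.2 hs)]
    have := mul_le_mul_of_nonpos_left (H.deflatedShadow_le h) hs
    linarith

/-- Deflated wealth has expectation at most the initial capital. -/
theorem treeExp_deflated_wealth_le (H : IntegerStep p d lam c n) {φ : Strategy} {x : ℝ} {T : ℕ}
    (hφ : φ.SelfFinancing d lam x T) :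
    treeExp p T (fun h => φ.wealth d lam h * deflator (odds p) d c n h) ≤ x := by
  have hp1 : 0 < 1 - p := sub_pos.2 H.p_lt
  refine (treeExp_mono H.p_pos H.p_lt fun h _ => H.wealth_mul_deflator_le φ h).trans ?_
  refine (treeExp_le_of_supermartingale H.p_pos H.p_lt T fun h hh => ?_).trans ?_
  · obtain ⟨a1, a2⟩ := hφ (true :: h) (by simp; omega)
    obtain ⟨b1, b2⟩ := hφ (false :: h) (by simp; omega)
    have ha := H.deflated_trade_nonpos a1 a2
    have hb := H.deflated_trade_nonpos b1 b2
    -- The two martingale properties move the fixed holdings from node h to its two children at no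
    -- change of expected deflated value; the trades at the children can only lose value at the
    -- shadow price.
    have e1 := H.deflator_martingale h
    have e2 := H.deflatedShadow_martingale h
    simp only [Strategy.bondBefore, Strategy.stockBefore] at ha hb
    rw [← e1, ← e2]
    nlinarith [mul_le_mul_of_nonneg_left ha H.p_pos.le, mul_le_mul_of_nonneg_left hb hp1.le]
  · obtain ⟨a1, a2⟩ := hφ [] (Nat.zero_le _)
    have ha := H.deflated_trade_nonpos a1 a2
    have hc := H.c_pos
    have : deflator (odds p) d c n [] = 1 := by
      simp only [deflator, scale, level, invWealth_zero]
      field_simp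
    simp only [Strategy.bondBefore, Strategy.stockBefore, this] at ha ⊢
    linarith

end IntegerStep

/-! ### Closed forms -/

theorem rFn_eq {p d c : ℝ} (hp : p < 1) (hd : d < 1) (hc : 0 < c) :
    rFn p d c = numFactor (odds p) d c * denFactor (odds p) d c / c := by
  have h1 : 1 - p ≠ 0 := (sub_pos.2 hp).ne'
  have h2 : 1 - d ≠ 0 := (sub_pos.2 hd).ne'
  unfold rFn numFactor denFactor odds
  field_simp
  ring

/-- Isolates the factor 1 - β, which vanishes at p = 1/2. It cancels against the logarithm of the
odds in `stepCount`, so `geomSum` carries the part that survives at p = 1/2. -/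
theorem rFn_sub_one {p d c : ℝ} (hp : p < 1) (hd : d < 1) (hc : 0 < c) :
    rFn p d c = 1 + (1 - odds p) * geomSum (odds p) d c := by
  have h2 : 1 - d ≠ 0 := (sub_pos.2 hd).ne'
  rw [rFn_eq hp hd hc]
  unfold numFactor denFactor geomSum
  field_simp
  ring

theorem odds_half : odds (1 / 2) = 1 := by norm_num [odds]

theorem log_inv_odds_ne {p : ℝ} (h0 : 0 < p) (h1 : p < 1) (hp : p ≠ 1 / 2) :
    Real.log ((1 - p) / p) ≠ 0 := by
  have h2 : 0 < 1 - p := sub_pos.2 h1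
  refine Real.log_ne_zero_of_pos_of_ne_one (by positivity) fun h => hp ?_
  rw [div_eq_one_iff_eq h0.ne'] at h
  linarith

/-- For p ≠ 1/2, exchanging base and exponent turns r^(log d / log((1 - p)/p)) into d^k, and r =
AB/c reduces A²/r to cA/B. For p = 1/2, A = c and B = 1. This single form serves both cases. -/
theorem costFn_eq {p d c : ℝ} (h1 : p < 1) (hd0 : 0 < d) (hd1 : d < 1) (hc : 0 < c)
    (hA : 0 < numFactor (odds p) d c) (hB : 0 < denFactor (odds p) d c) :
    costFn p d c = 1 - c * (numFactor (odds p) d c / denFactor (odds p) d c)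
      * d ^ stepCount p d c := by
  have hd' : 1 - d ≠ 0 := (sub_pos.2 hd1).ne'
  unfold costFn stepCount
  split_ifs with hp
  · rw [hp, odds_half]
    have e1 : numFactor 1 d c = c := by unfold numFactor; field_simp; ring
    have e2 : denFactor 1 d c = 1 := by unfold denFactor; field_simp; ring
    rw [e1, e2]; ring
  · have hp1 : 1 - p ≠ 0 := (sub_pos.2 h1).ne'
    have hr : 0 < rFn p d c := by rw [rFn_eq h1 hd1 hc]; positivity
    have e1 : (c * (p + p * d - d) + d * (2 * p - 1)) / ((1 - d) * (1 - p))
        = numFactor (odds p) d c := by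
      unfold numFactor odds; field_simp; ring
    have e2 : rFn p d c ^ (Real.log d / Real.log ((1 - p) / p))
        = d ^ (Real.log (rFn p d c) / Real.log ((1 - p) / p)) := by
      rw [Real.rpow_def_of_pos hr, Real.rpow_def_of_pos hd0]; congr 1; ring
    rw [e1, Real.rpow_sub_one hr.ne', e2, rFn_eq h1 hd1 hc]
    field_simp

/-- If `stepCount` is a natural number, the no-trade region is described by `IntegerStep`. -/
theorem IntegerStep.of_stepCount {p d lam c : ℝ} {n : ℕ} (h0 : 0 < p) (h1 : p < 1) (hd0 : 0 < d)
    (hd1 : d < 1) (hc : 0 < c) (hA : 0 < numFactor (odds p) d c)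
    (hB : 0 < denFactor (odds p) d c) (hl0 : 0 < lam) (hl1 : lam < 1) (hn : 0 < n)
    (hk : stepCount p d c = n) (hF : costFn p d c = lam) : IntegerStep p d lam c n := by
  refine ⟨h0, h1, hd0, hd1, hc, hA, hB, hn, hl0, hl1, ?_, ?_⟩
  · have hd' : 1 - d ≠ 0 := (sub_pos.2 hd1).ne'
    unfold stepCount at hk
    split_ifs at hk with hp
    · subst hp
      rw [odds_half, geomSum]
      simp only [inv_one, one_pow, Finset.sum_const, Finset.card_range, nsmul_eq_mul, mul_one]
      rw [← hk]
      field_simp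
    · have hβ := ShadowBinomial.odds_pos h0 h1
      have hr : 0 < rFn p d c := by rw [rFn_eq h1 hd1 hc]; positivity
      have hp1 : 0 < 1 - p := sub_pos.2 h1
      have hβ1 : odds p ≠ 1 := by
        intro h; unfold odds at h
        rw [div_eq_one_iff_eq hp1.ne'] at h
        exact hp (by linarith)
      have hβ2 : (odds p)⁻¹ ≠ 1 := by simpa using hβ1
      rw [div_eq_iff (log_inv_odds_ne h0 h1 hp)] at hk
      have e0 : (1 - p) / p = (odds p)⁻¹ := by unfold odds; rw [inv_div]
      -- An integer value of k means that r is a power of 1/β; comparing with `rFn_sub_one` gives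
      -- the finite geometric sum.
      have e1 : rFn p d c = (odds p)⁻¹ ^ n := by
        rw [e0, ← Real.log_pow] at hk
        exact Real.log_injOn_pos hr (pow_pos (inv_pos.2 hβ) n) hk
      rw [rFn_sub_one h1 hd1 hc] at e1
      simp only [pow_succ]
      rw [← Finset.sum_mul, geom_sum_eq hβ2, ← e1]
      have : 1 - odds p ≠ 0 := sub_ne_zero.2 (Ne.symm hβ1)
      have h3 : (odds p)⁻¹ - 1 = (1 - odds p) / odds p := by field_simp
      rw [h3]
      field_simp
      ring
  · rw [costFn_eq h1 hd0 hd1 hc hA hB, hk, Real.rpow_natCast] at hF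
    linarith

/-- Summing the geometric series in the denominator of `meanReward` gives the formula for p ≠ 1/2.
For p = 1/2 the series has n + 1 equal terms, with n + 1 = (c² - d)/(c(1 - d)), and the two
logarithms combine into a square. -/
theorem meanReward_eq_growthFormula {p d c : ℝ} {n : ℕ} (h0 : 0 < p) (h1 : p < 1) (hd0 : 0 < d)
    (hd1 : d < 1) (hc : 0 < c) (hk : stepCount p d c = n) :
    meanReward p d c n = growthFormula p d c := by
  have hd' : 1 - d ≠ 0 := (sub_pos.2 hd1).ne'
  have hp1 : 0 < 1 - p := sub_pos.2 h1
  have hβ := odds_pos h0 h1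
  unfold growthFormula
  split_ifs with hp
  · have hs : 0 < √d := Real.sqrt_pos.2 hd0
    have hk' := hk
    unfold stepCount at hk'
    rw [if_pos hp, div_eq_iff (by positivity)] at hk'
    have hn : (0 : ℝ) < n + 1 := by positivity
    have e : c ^ 2 - d = (n + 1) * (c * (1 - d)) := by linarith
    unfold meanReward upperReward lowerReward
    rw [hp, odds_half, e]
    simp only [inv_one, one_pow, Finset.sum_const, Finset.card_range, nsmul_eq_mul, mul_one,
      one_mul]
    rw [← Real.log_mul (by positivity) (by positivity)]
    have e2 : (c + d) / (d * (c + 1)) * ((c + d) / (c + 1))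
        = ((c + d) / (√d * (c + 1))) ^ 2 := by
      rw [div_pow, mul_pow, Real.sq_sqrt hd0.le]; field_simp
    rw [e2, Real.log_pow]
    push_cast
    field_simp
  · have hβ1 : odds p ≠ 1 := by
      intro h; unfold odds at h
      rw [div_eq_one_iff_eq hp1.ne'] at h
      exact hp (by linarith)
    have hβ2 : (odds p)⁻¹ ≠ 1 := by simpa using hβ1
    have e1 : (c + d) * p / ((c + 1) * (1 - p) * d) = odds p * (c + d) / (d * (c + 1)) := by
      unfold odds; field_simp
    have e2 : p / (1 - p) = odds p := rfl
    have e3 : (n : ℝ) + 1 = ((n + 1 : ℕ) : ℝ) := by push_cast; rfl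
    rw [hk, e1, e2, e3, Real.rpow_natCast, Real.rpow_natCast]
    unfold meanReward upperReward lowerReward
    rw [geom_sum_eq hβ2]
    have e4 : 1 - odds p ^ (n + 1) ≠ 0 := by
      intro h
      have h4 : odds p ^ (n + 1) = 1 := by linarith
      rw [pow_eq_one_iff_of_nonneg hβ.le (by omega)] at h4
      exact hβ1 h4
    have e5 : (odds p)⁻¹ ^ (n + 1) - 1 = (1 - odds p ^ (n + 1)) / odds p ^ (n + 1) := by
      rw [inv_pow]; field_simp
    have e6 : (odds p)⁻¹ - 1 = (1 - 2 * p) / p := by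
      unfold odds; field_simp; ring
    have e7 : 1 - 2 * p ≠ 0 := fun h => hp (by linarith)
    have e8 : p = (1 - p) * odds p := by unfold odds; field_simp
    rw [e5, e6, inv_pow]
    generalize Real.log ((c + d) / (c + 1)) = L₀
    generalize Real.log (odds p * (c + d) / (d * (c + 1))) = L₁
    have e9 : (1 - p) * L₀ + p * odds p ^ n * L₁ = (1 - p) * (L₀ + odds p ^ (n + 1) * L₁) := by
      rw [pow_succ]; linear_combination (odds p ^ n * L₁) * e8
    rw [e9]
    field_simp
    ring

/-! ### The growth rate -/

theorem coe_finset_sum_real {ι : Type*} (s : Finset ι) (f : ι → ℝ) :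
    ((∑ i ∈ s, f i : ℝ) : EReal) = ∑ i ∈ s, (f i : EReal) :=
  map_sum (⟨⟨Real.toEReal, EReal.coe_zero⟩, EReal.coe_add⟩ : ℝ →+ EReal) f s

theorem expectedLog_le {φ : Strategy} {p d lam : ℝ} (h0 : 0 < p) (h1 : p < 1) {T : ℕ}
    {X : List Bool → ℝ}
    (hX : ∀ h, h.length = T → 0 < φ.wealth d lam h → Real.log (φ.wealth d lam h) ≤ X h) :
    φ.expectedLog p d lam T ≤ (treeExp p T X : ℝ) := by
  unfold Strategy.expectedLog treeExp
  rw [coe_finset_sum_real]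
  refine Finset.sum_le_sum fun w _ => ?_
  have hq := nodeProb_pos h0 h1 (List.ofFn w)
  rcases le_or_gt (φ.wealth d lam (List.ofFn w)) 0 with hw | hw
  · rw [ENNReal.ofReal_of_nonpos hw, ENNReal.log_zero, EReal.coe_mul_bot_of_pos hq]
    exact bot_le
  · rw [ENNReal.log_ofReal_of_pos hw, ← EReal.coe_mul, EReal.coe_le_coe_iff]
    exact mul_le_mul_of_nonneg_left (hX _ (by simp) hw) hq.le

theorem le_expectedLog {φ : Strategy} {p d lam : ℝ} (h0 : 0 < p) (h1 : p < 1) {T : ℕ}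
    {X : List Bool → ℝ} (hw : ∀ h, h.length = T → 0 < φ.wealth d lam h)
    (hX : ∀ h, h.length = T → X h ≤ Real.log (φ.wealth d lam h)) :
    (treeExp p T X : ℝ) ≤ φ.expectedLog p d lam T := by
  unfold Strategy.expectedLog treeExp
  rw [coe_finset_sum_real]
  refine Finset.sum_le_sum fun w _ => ?_
  have hq := nodeProb_pos h0 h1 (List.ofFn w)
  rw [ENNReal.log_ofReal_of_pos (hw _ (by simp)), ← EReal.coe_mul, EReal.coe_le_coe_iff]
  exact mul_le_mul_of_nonneg_left (hX _ (by simp)) hq.le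

namespace IntegerStep

variable {p d lam c : ℝ} {n : ℕ}

theorem basePrice_pos (H : IntegerStep p d lam c n) (h : List Bool) : 0 < basePrice d n h :=
  mul_pos (price_pos H.d_pos h) (pow_pos H.d_pos _)

theorem reflectedStrategy_buy (H : IntegerStep p d lam c n) {Δb Δs P : ℝ} (hP : 0 ≤ P)
    (hs : 0 ≤ Δs) (h : Δb + Δs * P = 0) :
    Δb + Δs * P ≤ 0 ∧ Δb + Δs * ((1 - lam) * P) ≤ 0 := by
  refine ⟨h.le, ?_⟩
  have := mul_nonneg (mul_nonneg hs hP) H.lam_pos.le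
  nlinarith

theorem reflectedStrategy_sell (H : IntegerStep p d lam c n) {Δb Δs P : ℝ} (hP : 0 ≤ P)
    (hs : Δs ≤ 0) (h : Δb + Δs * ((1 - lam) * P) = 0) :
    Δb + Δs * P ≤ 0 ∧ Δb + Δs * ((1 - lam) * P) ≤ 0 := by
  refine ⟨?_, h.le⟩
  have := mul_nonneg (mul_nonneg (neg_nonneg.2 hs) hP) H.lam_pos.le
  nlinarith

/-- The holdings change only initially and at reflections. The strategy buys at the ask at level 0
and sells at the bid at level n, each time with equality in the budget constraint; the other
inequality holds because the trade has the right sign. -/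
theorem reflectedStrategy_selfFinancing (H : IntegerStep p d lam c n) {x : ℝ} (hx : 0 < x)
    (T : ℕ) : (reflectedStrategy (odds p) d c x n).SelfFinancing d lam x T := by
  have hc := H.c_pos
  have hd := H.d_pos
  have hd1 : 0 < 1 - d := sub_pos.2 H.d_lt
  have hβ := H.odds_pos
  intro h _
  match h with
  | [] =>
    refine H.reflectedStrategy_buy (price_pos hd _).le ?_ ?_
    · simp only [reflectedStrategy, Strategy.stockBefore, scale, basePrice, level, price, pow_zero,
        mul_one, sub_zero]
      positivity
    · simp only [reflectedStrategy, Strategy.stockBefore, Strategy.bondBefore, scale, basePrice,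
        level, price, pow_zero, mul_one, sub_zero]
      field_simp
      ring
  | false :: h =>
    have hW := scale_pos hβ hd hc n h
    have hS := price_pos hd h
    simp only [reflectedStrategy, Strategy.stockBefore, Strategy.bondBefore, basePrice,
      level_false, scale_false]
    rcases Nat.eq_zero_or_pos (level n h) with h0 | h0
    · simp only [h0, if_true, Nat.zero_sub, pow_zero, mul_one, price_false]
      refine H.reflectedStrategy_buy (by positivity) ?_ ?_
      · rw [sub_nonneg]
        refine div_le_div_of_nonneg_left hx.le (by positivity) ?_
        have : (c + 1) / (c + d) * d ≤ 1 := by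
          rw [div_mul_eq_mul_div, div_le_one (by positivity)]; nlinarith
        calc scale (odds p) d c n h * ((c + 1) / (c + d)) * (d * price d h)
            = scale (odds p) d c n h * price d h * ((c + 1) / (c + d) * d) := by ring
          _ ≤ scale (odds p) d c n h * price d h * 1 := by gcongr
          _ = _ := by ring
      · field_simp
        ring
    · obtain ⟨j, hj⟩ : ∃ j, level n h = j + 1 := ⟨level n h - 1, by omega⟩
      simp only [hj, Nat.succ_ne_zero, if_false, add_tsub_cancel_right, price_false]
      have e : d * price d h * d ^ j = price d h * d ^ (j + 1) := by ring
      rw [e]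
      simp
  | true :: h =>
    have hW := scale_pos hβ hd hc n h
    have hS := price_pos hd h
    simp only [reflectedStrategy, Strategy.stockBefore, Strategy.bondBefore, basePrice,
      level_true, scale_true]
    by_cases h0 : level n h = n
    · simp only [h0, if_true, price_true]
      have hB := H.den_pos
      -- The reflection at the top multiplies the number of stocks by β(c + d)/(c + 1); positivity
      -- of B makes this at most 1, so it is indeed a sale.
      have e1 : odds p * (c + d) = c + 1 - (1 - d) * denFactor (odds p) d c := by
        unfold denFactor; field_simp; ring
      have e2 : numFactor (odds p) d c = c + 1 - denFactor (odds p) d c := by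
        unfold denFactor numFactor; field_simp; ring
      refine H.reflectedStrategy_sell (by positivity) ?_ ?_
      · rw [sub_nonpos]
        refine div_le_div_of_nonneg_left hx.le (by positivity) ?_
        have : 1 ≤ (c + 1) / (odds p * (c + d)) := by
          rw [one_le_div (by positivity), e1]
          linarith [mul_pos hd1 hB]
        calc scale (odds p) d c n h * (price d h * d ^ n)
            = scale (odds p) d c n h * (price d h * d ^ n) * 1 := by ring
          _ ≤ scale (odds p) d c n h * (price d h * d ^ n) * ((c + 1) / (odds p * (c + d))) := by
            gcongr
          _ = _ := by field_simp
      · rw [H.cost, e2]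
        have e3 : c + 1 - (1 - d) * denFactor (odds p) d c ≠ 0 := by
          rw [← e1]; positivity
        rw [e1]
        generalize denFactor (odds p) d c = B at *
        field_simp
        ring
    · simp only [h0, if_false, price_true]
      have e : d⁻¹ * price d h * d ^ (level n h + 1) = price d h * d ^ level n h := by
        rw [pow_succ]; field_simp
      rw [e]
      simp

theorem le_reflectedStrategy_wealth (H : IntegerStep p d lam c n) {x : ℝ} (hx : 0 < x)
    (h : List Bool) :
    c * x / scale (odds p) d c n h ≤ (reflectedStrategy (odds p) d c x n).wealth d lam h := by
  have hc := H.c_pos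
  have hW := scale_pos H.odds_pos H.d_pos H.c_pos n h
  have hS := price_pos H.d_pos h
  have hm := H.basePrice_pos h
  have hl : 0 < 1 - lam := sub_pos.2 H.lam_lt
  have hN : 0 < x / (scale (odds p) d c n h * basePrice d n h) := by positivity
  simp only [reflectedStrategy, Strategy.wealth]
  rw [max_eq_left hN.le, max_eq_right (neg_nonpos.2 hN.le), zero_mul, sub_zero]
  have := mul_pos hN (mul_pos hl hS)
  linarith

theorem reflectedStrategy_admissible (H : IntegerStep p d lam c n) {x : ℝ} (hx : 0 < x) (T : ℕ) :
    (reflectedStrategy (odds p) d c x n).Admissible d lam x T := by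
  have hc := H.c_pos
  refine ⟨H.reflectedStrategy_selfFinancing hx T, fun h _ => ?_⟩
  have hW := scale_pos H.odds_pos H.d_pos H.c_pos n h
  exact le_trans (by positivity) (H.le_reflectedStrategy_wealth hx h)

theorem treeExp_scale (H : IntegerStep p d lam c n) (T : ℕ) :
    treeExp p T (fun h => -Real.log (scale (odds p) d c n h) + poissonSol p d c n (level n h))
      = -Real.log (c + 1) + T * meanReward p d c n := by
  rw [treeExp_eq_of_drift H.drift]
  simp [scale, level, poissonSol]

/-- There are only finitely many levels, so every correction that depends on the level alone
disappears after division by T. -/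
theorem bddAbove_level (f : ℕ → ℝ) (n : ℕ) : ∃ C, ∀ h, |f (level n h)| ≤ C := by
  refine ⟨∑ j ∈ Finset.range (n + 1), |f j|, fun h => ?_⟩
  exact Finset.single_le_sum (f := fun j => |f j|) (fun _ _ => abs_nonneg _)
    (Finset.mem_range.2 (Nat.lt_succ_of_le (level_le n h)))

theorem le_optimalUtility (H : IntegerStep p d lam c n) {x : ℝ} (hx : 0 < x) :
    ∃ C : ℝ, ∀ T : ℕ, ((T * meanReward p d c n - C : ℝ) : EReal) ≤ optimalUtility p d lam x T := by
  obtain ⟨C, hC⟩ := bddAbove_level (poissonSol p d c n) n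
  have hc := H.c_pos
  refine ⟨C - Real.log (c * x) + Real.log (c + 1), fun T => ?_⟩
  have hle := le_expectedLog (φ := reflectedStrategy (odds p) d c x n) (lam := lam) (d := d)
    H.p_pos H.p_lt (T := T)
    (X := fun h => (-Real.log (scale (odds p) d c n h) + poissonSol p d c n (level n h))
      + (Real.log (c * x) - C)) ?_ ?_
  · rw [treeExp_add, treeExp_const, H.treeExp_scale] at hle
    refine le_trans ?_ (hle.trans (le_iSup₂_of_le _ (H.reflectedStrategy_admissible hx T) le_rfl))
    rw [EReal.coe_le_coe_iff]
    linarith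
  · intro h _
    have hW := scale_pos H.odds_pos H.d_pos H.c_pos n h
    exact lt_of_lt_of_le (by positivity) (H.le_reflectedStrategy_wealth hx h)
  · intro h _
    have hW := scale_pos H.odds_pos H.d_pos H.c_pos n h
    refine le_trans ?_ (Real.log_le_log (by positivity) (H.le_reflectedStrategy_wealth hx h))
    rw [Real.log_div (by positivity) (by positivity)]
    linarith [(abs_le.1 (hC h)).2]

theorem optimalUtility_le (H : IntegerStep p d lam c n) (x : ℝ) :
    ∃ C : ℝ, ∀ T : ℕ, optimalUtility p d lam x T ≤ ((T * meanReward p d c n + C : ℝ) : EReal) := by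
  obtain ⟨C, hC⟩ := bddAbove_level (poissonSol p d c n) n
  obtain ⟨D, hD⟩ := bddAbove_level (fun j => Real.log (invWealth (odds p) d c j)) n
  refine ⟨x + C + D - Real.log (c + 1), fun T => iSup₂_le fun φ hφ => ?_⟩
  refine (expectedLog_le (X := fun h => φ.wealth d lam h * deflator (odds p) d c n h
    + ((-Real.log (scale (odds p) d c n h) + poissonSol p d c n (level n h)) + (C + D)))
    H.p_pos H.p_lt fun h _ hw => ?_).trans ?_
  · have hW := scale_pos H.odds_pos H.d_pos H.c_pos n h
    have hY := H.deflator_pos h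
    have hω := H.invWealth_pos (level_le n h)
    -- Duality for log utility: log V ≤ VY - 1 - log Y with Y the deflator. E[VY] is at most x by
    -- the supermartingale bound, and -log Y is the log wealth of the reflected strategy up to a
    -- bounded term.
    have h1 := Real.log_le_sub_one_of_pos (mul_pos hw hY)
    rw [Real.log_mul hw.ne' hY.ne'] at h1
    have h2 : Real.log (deflator (odds p) d c n h) = Real.log (scale (odds p) d c n h)
        + Real.log (invWealth (odds p) d c (level n h)) := Real.log_mul hW.ne' hω.ne'
    have h3 := (abs_le.1 (hC h)).1
    have h4 := (abs_le.1 (hD h)).1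
    linarith
  · rw [EReal.coe_le_coe_iff, treeExp_add, treeExp_add, treeExp_const, H.treeExp_scale]
    linarith [H.treeExp_deflated_wealth_le hφ.1]

theorem optimalGrowthRate_eq (H : IntegerStep p d lam c n) {x : ℝ} (hx : 0 < x) :
    optimalGrowthRate p d lam x = (meanReward p d c n : EReal) := by
  obtain ⟨C, hC⟩ := H.le_optimalUtility hx
  obtain ⟨D, hD⟩ := H.optimalUtility_le x
  have hinv : Tendsto (fun T : ℕ => (T : ℝ)⁻¹) atTop (𝓝 0) :=
    tendsto_inv_atTop_zero.comp tendsto_natCast_atTop_atTop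
  have hlim (E : ℝ) : Tendsto (fun T : ℕ => (((T : ℝ)⁻¹ * (T * meanReward p d c n + E) : ℝ) : EReal))
      atTop (𝓝 (meanReward p d c n : EReal)) := by
    refine continuous_coe_real_ereal.continuousAt.tendsto.comp ?_
    have h1 : Tendsto (fun T : ℕ => meanReward p d c n + (T : ℝ)⁻¹ * E) atTop
        (𝓝 (meanReward p d c n + 0 * E)) := tendsto_const_nhds.add (hinv.mul_const E)
    rw [zero_mul, add_zero] at h1
    refine h1.congr' ?_
    filter_upwards [eventually_gt_atTop 0] with T hT
    have : (T : ℝ) ≠ 0 := by exact_mod_cast hT.ne'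
    field_simp
  refine Tendsto.limsup_eq (tendsto_of_tendsto_of_tendsto_of_le_of_le (hlim (-C)) (hlim D)
    (fun T => ?_) (fun T => ?_))
  · simp only [EReal.coe_mul]
    exact mul_le_mul_of_nonneg_left (hC T) (by exact_mod_cast inv_nonneg.2 (Nat.cast_nonneg T))
  · simp only [EReal.coe_mul]
    exact mul_le_mul_of_nonneg_left (hD T) (by exact_mod_cast inv_nonneg.2 (Nat.cast_nonneg T))

end IntegerStep

/-! ### Partial derivatives and uniform Taylor expansions -/

/-- Partial derivative with respect to the first variable. -/
def partialFst (f : ℝ × ℝ → ℝ) (q : ℝ × ℝ) : ℝ := fderiv ℝ f q (1, 0)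

theorem AnalyticAt.partialFst {f : ℝ × ℝ → ℝ} {q : ℝ × ℝ} (hf : AnalyticAt ℝ f q) :
    AnalyticAt ℝ (partialFst f) q :=
  (ContinuousLinearMap.apply ℝ ℝ ((1, 0) : ℝ × ℝ)).analyticAt _ |>.comp hf.fderiv

theorem hasDerivAt_partialFst {f : ℝ × ℝ → ℝ} {c h : ℝ} (hf : AnalyticAt ℝ f (c, h)) :
    HasDerivAt (fun s => f (s, h)) (partialFst f (c, h)) c := by
  have h1 : HasDerivAt (fun s : ℝ => (s, h)) (1, 0) c :=
    (hasDerivAt_id c).prodMk (hasDerivAt_const c h)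
  exact hf.differentiableAt.hasFDerivAt.comp_hasDerivAt c h1

/-- The mean value inequality with the bound on the derivative evaluated at the far end. Each use
raises the order of a Taylor remainder by one and keeps the constant M, which is how uniformity in
the second variable is preserved. -/
theorem abs_sub_le_of_deriv_le_pow {g g' : ℝ → ℝ} {c c' M : ℝ} {n : ℕ} (hM : 0 ≤ M)
    (hg : ∀ s ∈ uIcc c c', HasDerivAt g (g' s) s)
    (hb : ∀ s ∈ uIcc c c', |g' s| ≤ M * |s - c| ^ n) :
    |g c' - g c| ≤ M * |c' - c| ^ (n + 1) := by
  have h := (convex_uIcc c c').norm_image_sub_le_of_norm_hasDerivWithin_le (f := g) (f' := g')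
    (C := M * |c' - c| ^ n) (fun s hs => (hg s hs).hasDerivWithinAt)
    (fun s hs => (hb s hs).trans ?_) left_mem_uIcc right_mem_uIcc
  · rw [Real.norm_eq_abs, Real.norm_eq_abs] at h
    rw [pow_succ, ← mul_assoc]; exact h
  · have := abs_sub_left_of_mem_uIcc hs
    gcongr

theorem exists_lipschitz_ball {f : ℝ × ℝ → ℝ} {q₀ : ℝ × ℝ} (hf : AnalyticAt ℝ f q₀) :
    ∃ ρ > 0, ∃ M > 0, ∀ q ∈ Metric.ball q₀ ρ, ∀ q' ∈ Metric.ball q₀ ρ,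
      |f q' - f q| ≤ M * dist q' q := by
  obtain ⟨K, t, ht, hK⟩ := (hf.contDiffAt (n := 1)).exists_lipschitzOnWith
  obtain ⟨ρ, hρ, hsub⟩ := Metric.mem_nhds_iff.1 ht
  refine ⟨ρ, hρ, K + 1, by positivity, fun q hq q' hq' => ?_⟩
  have := hK.dist_le_mul q' (hsub hq') q (hsub hq)
  rw [Real.dist_eq] at this
  refine this.trans ?_
  have := dist_nonneg (x := q') (y := q)
  nlinarith

theorem mem_ball_prod {c₀ ρ c h : ℝ} (hc : |c - c₀| < ρ) (hh : |h| < ρ) :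
    ((c, h) : ℝ × ℝ) ∈ Metric.ball (c₀, (0 : ℝ)) ρ := by
  simp [Prod.dist_eq, Real.dist_eq, hc, hh]

theorem exists_analytic_ball {f : ℝ × ℝ → ℝ} {q₀ : ℝ × ℝ} (hf : AnalyticAt ℝ f q₀) :
    ∃ ρ > 0, ∀ q ∈ Metric.ball q₀ ρ, AnalyticAt ℝ f q := by
  obtain ⟨ρ, hρ, hsub⟩ := Metric.eventually_nhds_iff_ball.1 hf.eventually_analyticAt
  exact ⟨ρ, hρ, hsub⟩

theorem abs_sub_lt_of_mem_uIcc {c c' c₀ s ρ : ℝ} (h1 : |c - c₀| < ρ) (h2 : |c' - c₀| < ρ)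
    (hs : s ∈ uIcc c c') : |s - c₀| < ρ := by
  have := (convex_ball c₀ ρ).ordConnected.uIcc_subset (x := c) (y := c')
    (by simpa [Real.dist_eq] using h1) (by simpa [Real.dist_eq] using h2) hs
  simpa [Real.dist_eq] using this

/-- First order Taylor expansion in the first variable, uniform in the second one. -/
theorem exists_taylor_one {f : ℝ × ℝ → ℝ} {c₀ : ℝ} (hf : AnalyticAt ℝ f (c₀, 0)) :
    ∃ ρ > 0, ∃ M > 0, ∀ h c c', |h| < ρ → |c - c₀| < ρ → |c' - c₀| < ρ →
      |f (c', h) - f (c, h) - partialFst f (c, h) * (c' - c)| ≤ M * |c' - c| ^ 2 := by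
  obtain ⟨ρ₁, hρ₁, ha⟩ := exists_analytic_ball hf
  obtain ⟨ρ₂, hρ₂, M, hM, hl⟩ := exists_lipschitz_ball (AnalyticAt.partialFst hf)
  refine ⟨min ρ₁ ρ₂, lt_min hρ₁ hρ₂, M, hM, fun h c c' hh hc hc' => ?_⟩
  rw [lt_min_iff] at hh hc hc'
  have key := abs_sub_le_of_deriv_le_pow (c := c) (c' := c') (n := 1) hM.le
    (g := fun s => f (s, h) - f (c, h) - partialFst f (c, h) * (s - c))
    (g' := fun s => partialFst f (s, h) - partialFst f (c, h)) ?_ ?_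
  · simpa using key
  · intro s hs
    have hs1 := abs_sub_lt_of_mem_uIcc hc.1 hc'.1 hs
    have h1 := hasDerivAt_partialFst (ha _ (mem_ball_prod hs1 hh.1))
    have h2 := ((hasDerivAt_id s).sub_const c).const_mul (partialFst f (c, h))
    exact ((h1.sub_const (f (c, h))).sub h2).congr_deriv (by simp)
  · intro s hs
    have hs2 := abs_sub_lt_of_mem_uIcc hc.2 hc'.2 hs
    have := hl _ (mem_ball_prod hc.2 hh.2) _ (mem_ball_prod hs2 hh.2)
    simpa [Prod.dist_eq, Real.dist_eq] using this

/-- Third order Taylor expansion in the first variable, uniform in the second one. -/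
theorem exists_taylor_three {f : ℝ × ℝ → ℝ} {c₀ : ℝ} (hf : AnalyticAt ℝ f (c₀, 0)) :
    ∃ ρ > 0, ∃ M > 0, ∀ h c c', |h| < ρ → |c - c₀| < ρ → |c' - c₀| < ρ →
      |f (c', h) - f (c, h) - partialFst f (c, h) * (c' - c)
        - partialFst (partialFst f) (c, h) / 2 * (c' - c) ^ 2
        - partialFst (partialFst (partialFst f)) (c, h) / 6 * (c' - c) ^ 3|
        ≤ M * |c' - c| ^ 4 := by
  have hf1 := AnalyticAt.partialFst hf
  have hf2 := AnalyticAt.partialFst hf1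
  obtain ⟨ρ₁, hρ₁, ha⟩ := exists_analytic_ball hf
  obtain ⟨ρ₂, hρ₂, ha1⟩ := exists_analytic_ball hf1
  obtain ⟨ρ₃, hρ₃, M, hM, h2⟩ := exists_taylor_one hf2
  refine ⟨min ρ₁ (min ρ₂ ρ₃), lt_min hρ₁ (lt_min hρ₂ hρ₃), M, hM, fun h c c' hh hc hc' => ?_⟩
  simp only [lt_min_iff] at hh hc hc'
  -- The first order expansion of the second derivative is integrated twice: it gives a cubic
  -- remainder for the first derivative here, and then a quartic one for f.
  have key1 (t : ℝ) (ht2 : |t - c₀| < ρ₂) (ht3 : |t - c₀| < ρ₃) :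
      |partialFst f (t, h) - partialFst f (c, h) - partialFst (partialFst f) (c, h) * (t - c)
        - partialFst (partialFst (partialFst f)) (c, h) / 2 * (t - c) ^ 2|
        ≤ M * |t - c| ^ 3 := by
    have key := abs_sub_le_of_deriv_le_pow (c := c) (c' := t) (n := 2) hM.le
      (g := fun s => partialFst f (s, h) - partialFst f (c, h)
        - partialFst (partialFst f) (c, h) * (s - c)
        - partialFst (partialFst (partialFst f)) (c, h) / 2 * (s - c) ^ 2)
      (g' := fun s => partialFst (partialFst f) (s, h) - partialFst (partialFst f) (c, h)
        - partialFst (partialFst (partialFst f)) (c, h) * (s - c)) ?_ ?_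
    · simpa using key
    · intro s hs
      have hs1 := abs_sub_lt_of_mem_uIcc hc.2.1 ht2 hs
      have h1 := hasDerivAt_partialFst (ha1 _ (mem_ball_prod hs1 hh.2.1))
      have e1 := (hasDerivAt_id s).sub_const c
      have e2 := e1.const_mul (partialFst (partialFst f) (c, h))
      have e3 := (e1.pow 2).const_mul (partialFst (partialFst (partialFst f)) (c, h) / 2)
      refine (((h1.sub_const (partialFst f (c, h))).sub e2).sub e3).congr_deriv ?_
      simp; ring
    · intro s hs
      exact h2 h c s hh.2.2 hc.2.2 (abs_sub_lt_of_mem_uIcc hc.2.2 ht3 hs)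
  have key := abs_sub_le_of_deriv_le_pow (c := c) (c' := c') (n := 3) hM.le
    (g := fun s => f (s, h) - f (c, h) - partialFst f (c, h) * (s - c)
      - partialFst (partialFst f) (c, h) / 2 * (s - c) ^ 2
      - partialFst (partialFst (partialFst f)) (c, h) / 6 * (s - c) ^ 3)
    (g' := fun s => partialFst f (s, h) - partialFst f (c, h)
      - partialFst (partialFst f) (c, h) * (s - c)
      - partialFst (partialFst (partialFst f)) (c, h) / 2 * (s - c) ^ 2) ?_ ?_
  · simpa using key
  · intro s hs
    have hs1 := abs_sub_lt_of_mem_uIcc hc.1 hc'.1 hs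
    have h1 := hasDerivAt_partialFst (ha _ (mem_ball_prod hs1 hh.1))
    have e1 := (hasDerivAt_id s).sub_const c
    have e2 := e1.const_mul (partialFst f (c, h))
    have e3 := (e1.pow 2).const_mul (partialFst (partialFst f) (c, h) / 2)
    have e4 := (e1.pow 3).const_mul (partialFst (partialFst (partialFst f)) (c, h) / 6)
    refine ((((h1.sub_const (f (c, h))).sub e2).sub e3).sub e4).congr_deriv ?_
    simp; ring
  · intro s hs
    exact key1 s (abs_sub_lt_of_mem_uIcc hc.2.1 hc'.2.1 hs)
      (abs_sub_lt_of_mem_uIcc hc.2.2 hc'.2.2 hs)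

/-! ### One-dimensional expansions at the origin -/

theorem isBigO_sub_of_hasDerivAt {f : ℝ → ℝ} {L : ℝ} (hf : AnalyticAt ℝ f 0)
    (hL : HasDerivAt f L 0) : (fun h => f h - (f 0 + L * h)) =O[𝓝 0] fun h => h ^ 2 := by
  have hg : AnalyticAt ℝ (fun q : ℝ × ℝ => f q.1) (0, 0) := 
    AnalyticAt.fun_comp (f := fun q : ℝ × ℝ => q.1) (g := f) (x := (0, 0)) hf analyticAt_fst
  obtain ⟨ρ, hρ, M, hM, h1⟩ := exists_taylor_one hg
  have hd : partialFst (fun q : ℝ × ℝ => f q.1) (0, 0) = L :=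
    (hasDerivAt_partialFst hg).unique hL
  refine IsBigO.of_bound M ?_
  filter_upwards [Metric.ball_mem_nhds (0 : ℝ) hρ] with h hh
  have := h1 0 0 h (by simpa using hρ) (by simpa using hρ)
    (by simpa [Real.dist_eq] using hh)
  rw [hd] at this
  rw [Real.norm_eq_abs, Real.norm_eq_abs, abs_pow]
  simp only [sub_zero] at this
  convert this using 2
  ring

theorem isBigO_id_of_zero {f : ℝ → ℝ} (hf : AnalyticAt ℝ f 0) (h0 : f 0 = 0) :
    f =O[𝓝 0] fun h => h := by
  have := hf.differentiableAt.isBigO_sub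
  simpa [h0] using this

theorem analyticAt_dslope {f : ℝ → ℝ} {a b : ℝ} (ha : AnalyticAt ℝ f a) (hb : AnalyticAt ℝ f b) :
    AnalyticAt ℝ (dslope f a) b := by
  rcases eq_or_ne b a with rfl | hne
  · obtain ⟨p, hp⟩ := ha
    exact ⟨_, hp.has_fpower_series_dslope_fslope⟩
  · refine AnalyticAt.congr ?_ (dslope_eventuallyEq_slope_of_ne f hne).symm
    simp only [slope_fun_def]
    exact ((analyticAt_id.sub analyticAt_const).inv (sub_ne_zero.2 hne)).smul
      (hb.sub analyticAt_const)

theorem mul_dslope_zero {f : ℝ → ℝ} (h0 : f 0 = 0) (x : ℝ) : x * dslope f 0 x = f x := by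
  simpa [h0] using sub_smul_dslope f 0 x

/-- With f = x g one has f' = g + x g' near 0. Differentiating once more at 0 gives f''(0) = 2
g'(0). -/
theorem hasDerivAt_dslope_zero {f f' : ℝ → ℝ} {L : ℝ} (hf : AnalyticAt ℝ f 0) (h0 : f 0 = 0)
    (h1 : ∀ᶠ x in 𝓝 0, HasDerivAt f (f' x) x) (h2 : HasDerivAt f' L 0) :
    HasDerivAt (dslope f 0) (L / 2) 0 := by
  have hg := analyticAt_dslope hf hf
  have e1 : f' =ᶠ[𝓝 0] fun x => dslope f 0 x + x * deriv (dslope f 0) x := by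
    filter_upwards [h1, hg.eventually_analyticAt] with x hx hgx
    have h3 := (hasDerivAt_id x).mul hgx.differentiableAt.hasDerivAt
    refine hx.unique ((h3.congr_of_eventuallyEq ?_).congr_deriv (by simp))
    exact Eventually.of_forall fun y => (mul_dslope_zero h0 y).symm
  have h3 := hg.differentiableAt.hasDerivAt
  have h4 := hg.deriv.differentiableAt.hasDerivAt
  have h5 := (h3.add ((hasDerivAt_id 0).mul h4)).congr_of_eventuallyEq e1
  have h6 := h2.unique h5
  simp at h6
  exact h3.congr_deriv (by linarith)

/-! ### The parameters as functions of `h = σ √δ` -/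

/-- The function `(1 - exp (-h)) / h`. -/
def expRatio : ℝ → ℝ := dslope (fun t => 1 - Real.exp (-t)) 0

/-- The function `log (1 + y) / y`. -/
def logRatio : ℝ → ℝ := dslope (fun t => Real.log (1 + t)) 0

theorem mul_expRatio (h : ℝ) : h * expRatio h = 1 - Real.exp (-h) :=
  mul_dslope_zero (f := fun t => 1 - Real.exp (-t)) (by simp) h

theorem mul_logRatio (y : ℝ) : y * logRatio y = Real.log (1 + y) :=
  mul_dslope_zero (f := fun t => Real.log (1 + t)) (by simp) y

theorem analyticAt_one_sub_exp (x : ℝ) : AnalyticAt ℝ (fun t : ℝ => 1 - Real.exp (-t)) x := by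
  fun_prop

theorem analyticAt_log_one_add {x : ℝ} (hx : 0 < 1 + x) :
    AnalyticAt ℝ (fun t : ℝ => Real.log (1 + t)) x :=
  (analyticAt_const.add analyticAt_id).log hx

@[fun_prop]
theorem analyticAt_expRatio (x : ℝ) : AnalyticAt ℝ expRatio x :=
  analyticAt_dslope (analyticAt_one_sub_exp 0) (analyticAt_one_sub_exp x)

theorem analyticAt_logRatio {x : ℝ} (hx : 0 < 1 + x) : AnalyticAt ℝ logRatio x :=
  analyticAt_dslope (analyticAt_log_one_add (by norm_num)) (analyticAt_log_one_add hx)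

theorem hasDerivAt_one_sub_exp (x : ℝ) :
    HasDerivAt (fun t : ℝ => 1 - Real.exp (-t)) (Real.exp (-x)) x := by
  simpa using ((hasDerivAt_neg x).exp).const_sub 1

theorem hasDerivAt_log_one_add {x : ℝ} (hx : 0 < 1 + x) :
    HasDerivAt (fun t : ℝ => Real.log (1 + t)) (1 / (1 + x)) x :=
  ((hasDerivAt_id x).const_add 1).log hx.ne'

theorem expRatio_zero : expRatio 0 = 1 := by
  unfold expRatio
  rw [dslope_same, (hasDerivAt_one_sub_exp 0).deriv]
  simp

theorem logRatio_zero : logRatio 0 = 1 := by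
  unfold logRatio
  rw [dslope_same, (hasDerivAt_log_one_add (by norm_num)).deriv]
  simp

theorem hasDerivAt_expRatio : HasDerivAt expRatio (-(1 / 2)) 0 := by
  have h : HasDerivAt (fun x : ℝ => Real.exp (-x)) (-1) 0 := by
    simpa using (hasDerivAt_neg (0 : ℝ)).exp
  refine (hasDerivAt_dslope_zero (analyticAt_one_sub_exp 0) (by simp)
    (Eventually.of_forall hasDerivAt_one_sub_exp) h).congr_deriv (by norm_num)

theorem hasDerivAt_logRatio : HasDerivAt logRatio (-(1 / 2)) 0 := by
  have h : HasDerivAt (fun x : ℝ => 1 / (1 + x)) (-1) 0 := by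
    have := ((hasDerivAt_id (0 : ℝ)).const_add 1).inv (by norm_num)
    refine (this.congr_of_eventuallyEq (Eventually.of_forall fun x => ?_)).congr_deriv (by simp)
    simp
  refine (hasDerivAt_dslope_zero (analyticAt_log_one_add (by norm_num)) (by simp)
    ?_ h).congr_deriv (by norm_num)
  filter_upwards [eventually_gt_nhds (show (-1 : ℝ) < 0 by norm_num)] with x hx
  exact hasDerivAt_log_one_add (by linarith)

/-- The function `(h / 2) coth (h / 2)`. -/
def halfCoth (h : ℝ) : ℝ := (1 + Real.exp (-h)) / (2 * expRatio h)

/-- The odds `p / (1 - p)` for `p = (1 + a h) / 2`. -/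
def oddsFn (a h : ℝ) : ℝ := (1 + a * h) / (1 - a * h)

/-- The coefficient `(β - d) / (1 - d)`. -/
def alphaFn (a h : ℝ) : ℝ := (1 + 2 * a * halfCoth h) / (1 - a * h)

/-- The coefficient `(β - 1) / (1 - d)`. -/
def slopeFn (a h : ℝ) : ℝ := a * (2 * halfCoth h + h) / (1 - a * h)

/-- The coefficient `(1 - β d) / (1 - d)`. -/
def interceptFn (a h : ℝ) : ℝ := (1 - 2 * a * halfCoth h) / (1 - a * h)

/-- The coefficient `h (β - 1) / ((1 - d) log β)`. -/
def etaFn (a h : ℝ) : ℝ := 1 / (expRatio h * logRatio (oddsFn a h - 1))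

/-- The frictionless optimal ratio. -/
def cbarFn (a h : ℝ) : ℝ := (1 - 2 * a * halfCoth h) / (1 + 2 * a * halfCoth h)

theorem halfCoth_zero : halfCoth 0 = 1 := by norm_num [halfCoth, expRatio_zero]

theorem oddsFn_zero (a : ℝ) : oddsFn a 0 = 1 := by simp [oddsFn]

theorem alphaFn_zero (a : ℝ) : alphaFn a 0 = 1 + 2 * a := by simp [alphaFn, halfCoth_zero]

theorem slopeFn_zero (a : ℝ) : slopeFn a 0 = 2 * a := by
  simp [slopeFn, halfCoth_zero]; ring

theorem interceptFn_zero (a : ℝ) : interceptFn a 0 = 1 - 2 * a := by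
  simp [interceptFn, halfCoth_zero]

theorem etaFn_zero (a : ℝ) : etaFn a 0 = 1 := by
  simp [etaFn, oddsFn_zero, expRatio_zero, logRatio_zero]

theorem cbarFn_zero (a : ℝ) : cbarFn a 0 = (1 - 2 * a) / (1 + 2 * a) := by
  simp [cbarFn, halfCoth_zero]

theorem analyticAt_halfCoth : AnalyticAt ℝ halfCoth 0 := by
  unfold halfCoth
  refine AnalyticAt.fun_div (by fun_prop) (by fun_prop) ?_
  norm_num [expRatio_zero]

theorem analyticAt_oddsFn (a : ℝ) : AnalyticAt ℝ (oddsFn a) 0 := by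
  unfold oddsFn
  exact AnalyticAt.fun_div (by fun_prop) (by fun_prop) (by simp)

theorem analyticAt_alphaFn (a : ℝ) : AnalyticAt ℝ (alphaFn a) 0 := by
  have := analyticAt_halfCoth
  unfold alphaFn
  exact AnalyticAt.fun_div (by fun_prop) (by fun_prop) (by simp)

theorem analyticAt_slopeFn (a : ℝ) : AnalyticAt ℝ (slopeFn a) 0 := by
  have := analyticAt_halfCoth
  unfold slopeFn
  exact AnalyticAt.fun_div (by fun_prop) (by fun_prop) (by simp)

theorem analyticAt_interceptFn (a : ℝ) : AnalyticAt ℝ (interceptFn a) 0 := by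
  have := analyticAt_halfCoth
  unfold interceptFn
  exact AnalyticAt.fun_div (by fun_prop) (by fun_prop) (by simp)

theorem analyticAt_logRatio_oddsFn (a : ℝ) :
    AnalyticAt ℝ (fun h => logRatio (oddsFn a h - 1)) 0 := by
  refine AnalyticAt.fun_comp (g := logRatio) (f := fun h => oddsFn a h - 1) ?_
    ((analyticAt_oddsFn a).sub analyticAt_const)
  exact analyticAt_logRatio (by simp [oddsFn_zero])

theorem analyticAt_etaFn (a : ℝ) : AnalyticAt ℝ (etaFn a) 0 := by
  have := analyticAt_logRatio_oddsFn a
  unfold etaFn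
  refine AnalyticAt.fun_div (by fun_prop) (by fun_prop) ?_
  simp [oddsFn_zero, expRatio_zero, logRatio_zero]

theorem analyticAt_cbarFn {a : ℝ} (ha : -1 < 2 * a) : AnalyticAt ℝ (cbarFn a) 0 := by
  have := analyticAt_halfCoth
  unfold cbarFn
  refine AnalyticAt.fun_div (by fun_prop) (by fun_prop) ?_
  rw [halfCoth_zero]; linarith

theorem hasDerivAt_exp_neg_zero : HasDerivAt (fun h : ℝ => Real.exp (-h)) (-1) 0 := by
  simpa using (hasDerivAt_neg (0 : ℝ)).exp

theorem hasDerivAt_halfCoth : HasDerivAt halfCoth 0 0 := by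
  have h1 := hasDerivAt_exp_neg_zero.const_add 1
  have h2 := hasDerivAt_expRatio.const_mul 2
  refine (h1.div h2 (by norm_num [expRatio_zero])).congr_deriv ?_
  norm_num [expRatio_zero]

theorem hasDerivAt_one_sub_mul (a : ℝ) : HasDerivAt (fun h => 1 - a * h) (-a) 0 := by
  simpa using ((hasDerivAt_id (0 : ℝ)).const_mul a).const_sub 1

theorem hasDerivAt_oddsFn (a : ℝ) : HasDerivAt (oddsFn a) (2 * a) 0 := by
  have h1 : HasDerivAt (fun h => 1 + a * h) a 0 := by
    simpa using ((hasDerivAt_id (0 : ℝ)).const_mul a).const_add 1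
  refine (h1.div (hasDerivAt_one_sub_mul a) (by simp)).congr_deriv ?_
  simp; ring

theorem hasDerivAt_alphaFn (a : ℝ) : HasDerivAt (alphaFn a) ((1 + 2 * a) * a) 0 := by
  have h1 := (hasDerivAt_halfCoth.const_mul (2 * a)).const_add 1
  refine (h1.div (hasDerivAt_one_sub_mul a) (by simp)).congr_deriv ?_
  simp [halfCoth_zero]

theorem hasDerivAt_slopeFn (a : ℝ) : HasDerivAt (slopeFn a) (a * (1 + 2 * a)) 0 := by
  have h1 := ((hasDerivAt_halfCoth.const_mul 2).add (hasDerivAt_id (0 : ℝ))).const_mul a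
  refine (h1.div (hasDerivAt_one_sub_mul a) (by simp)).congr_deriv ?_
  simp [halfCoth_zero]
  ring

theorem hasDerivAt_etaFn (a : ℝ) : HasDerivAt (etaFn a) (a + 1 / 2) 0 := by
  have h1 : HasDerivAt (fun h => logRatio (oddsFn a h - 1)) (-(1 / 2) * (2 * a)) 0 := by
    refine HasDerivAt.comp (h₂ := logRatio) (h := fun h => oddsFn a h - 1) 0 ?_
      ((hasDerivAt_oddsFn a).sub_const 1)
    simpa [oddsFn_zero] using hasDerivAt_logRatio
  have h2 := (hasDerivAt_expRatio.mul h1)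
  have h3 := h2.inv (by simp [oddsFn_zero, expRatio_zero, logRatio_zero])
  have e : etaFn a = (expRatio * fun h => logRatio (oddsFn a h - 1))⁻¹ := by
    ext h; simp [etaFn]
  rw [e]
  refine h3.congr_deriv ?_
  simp [oddsFn_zero, expRatio_zero, logRatio_zero]

theorem hasDerivAt_cbarFn {a : ℝ} (ha : -1 < 2 * a) : HasDerivAt (cbarFn a) 0 0 := by
  have h1 := (hasDerivAt_halfCoth.const_mul (2 * a)).const_add 1
  have h2 := (hasDerivAt_halfCoth.const_mul (2 * a)).const_sub 1
  refine (h2.div h1 (by rw [halfCoth_zero]; linarith)).congr_deriv ?_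
  simp

/-- The range of `h` in which the formulas for the parameters hold. -/
structure Regime (a h p d : ℝ) : Prop where
  h_pos : 0 < h
  p_eq : p = (1 + a * h) / 2
  d_eq : d = Real.exp (-h)
  one_add : 0 < 1 + a * h
  one_sub : 0 < 1 - a * h
  num_pos : 0 < 1 + 2 * a * halfCoth h
  den_pos : 0 < 1 - 2 * a * halfCoth h

namespace Regime

variable {a h p d : ℝ}

theorem p_pos (H : Regime a h p d) : 0 < p := by
  rw [H.p_eq]; linarith [H.one_add]

theorem p_lt (H : Regime a h p d) : p < 1 := by
  rw [H.p_eq]; linarith [H.one_sub]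

theorem d_pos (H : Regime a h p d) : 0 < d := by rw [H.d_eq]; exact Real.exp_pos _

theorem d_lt (H : Regime a h p d) : d < 1 := by
  rw [H.d_eq, Real.exp_lt_one_iff]; linarith [H.h_pos]

theorem odds_eq (H : Regime a h p d) : odds p = oddsFn a h := by
  have := H.one_sub
  unfold odds oddsFn
  rw [H.p_eq, show 1 - (1 + a * h) / 2 = (1 - a * h) / 2 by ring]
  field_simp

theorem oddsFn_pos (H : Regime a h p d) : 0 < oddsFn a h := div_pos H.one_add H.one_sub

theorem mul_expRatio_eq (H : Regime a h p d) : h * expRatio h = 1 - d := by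
  rw [mul_expRatio, H.d_eq]

theorem expRatio_pos (H : Regime a h p d) : 0 < expRatio h := by
  have h1 := H.mul_expRatio_eq
  have h2 := H.d_lt
  by_contra hc
  nlinarith [H.h_pos]

theorem halfCoth_eq (H : Regime a h p d) : halfCoth h = h * (1 + d) / (2 * (1 - d)) := by
  have := H.h_pos
  have := H.expRatio_pos
  rw [← H.mul_expRatio_eq, halfCoth, H.d_eq]
  field_simp

theorem alphaFn_pos (H : Regime a h p d) : 0 < alphaFn a h := div_pos H.num_pos H.one_sub

theorem interceptFn_pos (H : Regime a h p d) : 0 < interceptFn a h := div_pos H.den_pos H.one_sub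

theorem cbarFn_pos (H : Regime a h p d) : 0 < cbarFn a h := div_pos H.den_pos H.num_pos

theorem alphaFn_mul (H : Regime a h p d) : alphaFn a h * (1 - d) = oddsFn a h - d := by
  have h1 := H.one_sub
  have h2 : 0 < 1 - d := sub_pos.2 H.d_lt
  unfold alphaFn oddsFn
  rw [H.halfCoth_eq]
  field_simp
  ring

theorem slopeFn_mul (H : Regime a h p d) : slopeFn a h * (1 - d) = oddsFn a h - 1 := by
  have h1 := H.one_sub
  have h2 : 0 < 1 - d := sub_pos.2 H.d_lt
  unfold slopeFn oddsFn
  rw [H.halfCoth_eq]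
  field_simp
  ring

theorem interceptFn_mul (H : Regime a h p d) : interceptFn a h * (1 - d) = 1 - oddsFn a h * d := by
  have h1 := H.one_sub
  have h2 : 0 < 1 - d := sub_pos.2 H.d_lt
  unfold interceptFn oddsFn
  rw [H.halfCoth_eq]
  field_simp
  ring

theorem interceptFn_eq (H : Regime a h p d) : interceptFn a h = alphaFn a h * cbarFn a h := by
  have h1 := H.one_sub
  have h2 := H.num_pos
  unfold interceptFn alphaFn cbarFn
  field_simp

theorem numFactor_eq (H : Regime a h p d) (c : ℝ) :
    numFactor (odds p) d c = alphaFn a h * c + d * slopeFn a h := by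
  have h2 : 0 < 1 - d := sub_pos.2 H.d_lt
  unfold numFactor
  rw [H.odds_eq, ← H.alphaFn_mul, ← H.slopeFn_mul]
  field_simp

theorem denFactor_eq (H : Regime a h p d) (c : ℝ) :
    denFactor (odds p) d c = interceptFn a h - slopeFn a h * c := by
  have h2 : 0 < 1 - d := sub_pos.2 H.d_lt
  unfold denFactor
  rw [H.odds_eq, ← H.interceptFn_mul, ← H.slopeFn_mul]
  field_simp

theorem geomSum_eq (H : Regime a h p d) (c : ℝ) :
    geomSum (odds p) d c = alphaFn a h * (c - cbarFn a h) * (c + d) / (c * (1 - d)) := by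
  have h2 : 0 < 1 - d := sub_pos.2 H.d_lt
  unfold geomSum
  rw [H.odds_eq, ← H.alphaFn_mul, ← H.interceptFn_mul, H.interceptFn_eq]
  field_simp

theorem cBar_eq (H : Regime a h p d) : cBar p d = cbarFn a h := by
  have h1 := H.one_sub
  have h2 : 0 < 1 - d := sub_pos.2 H.d_lt
  have h3 := H.num_pos
  have e1 : 1 - p - p * d = (1 - d) / 2 * (1 - 2 * a * halfCoth h) := by
    rw [H.halfCoth_eq, H.p_eq]; field_simp; ring
  have e2 : p + p * d - d = (1 - d) / 2 * (1 + 2 * a * halfCoth h) := by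
    rw [H.halfCoth_eq, H.p_eq]; field_simp; ring
  unfold cBar cbarFn
  rw [e1, e2]
  field_simp

/-- Together with `slopeFn_add_interceptFn` and `intercept_add`, this is what permits elimination
among the coefficients without reference to h. -/
theorem alphaFn_sub_slopeFn (H : Regime a h p d) : alphaFn a h - slopeFn a h = 1 := by
  have h2 : 0 < 1 - d := sub_pos.2 H.d_lt
  have := H.alphaFn_mul
  have := H.slopeFn_mul
  have : (alphaFn a h - slopeFn a h - 1) * (1 - d) = 0 := by linarith
  rcases mul_eq_zero.1 this with h | h <;> linarith

theorem slopeFn_add_interceptFn (H : Regime a h p d) :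
    slopeFn a h + interceptFn a h = oddsFn a h := by
  have h2 : 0 < 1 - d := sub_pos.2 H.d_lt
  have := H.interceptFn_mul
  have := H.slopeFn_mul
  have : (slopeFn a h + interceptFn a h - oddsFn a h) * (1 - d) = 0 := by linarith
  rcases mul_eq_zero.1 this with h | h <;> linarith

theorem logRatio_pos (H : Regime a h p d) : 0 < logRatio (oddsFn a h - 1) := by
  have h1 := mul_logRatio (oddsFn a h - 1)
  have hβ := H.oddsFn_pos
  rw [add_sub_cancel] at h1
  rcases lt_trichotomy (oddsFn a h) 1 with h2 | h2 | h2
  · have := Real.log_neg hβ h2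
    by_contra hc
    nlinarith
  · rw [h2, sub_self, logRatio_zero]; norm_num
  · have := Real.log_pos h2
    by_contra hc
    nlinarith

theorem etaFn_pos (H : Regime a h p d) : 0 < etaFn a h :=
  div_pos one_pos (mul_pos H.expRatio_pos H.logRatio_pos)

/-- The relation `h b = η log β`. -/
theorem mul_slopeFn (H : Regime a h p d) :
    h * slopeFn a h = etaFn a h * Real.log (oddsFn a h) := by
  have h1 := H.logRatio_pos
  have h2 := H.expRatio_pos
  have h3 := mul_logRatio (oddsFn a h - 1)
  have h4 := H.slopeFn_mul
  rw [add_sub_cancel] at h3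
  rw [← H.mul_expRatio_eq] at h4
  rw [← h3, etaFn, one_div_mul_eq_div, eq_div_iff (by positivity)]
  linear_combination (logRatio (oddsFn a h - 1)) * h4

theorem half_iff (H : Regime a h p d) : p = 1 / 2 ↔ a = 0 := by
  have := H.h_pos
  rw [H.p_eq]
  constructor
  · intro e
    have : a * h = 0 := by linarith
    rcases mul_eq_zero.1 this with h | h
    · exact h
    · linarith
  · rintro rfl; ring

theorem log_oddsFn_ne (H : Regime a h p d) (ha : a ≠ 0) : Real.log (oddsFn a h) ≠ 0 := by
  refine Real.log_ne_zero_of_pos_of_ne_one H.oddsFn_pos fun e => ha ?_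
  have h1 := H.one_sub
  unfold oddsFn at e
  rw [div_eq_one_iff_eq h1.ne'] at e
  have : a * h = 0 := by linarith
  rcases mul_eq_zero.1 this with h2 | h2
  · exact h2
  · linarith [H.h_pos]

theorem slopeFn_ne (H : Regime a h p d) (ha : a ≠ 0) : slopeFn a h ≠ 0 := by
  intro e
  have := H.mul_slopeFn
  rw [e, mul_zero, eq_comm, mul_eq_zero] at this
  exact this.elim H.etaFn_pos.ne' (H.log_oddsFn_ne ha)

theorem log_inv_odds (H : Regime a h p d) :
    Real.log ((1 - p) / p) = -Real.log (oddsFn a h) := by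
  rw [← H.odds_eq, odds, ← Real.log_inv, inv_div]

/-- The logarithm of `s̄`, in a form that is analytic at `h = 0`. -/
theorem mul_stepCount_eq (H : Regime a h p d) {c : ℝ} (hc : 0 < c) :
    h * stepCount p d c = etaFn a h * alphaFn a h * ((c - cbarFn a h) * (c + d) / c)
      * logRatio (-(alphaFn a h * slopeFn a h * ((c - cbarFn a h) * (c + d) / c))) := by
  have h2 : 0 < 1 - d := sub_pos.2 H.d_lt
  unfold stepCount
  split_ifs with hp
  · have ha := H.half_iff.1 hp
    subst ha
    have e1 : slopeFn 0 h = 0 := by simp [slopeFn]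
    have e2 : alphaFn 0 h = 1 := by simp [alphaFn]
    have e3 : cbarFn 0 h = 1 := by simp [cbarFn]
    have e4 : etaFn 0 h * (1 - d) = h := by
      have := H.expRatio_pos
      rw [← H.mul_expRatio_eq, etaFn, oddsFn]; simp [logRatio_zero]; field_simp
    rw [e1, e2, e3, mul_zero, zero_mul, neg_zero, logRatio_zero, mul_div_assoc',
      div_eq_iff (by positivity)]
    field_simp
    linear_combination (-(c + d) * (c - 1)) * e4
  · have ha : a ≠ 0 := fun e => hp (H.half_iff.2 e)
    have hb := H.slopeFn_ne ha
    have hl := H.log_oddsFn_ne ha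
    have e : rFn p d c = 1 + -(alphaFn a h * slopeFn a h * ((c - cbarFn a h) * (c + d) / c)) := by
      rw [rFn_sub_one H.p_lt H.d_lt hc, H.geomSum_eq, H.odds_eq,
        show 1 - oddsFn a h = -(slopeFn a h * (1 - d)) by rw [H.slopeFn_mul]; ring]
      field_simp
    rw [e, H.log_inv_odds, ← mul_logRatio]
    have e2 : h = etaFn a h * Real.log (oddsFn a h) / slopeFn a h := by
      rw [← H.mul_slopeFn]; field_simp
    generalize logRatio (-(alphaFn a h * slopeFn a h * ((c - cbarFn a h) * (c + d) / c))) = w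
    rw [mul_div_assoc']
    rw [div_eq_iff (neg_ne_zero.2 hl)]
    have e3 := H.mul_slopeFn
    linear_combination (-(alphaFn a h) * ((c - cbarFn a h) * (c + d) / c) * w) * e3

theorem d_rpow (H : Regime a h p d) (k : ℝ) : d ^ k = Real.exp (-(h * k)) := by
  rw [Real.rpow_def_of_pos H.d_pos, H.d_eq, Real.log_exp]; congr 1; ring

theorem sBar_eq (H : Regime a h p d) (c : ℝ) : sBar p d c = Real.exp (h * stepCount p d c) := by
  rw [sBar, Real.inv_rpow H.d_pos.le, H.d_rpow, Real.exp_neg, inv_inv]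

end Regime

/-! ### Derivatives of the cost function for fixed `h` -/

/-- Logarithmic derivative of `1 - F`. -/
def logSlope (α b b' η d c : ℝ) : ℝ :=
  1 / c + α / (α * c + d * b) + (b - η) / (b' - b * c) - η * d / (c * (α * c + d * b))

/-- Derivative of `logSlope`. -/
def logSlopeDeriv (α b b' η d c : ℝ) : ℝ :=
  -1 / c ^ 2 - α ^ 2 / (α * c + d * b) ^ 2 + b * (b - η) / (b' - b * c) ^ 2
    + η * d * (1 / (c ^ 2 * (α * c + d * b)) + α / (c * (α * c + d * b) ^ 2))

/-- Second derivative of `logSlope`. -/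
def logSlopeDerivTwo (α b b' η d c : ℝ) : ℝ :=
  2 / c ^ 3 + 2 * α ^ 3 / (α * c + d * b) ^ 3 + 2 * b ^ 2 * (b - η) / (b' - b * c) ^ 3
    - 2 * η * d * (1 / (c ^ 3 * (α * c + d * b)) + α / (c ^ 2 * (α * c + d * b) ^ 2)
      + α ^ 2 / (c * (α * c + d * b) ^ 3))

theorem hasDerivAt_logSlope {α b b' η d c : ℝ} (hc : c ≠ 0) (hA : α * c + d * b ≠ 0)
    (hB : b' - b * c ≠ 0) :
    HasDerivAt (logSlope α b b' η d) (logSlopeDeriv α b b' η d c) c := by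
  have e0 := hasDerivAt_id c
  have eA := (e0.const_mul α).add_const (d * b)
  have eB := (e0.const_mul b).const_sub b'
  have e1 := ((((hasDerivAt_const c (1 : ℝ)).div e0 hc).add
    ((hasDerivAt_const c α).div eA hA)).add ((hasDerivAt_const c (b - η)).div eB hB)).sub
    ((hasDerivAt_const c (η * d)).div (e0.mul eA) (mul_ne_zero hc hA))
  refine e1.congr_deriv ?_
  simp only [logSlopeDeriv, id, Pi.mul_apply]
  generalize hA' : α * c + d * b = A at *
  generalize b' - b * c = B at *
  field_simp
  ring

theorem hasDerivAt_logSlopeDeriv {α b b' η d c : ℝ} (hc : c ≠ 0) (hA : α * c + d * b ≠ 0)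
    (hB : b' - b * c ≠ 0) :
    HasDerivAt (logSlopeDeriv α b b' η d) (logSlopeDerivTwo α b b' η d c) c := by
  have e0 := hasDerivAt_id c
  have eA := (e0.const_mul α).add_const (d * b)
  have eB := (e0.const_mul b).const_sub b'
  have e1 := ((((hasDerivAt_const c (-1 : ℝ)).div (e0.pow 2) (pow_ne_zero 2 hc)).sub
    ((hasDerivAt_const c (α ^ 2)).div (eA.pow 2) (pow_ne_zero 2 hA))).add
    ((hasDerivAt_const c (b * (b - η))).div (eB.pow 2) (pow_ne_zero 2 hB))).add
    ((((hasDerivAt_const c (1 : ℝ)).div ((e0.pow 2).mul eA)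
      (mul_ne_zero (pow_ne_zero 2 hc) hA)).add
      ((hasDerivAt_const c α).div (e0.mul (eA.pow 2))
        (mul_ne_zero hc (pow_ne_zero 2 hA)))).const_mul (η * d))
  refine e1.congr_deriv ?_
  simp only [logSlopeDerivTwo, id, Pi.mul_apply, Pi.pow_apply]
  generalize hA' : α * c + d * b = A at *
  generalize b' - b * c = B at *
  field_simp
  ring

/-- The domain of the cost function. -/
def Dom (p d c : ℝ) : Prop :=
  0 < c ∧ 0 < numFactor (odds p) d c ∧ 0 < denFactor (odds p) d c

namespace Regime

variable {a h p d : ℝ}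

theorem intercept_add (H : Regime a h p d) : interceptFn a h + d * slopeFn a h = 1 := by
  have h2 : 0 < 1 - d := sub_pos.2 H.d_lt
  have := H.interceptFn_mul
  have := H.slopeFn_mul
  have : (interceptFn a h + d * slopeFn a h - 1) * (1 - d) = 0 := by
    linear_combination H.interceptFn_mul + d * H.slopeFn_mul
  rcases mul_eq_zero.1 this with h | h <;> linarith

theorem numFactor_cbar (H : Regime a h p d) :
    alphaFn a h * cbarFn a h + d * slopeFn a h = 1 := by
  rw [← H.interceptFn_eq, H.intercept_add]

theorem denFactor_cbar (H : Regime a h p d) :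
    interceptFn a h - slopeFn a h * cbarFn a h = cbarFn a h := by
  rw [H.interceptFn_eq]
  linear_combination (cbarFn a h) * H.alphaFn_sub_slopeFn

theorem isOpen_dom (H : Regime a h p d) : IsOpen {c | Dom p d c} := by
  simp only [Dom, H.numFactor_eq, H.denFactor_eq]
  exact (isOpen_lt continuous_const continuous_id).inter
    ((isOpen_lt (g := fun c => alphaFn a h * c + d * slopeFn a h) continuous_const
      (by fun_prop)).inter (isOpen_lt (g := fun c => interceptFn a h - slopeFn a h * c)
        continuous_const (by fun_prop)))

theorem dom_cbar (H : Regime a h p d) : Dom p d (cbarFn a h) := by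
  refine ⟨H.cbarFn_pos, ?_, ?_⟩
  · rw [H.numFactor_eq, H.numFactor_cbar]; exact one_pos
  · rw [H.denFactor_eq, H.denFactor_cbar]; exact H.cbarFn_pos

/-- For p ≠ 1/2, h k equals -(η/b) log(AB/c) by `mul_slopeFn`, where b is `slopeFn`. Differentiation
produces a factor b that cancels the denominator, so the result has no singularity at p = 1/2. -/
theorem hasDerivAt_stepCount (H : Regime a h p d) {c : ℝ} (hc : Dom p d c) :
    HasDerivAt (fun c => h * stepCount p d c)
      (etaFn a h * (1 / (interceptFn a h - slopeFn a h * c)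
        + d / (c * (alphaFn a h * c + d * slopeFn a h)))) c := by
  obtain ⟨hc0, hA, hB⟩ := hc
  have h2 : 0 < 1 - d := sub_pos.2 H.d_lt
  by_cases hp : p = 1 / 2
  · have ha := H.half_iff.1 hp
    subst ha
    have e1 : slopeFn 0 h = 0 := by simp [slopeFn]
    have e2 : alphaFn 0 h = 1 := by simp [alphaFn]
    have e3 : interceptFn 0 h = 1 := by simp [interceptFn]
    have e4 : etaFn 0 h * (1 - d) = h := by
      have := H.expRatio_pos
      rw [← H.mul_expRatio_eq, etaFn, oddsFn]; simp [logRatio_zero]; field_simp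
    have e0 := hasDerivAt_id c
    have e5 := ((((e0.add_const d).mul (e0.sub_const 1)).div (e0.mul_const (1 - d))
      (mul_ne_zero hc0.ne' h2.ne')).const_mul h)
    simp only [stepCount, if_pos hp]
    refine e5.congr_deriv ?_
    rw [e1, e2, e3, show (1 : ℝ) * c + d * 0 = c by ring]
    simp only [id, Pi.mul_apply]
    field_simp
    linear_combination (-(c ^ 2 + d)) * e4
  · have ha : a ≠ 0 := fun e => hp (H.half_iff.2 e)
    have hb := H.slopeFn_ne ha
    have hl := H.log_oddsFn_ne ha
    have e3 := H.mul_slopeFn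
    rw [H.numFactor_eq] at hA
    rw [H.denFactor_eq] at hB
    have e0 := hasDerivAt_id c
    have eA := ((e0.const_mul (alphaFn a h)).add_const (d * slopeFn a h)).log hA.ne'
    have eB := ((e0.const_mul (slopeFn a h)).const_sub (interceptFn a h)).log hB.ne'
    have e5 := ((eA.add eB).sub (e0.log hc0.ne')).const_mul (h / -Real.log (oddsFn a h))
    refine (e5.congr_of_eventuallyEq ?_).congr_deriv ?_
    · filter_upwards [H.isOpen_dom.mem_nhds (show Dom p d c from
        ⟨hc0, by rwa [H.numFactor_eq], by rwa [H.denFactor_eq]⟩)] with t ht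
      obtain ⟨ht0, htA, htB⟩ := ht
      simp only [stepCount, if_neg hp]
      rw [rFn_eq H.p_lt H.d_lt ht0, Real.log_div (by positivity) (by positivity),
        Real.log_mul (by positivity) (by positivity), H.log_inv_odds, H.numFactor_eq,
        H.denFactor_eq]
      simp only [Pi.add_apply, Pi.sub_apply, id]
      ring
    · simp only [id]
      have e6 : h / -Real.log (oddsFn a h) = -(etaFn a h / slopeFn a h) := by
        field_simp; linear_combination (-1) * e3
      rw [e6]
      -- A - αc = d b is the source of the cancelling factor b.
      have key : alphaFn a h * c = (alphaFn a h * c + d * slopeFn a h) - d * slopeFn a h := by ring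
      generalize hA' : alphaFn a h * c + d * slopeFn a h = A at *
      generalize interceptFn a h - slopeFn a h * c = B at *
      field_simp
      linear_combination (-(etaFn a h) * B) * key

theorem costFn_eq_exp (H : Regime a h p d) {c : ℝ} (hc : Dom p d c) :
    costFn p d c = 1 - c * ((alphaFn a h * c + d * slopeFn a h)
      / (interceptFn a h - slopeFn a h * c)) * Real.exp (-(h * stepCount p d c)) := by
  rw [costFn_eq H.p_lt H.d_pos H.d_lt hc.1 hc.2.1 hc.2.2, H.numFactor_eq, H.denFactor_eq, H.d_rpow]

theorem hasDerivAt_costFn (H : Regime a h p d) {c : ℝ} (hc : Dom p d c) :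
    HasDerivAt (costFn p d) (-((1 - costFn p d c) *
      logSlope (alphaFn a h) (slopeFn a h) (interceptFn a h) (etaFn a h) d c)) c := by
  have hk := H.hasDerivAt_stepCount hc
  have hF := H.costFn_eq_exp hc
  have hev : costFn p d =ᶠ[𝓝 c] fun c => 1 - c * ((alphaFn a h * c + d * slopeFn a h)
      / (interceptFn a h - slopeFn a h * c)) * Real.exp (-(h * stepCount p d c)) := by
    filter_upwards [H.isOpen_dom.mem_nhds hc] with t ht using H.costFn_eq_exp ht
  obtain ⟨hc0, hA, hB⟩ := hc
  rw [H.numFactor_eq] at hA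
  rw [H.denFactor_eq] at hB
  have e0 := hasDerivAt_id c
  have eA := (e0.const_mul (alphaFn a h)).add_const (d * slopeFn a h)
  have eB := (e0.const_mul (slopeFn a h)).const_sub (interceptFn a h)
  have e1 := ((e0.mul (eA.div eB hB.ne')).mul (hk.neg.exp)).const_sub 1
  refine (e1.congr_of_eventuallyEq hev).congr_deriv ?_
  rw [hF]
  simp only [id, Pi.mul_apply, Pi.div_apply, Pi.neg_apply, logSlope]
  generalize Real.exp (-(h * stepCount p d c)) = E at *
  generalize hA' : alphaFn a h * c + d * slopeFn a h = A at *
  generalize hB' : interceptFn a h - slopeFn a h * c = B at *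
  field_simp
  ring

theorem one_sub_costFn_pos (H : Regime a h p d) {c : ℝ} (hc : Dom p d c) :
    0 < 1 - costFn p d c := by
  have hF := H.costFn_eq_exp hc
  obtain ⟨hc0, hA, hB⟩ := hc
  rw [H.numFactor_eq] at hA
  rw [H.denFactor_eq] at hB
  rw [hF, sub_sub_cancel]
  positivity

theorem stepCount_cbar (H : Regime a h p d) : h * stepCount p d (cbarFn a h) = 0 := by
  rw [H.mul_stepCount_eq H.cbarFn_pos]; simp

theorem costFn_cbar (H : Regime a h p d) : costFn p d (cbarFn a h) = 0 := by
  have := H.cbarFn_pos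
  rw [H.costFn_eq_exp H.dom_cbar, H.numFactor_cbar, H.denFactor_cbar, H.stepCount_cbar]
  simp
  field_simp
  ring

theorem hasDerivAt_costFn_deriv (H : Regime a h p d) {c : ℝ} (hc : Dom p d c) :
    HasDerivAt (fun c => -((1 - costFn p d c) *
        logSlope (alphaFn a h) (slopeFn a h) (interceptFn a h) (etaFn a h) d c))
      (-((1 - costFn p d c) *
        (logSlopeDeriv (alphaFn a h) (slopeFn a h) (interceptFn a h) (etaFn a h) d c
          + logSlope (alphaFn a h) (slopeFn a h) (interceptFn a h) (etaFn a h) d c ^ 2))) c := by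
  have h1 := H.hasDerivAt_costFn hc
  obtain ⟨hc0, hA, hB⟩ := hc
  rw [H.numFactor_eq] at hA
  rw [H.denFactor_eq] at hB
  have h2 := hasDerivAt_logSlope (η := etaFn a h) hc0.ne' hA.ne' hB.ne'
  refine ((h1.const_sub 1).mul h2).neg.congr_deriv ?_
  ring

theorem hasDerivAt_costFn_deriv_two (H : Regime a h p d) {c : ℝ} (hc : Dom p d c) :
    HasDerivAt (fun c => (-((1 - costFn p d c) *
        (logSlopeDeriv (alphaFn a h) (slopeFn a h) (interceptFn a h) (etaFn a h) d c
          + logSlope (alphaFn a h) (slopeFn a h) (interceptFn a h) (etaFn a h) d c ^ 2))))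
      (-((1 - costFn p d c) *
        (logSlopeDerivTwo (alphaFn a h) (slopeFn a h) (interceptFn a h) (etaFn a h) d c
          + 3 * logSlope (alphaFn a h) (slopeFn a h) (interceptFn a h) (etaFn a h) d c
            * logSlopeDeriv (alphaFn a h) (slopeFn a h) (interceptFn a h) (etaFn a h) d c
          + logSlope (alphaFn a h) (slopeFn a h) (interceptFn a h) (etaFn a h) d c ^ 3))) c := by
  have h1 := H.hasDerivAt_costFn hc
  obtain ⟨hc0, hA, hB⟩ := hc
  rw [H.numFactor_eq] at hA
  rw [H.denFactor_eq] at hB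
  have h2 := hasDerivAt_logSlope (η := etaFn a h) hc0.ne' hA.ne' hB.ne'
  have h3 := hasDerivAt_logSlopeDeriv (η := etaFn a h) hc0.ne' hA.ne' hB.ne'
  refine ((h1.const_sub 1).mul (h3.add (h2.pow 2))).neg.congr_deriv ?_
  simp only [Pi.add_apply, Pi.pow_apply]
  ring

/-- The logarithmic derivative of `1 - F` as a rational function with quadratic numerator. -/
theorem logSlope_eq (H : Regime a h p d) {c : ℝ} (hc : Dom p d c) :
    logSlope (alphaFn a h) (slopeFn a h) (interceptFn a h) (etaFn a h) d c
      = (cbarFn a h * (1 + oddsFn a h - etaFn a h * (1 + d))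
          + 2 * interceptFn a h * (1 - etaFn a h) * (c - cbarFn a h)
          - alphaFn a h * (slopeFn a h + etaFn a h) * (c - cbarFn a h) ^ 2)
        / (c * (alphaFn a h * c + d * slopeFn a h) * (interceptFn a h - slopeFn a h * c)) := by
  obtain ⟨hc0, hA, hB⟩ := hc
  rw [H.numFactor_eq] at hA
  rw [H.denFactor_eq] at hB
  have e1 := H.interceptFn_eq
  have e2 := H.alphaFn_sub_slopeFn
  have e3 := H.slopeFn_add_interceptFn
  have e4 := H.intercept_add
  rw [eq_div_iff (by positivity), logSlope]
  -- Eliminating b, b' and β in favour of α and c̄ leaves an identity that follows from the one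
  -- remaining relation `e4`.
  have e6 : slopeFn a h = alphaFn a h - 1 := by linarith
  have e5 : (1 / c + alphaFn a h / (alphaFn a h * c + d * slopeFn a h)
      + (slopeFn a h - etaFn a h) / (interceptFn a h - slopeFn a h * c)
      - etaFn a h * d / (c * (alphaFn a h * c + d * slopeFn a h)))
      * (c * (alphaFn a h * c + d * slopeFn a h) * (interceptFn a h - slopeFn a h * c))
      = (alphaFn a h * c + d * slopeFn a h) * (interceptFn a h - slopeFn a h * c)
        + alphaFn a h * c * (interceptFn a h - slopeFn a h * c)
        + (slopeFn a h - etaFn a h) * c * (alphaFn a h * c + d * slopeFn a h)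
        - etaFn a h * d * (interceptFn a h - slopeFn a h * c) := by
    generalize alphaFn a h * c + d * slopeFn a h = A at *
    generalize interceptFn a h - slopeFn a h * c = B at *
    field_simp
  rw [e5, ← e3]
  rw [e6] at e4 ⊢
  rw [e1] at e4 ⊢
  linear_combination (cbarFn a h * (alphaFn a h - etaFn a h)) * e4

end Regime

/-! ### The quantities of interest as analytic functions of `(c, h)` -/

attribute [fun_prop] analyticAt_fst analyticAt_snd

/-- The function `(c - c̄) (c + d) / c`. -/
def excessFn (a : ℝ) (q : ℝ × ℝ) : ℝ :=
  (q.1 - cbarFn a q.2) * (q.1 + Real.exp (-q.2)) / q.1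

/-- The logarithm of `s̄`. -/
def logSBarFn (a : ℝ) (q : ℝ × ℝ) : ℝ :=
  etaFn a q.2 * alphaFn a q.2 * excessFn a q
    * logRatio (-(alphaFn a q.2 * slopeFn a q.2 * excessFn a q))

/-- The cost function `F`. -/
def costAn (a : ℝ) (q : ℝ × ℝ) : ℝ :=
  1 - q.1 * ((alphaFn a q.2 * q.1 + Real.exp (-q.2) * slopeFn a q.2)
      / (interceptFn a q.2 - slopeFn a q.2 * q.1)) * Real.exp (-logSBarFn a q)

/-- The upper boundary of the no-trade region. -/
def upperAn (a : ℝ) (q : ℝ × ℝ) : ℝ := 1 / (1 + q.1 * Real.exp (-logSBarFn a q))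

/-- The lower boundary of the no-trade region. -/
def lowerAn (q : ℝ × ℝ) : ℝ := 1 / (1 + q.1)

/-- The quotient `log β / h`. -/
def logOddsRatio (a h : ℝ) : ℝ := logRatio (oddsFn a h - 1) * (2 * a / (1 - a * h))

/-- The number `√(d / β)`. -/
def geomMean (a h : ℝ) : ℝ := Real.exp (-(h * (1 + logOddsRatio a h) / 2))

/-- The growth rate divided by `h ^ 2`. -/
def growthAn (a : ℝ) (q : ℝ × ℝ) : ℝ :=
  (a / (1 - a * q.2) * (1 + logOddsRatio a q.2)
    + (1 + oddsFn a q.2 - alphaFn a q.2 * slopeFn a q.2 * excessFn a q)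
      * (logRatio ((q.1 + Real.exp (-q.2)) / (geomMean a q.2 * (q.1 + 1)) - 1)
        * (q.1 * expRatio q.2 ^ 2 / (oddsFn a q.2 * geomMean a q.2 * (q.1 + 1)
          * (q.1 + Real.exp (-q.2) + geomMean a q.2 * (q.1 + 1)))))) / (1 + oddsFn a q.2)

theorem AnalyticAt.comp_snd {f : ℝ → ℝ} (hf : AnalyticAt ℝ f 0) (c₀ : ℝ) :
    AnalyticAt ℝ (fun q : ℝ × ℝ => f q.2) (c₀, 0) :=
  AnalyticAt.fun_comp (f := fun q : ℝ × ℝ => q.2) (g := f) (x := (c₀, 0)) hf analyticAt_snd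

theorem analyticAt_logOddsRatio (a : ℝ) : AnalyticAt ℝ (logOddsRatio a) 0 := by
  have := analyticAt_logRatio_oddsFn a
  unfold logOddsRatio
  exact this.fun_mul (AnalyticAt.fun_div (by fun_prop) (by fun_prop) (by simp))

theorem analyticAt_geomMean (a : ℝ) : AnalyticAt ℝ (geomMean a) 0 := by
  have := analyticAt_logOddsRatio a
  unfold geomMean
  fun_prop

theorem geomMean_zero (a : ℝ) : geomMean a 0 = 1 := by simp [geomMean]

section

variable {a : ℝ}

theorem cbarFn_zero_pos (h0 : -1 < 2 * a) (h1 : 2 * a < 1) : 0 < cbarFn a 0 := by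
  rw [cbarFn_zero]; exact div_pos (by linarith) (by linarith)

theorem analyticAt_excessFn (h0 : -1 < 2 * a) (h1 : 2 * a < 1) :
    AnalyticAt ℝ (excessFn a) (cbarFn a 0, 0) := by
  have := (analyticAt_cbarFn h0).comp_snd (cbarFn a 0)
  unfold excessFn
  exact AnalyticAt.fun_div (by fun_prop) (by fun_prop) (cbarFn_zero_pos h0 h1).ne'

theorem excessFn_zero : excessFn a (cbarFn a 0, 0) = 0 := by simp [excessFn]

theorem analyticAt_logSBarFn (h0 : -1 < 2 * a) (h1 : 2 * a < 1) :
    AnalyticAt ℝ (logSBarFn a) (cbarFn a 0, 0) := by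
  have e1 := (analyticAt_etaFn a).comp_snd (cbarFn a 0)
  have e2 := (analyticAt_alphaFn a).comp_snd (cbarFn a 0)
  have e3 := (analyticAt_slopeFn a).comp_snd (cbarFn a 0)
  have e4 := analyticAt_excessFn h0 h1
  unfold logSBarFn
  refine AnalyticAt.fun_mul (by fun_prop) ?_
  refine AnalyticAt.fun_comp (g := logRatio)
    (f := fun q => -(alphaFn a q.2 * slopeFn a q.2 * excessFn a q)) ?_ (by fun_prop)
  rw [excessFn_zero]
  exact analyticAt_logRatio (by simp)

theorem analyticAt_costAn (h0 : -1 < 2 * a) (h1 : 2 * a < 1) :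
    AnalyticAt ℝ (costAn a) (cbarFn a 0, 0) := by
  have e1 := (analyticAt_interceptFn a).comp_snd (cbarFn a 0)
  have e2 := (analyticAt_alphaFn a).comp_snd (cbarFn a 0)
  have e3 := (analyticAt_slopeFn a).comp_snd (cbarFn a 0)
  have e4 := analyticAt_logSBarFn h0 h1
  unfold costAn
  have e5 : AnalyticAt ℝ (fun q : ℝ × ℝ => (alphaFn a q.2 * q.1 + Real.exp (-q.2) * slopeFn a q.2)
      / (interceptFn a q.2 - slopeFn a q.2 * q.1)) (cbarFn a 0, 0) := by
    refine AnalyticAt.fun_div (by fun_prop) (by fun_prop) ?_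
    have h2 : 1 + 2 * a ≠ 0 := by linarith
    have h3 : 1 - 2 * a ≠ 0 := by linarith
    simp only [interceptFn_zero, slopeFn_zero, cbarFn_zero]
    field_simp
    simp [h2, h3]
  fun_prop

theorem analyticAt_upperAn (h0 : -1 < 2 * a) (h1 : 2 * a < 1) :
    AnalyticAt ℝ (upperAn a) (cbarFn a 0, 0) := by
  have e4 := analyticAt_logSBarFn h0 h1
  unfold upperAn
  refine AnalyticAt.fun_div (by fun_prop) (by fun_prop) ?_
  have := cbarFn_zero_pos h0 h1
  positivity

theorem analyticAt_lowerAn (h0 : -1 < 2 * a) (h1 : 2 * a < 1) :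
    AnalyticAt ℝ lowerAn (cbarFn a 0, 0) := by
  unfold lowerAn
  refine AnalyticAt.fun_div (by fun_prop) (by fun_prop) ?_
  have := cbarFn_zero_pos h0 h1
  positivity

theorem analyticAt_growthAn (h0 : -1 < 2 * a) (h1 : 2 * a < 1) :
    AnalyticAt ℝ (growthAn a) (cbarFn a 0, 0) := by
  have e1 := (analyticAt_oddsFn a).comp_snd (cbarFn a 0)
  have e2 := (analyticAt_alphaFn a).comp_snd (cbarFn a 0)
  have e3 := (analyticAt_slopeFn a).comp_snd (cbarFn a 0)
  have e4 := analyticAt_excessFn h0 h1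
  have e5 := (analyticAt_logOddsRatio a).comp_snd (cbarFn a 0)
  have e6 := (analyticAt_geomMean a).comp_snd (cbarFn a 0)
  have e7 := (analyticAt_expRatio 0).comp_snd (cbarFn a 0)
  have hc := cbarFn_zero_pos h0 h1
  have f1 : AnalyticAt ℝ (fun q : ℝ × ℝ => a / (1 - a * q.2)) (cbarFn a 0, 0) :=
    AnalyticAt.fun_div (by fun_prop) (by fun_prop) (by simp)
  have f2 : AnalyticAt ℝ (fun q : ℝ × ℝ =>
      (q.1 + Real.exp (-q.2)) / (geomMean a q.2 * (q.1 + 1)) - 1) (cbarFn a 0, 0) := by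
    refine (AnalyticAt.fun_div (by fun_prop) (by fun_prop) ?_).sub analyticAt_const
    rw [geomMean_zero]; positivity
  have f3 : AnalyticAt ℝ (fun q : ℝ × ℝ => logRatio
      ((q.1 + Real.exp (-q.2)) / (geomMean a q.2 * (q.1 + 1)) - 1)) (cbarFn a 0, 0) := by
    refine AnalyticAt.fun_comp (g := logRatio) ?_ f2
    refine analyticAt_logRatio ?_
    rw [geomMean_zero]; simp; positivity
  have f4 : AnalyticAt ℝ (fun q : ℝ × ℝ => q.1 * expRatio q.2 ^ 2 /
      (oddsFn a q.2 * geomMean a q.2 * (q.1 + 1)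
          * (q.1 + Real.exp (-q.2) + geomMean a q.2 * (q.1 + 1)))) (cbarFn a 0, 0) := by
    refine AnalyticAt.fun_div (by fun_prop) (by fun_prop) ?_
    rw [geomMean_zero, oddsFn_zero]; simp; positivity
  unfold growthAn
  refine AnalyticAt.fun_div (by fun_prop) (by fun_prop) ?_
  rw [oddsFn_zero]; norm_num

end

namespace Regime

variable {a h p d : ℝ}

theorem logSBarFn_eq (H : Regime a h p d) {c : ℝ} (hc : 0 < c) :
    logSBarFn a (c, h) = h * stepCount p d c := by
  rw [H.mul_stepCount_eq hc, H.d_eq]; rfl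

theorem costAn_eq (H : Regime a h p d) {c : ℝ} (hc : Dom p d c) :
    costAn a (c, h) = costFn p d c := by
  rw [H.costFn_eq_exp hc, ← H.logSBarFn_eq hc.1, H.d_eq]; rfl

theorem upperAn_eq (H : Regime a h p d) {c : ℝ} (hc : 0 < c) :
    upperAn a (c, h) = upperBd p d c := by
  rw [upperBd, H.sBar_eq, ← H.logSBarFn_eq hc, div_eq_mul_inv c, ← Real.exp_neg]; rfl

/-! ### The growth rate -/

theorem logOddsRatio_eq (H : Regime a h p d) : h * logOddsRatio a h = Real.log (oddsFn a h) := by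
  have h3 := mul_logRatio (oddsFn a h - 1)
  have h1 := H.one_sub
  rw [add_sub_cancel] at h3
  have h4 : oddsFn a h - 1 = h * (2 * a / (1 - a * h)) := by
    unfold oddsFn; field_simp; ring
  rw [← h3, logOddsRatio]
  nth_rewrite 2 [h4]
  ring

theorem log_geomMean (H : Regime a h p d) :
    Real.log (geomMean a h) = -(h + Real.log (oddsFn a h)) / 2 := by
  rw [geomMean, Real.log_exp, ← H.logOddsRatio_eq]; ring

theorem geomMean_sq (H : Regime a h p d) : oddsFn a h * geomMean a h ^ 2 = d := by
  have h1 : geomMean a h ^ 2 = Real.exp (-(h + Real.log (oddsFn a h))) := by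
    rw [← H.logOddsRatio_eq, geomMean, ← Real.exp_nat_mul]; congr 1; push_cast; ring
  rw [h1, neg_add, Real.exp_add, Real.exp_neg (Real.log _), Real.exp_log H.oddsFn_pos, H.d_eq]
  have := H.oddsFn_pos
  field_simp

theorem geomMean_pos (a h : ℝ) : 0 < geomMean a h := Real.exp_pos _

/-- Removes the singularity at p = 1/2. With s = `geomSum` and β^k = 1/r, the denominator 1 -
β^(k+1) equals (1 - β)(1 + s)/r, and its factor 1 - β cancels 1 - 2p. Centring the logarithm at
√(d/β) prepares the cancellation at h = 0. -/
theorem growthFormula_eq (H : Regime a h p d) {c : ℝ} (hc : Dom p d c)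
    (hs : 0 < 1 + geomSum (odds p) d c) :
    growthFormula p d c = ((1 - oddsFn a h) * Real.log (geomMean a h)
      + (1 + oddsFn a h + (1 - oddsFn a h) * geomSum (odds p) d c)
        * (Real.log ((c + d) / (geomMean a h * (c + 1))) / (1 + geomSum (odds p) d c)))
      / (1 + oddsFn a h) := by
  obtain ⟨hc0, hA, hB⟩ := hc
  have hd := H.d_pos
  have h2 : 0 < 1 - d := sub_pos.2 H.d_lt
  have hp1 : 0 < 1 - p := sub_pos.2 H.p_lt
  have hp0 := H.p_pos
  have hβ := H.oddsFn_pos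
  have hg := geomMean_pos a h
  unfold growthFormula
  split_ifs with hp
  · have ha := H.half_iff.1 hp
    subst ha
    have e1 : oddsFn 0 h = 1 := by simp [oddsFn]
    have e2 : geomMean 0 h = √d := by
      have := H.geomMean_sq
      rw [e1, one_mul] at this
      rw [← this, Real.sqrt_sq hg.le]
    have e3 : 1 + geomSum (odds p) d c = (c ^ 2 - d) / (c * (1 - d)) := by
      rw [hp, odds_half, geomSum]; field_simp; ring
    rw [e3] at hs
    have e4 : 0 < c ^ 2 - d := by
      by_contra hcon
      exact absurd hs (not_lt.2 (div_nonpos_of_nonpos_of_nonneg (by linarith) (by positivity)))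
    rw [e3, e1, e2]
    field_simp
    ring
  · have ha : a ≠ 0 := fun e => hp (H.half_iff.2 e)
    have hl := H.log_oddsFn_ne ha
    have hr : 0 < rFn p d c := by rw [rFn_eq H.p_lt H.d_lt hc0]; positivity
    have hodds : p / (1 - p) = oddsFn a h := H.odds_eq
    have e1 : oddsFn a h ^ stepCount p d c = (rFn p d c)⁻¹ := by
      rw [stepCount, if_neg hp, Real.rpow_def_of_pos hβ, H.log_inv_odds, ← Real.exp_log hr,
        ← Real.exp_neg, Real.exp_log hr]
      congr 1
      field_simp
    have e2 : Real.log ((c + d) * p / ((c + 1) * (1 - p) * d))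
        = Real.log ((c + d) / (c + 1)) + Real.log (oddsFn a h) + h := by
      have : (c + d) * p / ((c + 1) * (1 - p) * d)
          = (c + d) / (c + 1) * oddsFn a h * d⁻¹ := by
        rw [← hodds]; field_simp
      rw [this, Real.log_mul (by positivity) (by positivity),
        Real.log_mul (by positivity) (by positivity), Real.log_inv, H.d_eq, Real.log_exp]
      ring
    have e3 : Real.log ((c + d) / (geomMean a h * (c + 1)))
        = Real.log ((c + d) / (c + 1)) - Real.log (geomMean a h) := by
      rw [← Real.log_div (by positivity) hg.ne']; congr 1; field_simp
    have hβ1 : 1 - oddsFn a h ≠ 0 := by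
      intro e
      have : oddsFn a h = 1 := by linarith
      rw [this, Real.log_one] at hl
      exact hl rfl
    have e5 : rFn p d c = 1 + (1 - oddsFn a h) * geomSum (odds p) d c := by
      rw [rFn_sub_one H.p_lt H.d_lt hc0, H.odds_eq]
    have e6 : p = oddsFn a h / (1 + oddsFn a h) := by
      rw [← hodds]; field_simp; ring
    have e7 : rFn p d c - oddsFn a h = (1 - oddsFn a h) * (1 + geomSum (odds p) d c) := by
      rw [e5]; ring
    rw [hodds, Real.rpow_add_one hβ.ne', e1, e2, e3, H.log_geomMean]
    have e8 : 1 - (rFn p d c)⁻¹ * oddsFn a h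
        = (1 - oddsFn a h) * (1 + geomSum (odds p) d c) / rFn p d c := by
      rw [← e7]; field_simp
    rw [e8]
    rw [e5] at hr ⊢
    generalize Real.log ((c + d) / (c + 1)) = L at *
    generalize Real.log (oddsFn a h) = M at *
    generalize geomSum (odds p) d c = s at *
    rw [e6]
    generalize oddsFn a h = β at *
    have hr' := hr.ne'
    have hs' := hs.ne'
    field_simp
    ring

/-- Removes the singularity at h = 0. With g = √(d/β), the difference of squares (c + d)² - g²(c +
1)² is proportional to (1 - d)²(1 + s), and its first factor is also the argument of the logarithm.
In the quotient this factor drops out and (1 - d)² supplies the power h². -/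
theorem growthAn_eq (H : Regime a h p d) {c : ℝ} (hc : Dom p d c)
    (hs : 0 < 1 + geomSum (odds p) d c) :
    growthFormula p d c = h ^ 2 * growthAn a (c, h) := by
  rw [H.growthFormula_eq hc hs]
  obtain ⟨hc0, hA, hB⟩ := hc
  have hd := H.d_pos
  have h2 : 0 < 1 - d := sub_pos.2 H.d_lt
  have hβ := H.oddsFn_pos
  have hg := geomMean_pos a h
  have h1 := H.one_sub
  have e0 : (1 - oddsFn a h) * Real.log (geomMean a h)
      = h ^ 2 * (a / (1 - a * h) * (1 + logOddsRatio a h)) := by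
    rw [H.log_geomMean, ← H.logOddsRatio_eq, oddsFn]; field_simp; ring
  have e1 : (1 - oddsFn a h) * geomSum (odds p) d c
      = -(alphaFn a h * slopeFn a h * excessFn a (c, h)) := by
    rw [show 1 - oddsFn a h = -(slopeFn a h * (1 - d)) by rw [H.slopeFn_mul]; ring, H.geomSum_eq,
      excessFn, ← H.d_eq]
    field_simp
  have e2 : Real.log ((c + d) / (geomMean a h * (c + 1))) / (1 + geomSum (odds p) d c)
      = h ^ 2 * (logRatio ((c + d) / (geomMean a h * (c + 1)) - 1)
        * (c * expRatio h ^ 2 / (oddsFn a h * geomMean a h * (c + 1)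
          * (c + d + geomMean a h * (c + 1))))) := by
    have e3 := mul_logRatio ((c + d) / (geomMean a h * (c + 1)) - 1)
    rw [add_sub_cancel] at e3
    have e4 : c * (1 - d) ^ 2 * (1 + geomSum (odds p) d c)
        = oddsFn a h * ((c + d - geomMean a h * (c + 1)) * (c + d + geomMean a h * (c + 1))) := by
      have : oddsFn a h * ((c + d - geomMean a h * (c + 1)) * (c + d + geomMean a h * (c + 1)))
          = oddsFn a h * (c + d) ^ 2 - oddsFn a h * geomMean a h ^ 2 * (c + 1) ^ 2 := by ring
      rw [this, H.geomMean_sq, geomSum, H.odds_eq]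
      field_simp
      ring
    rw [← e3, div_eq_iff hs.ne', ← sub_eq_zero]
    have e5 : c * (h * expRatio h) ^ 2 * (1 + geomSum (odds p) d c)
        = oddsFn a h * ((c + d - geomMean a h * (c + 1)) * (c + d + geomMean a h * (c + 1))) := by
      rw [H.mul_expRatio_eq, e4]
    generalize logRatio ((c + d) / (geomMean a h * (c + 1)) - 1) = w
    generalize geomSum (odds p) d c = s at *
    generalize geomMean a h = g at *
    field_simp
    linear_combination (-w) * e5
  rw [e0, e1, e2, growthAn, ← H.d_eq]
  simp only
  ring

end Regime

/-! ### Derivatives at the frictionless ratio -/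

/-- The function `(log (1 + y) - y) / y ^ 2`. -/
def logRatioTwo : ℝ → ℝ := dslope logRatio 0

theorem logRatioTwo_eq (y : ℝ) : Real.log (1 + y) - y = y ^ 2 * logRatioTwo y := by
  have h1 := sub_smul_dslope logRatio 0 y
  rw [logRatio_zero, sub_zero, smul_eq_mul] at h1
  rw [← mul_logRatio, logRatioTwo]
  linear_combination (-y) * h1

theorem logRatioTwo_zero : logRatioTwo 0 = -(1 / 2) := by
  rw [logRatioTwo, dslope_same, hasDerivAt_logRatio.deriv]

theorem analyticAt_logRatioTwo : AnalyticAt ℝ logRatioTwo 0 :=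
  analyticAt_dslope (analyticAt_logRatio (by norm_num)) (analyticAt_logRatio (by norm_num))

/-- The quantity `((1 + β) ^ 2 d / (β (1 + d) ^ 2) - 1) / h ^ 2`. -/
def zetaFn (a h : ℝ) : ℝ :=
  -(expRatio h ^ 2 * alphaFn a h * interceptFn a h / (oddsFn a h * (1 + Real.exp (-h)) ^ 2))

/-- The derivative of the growth rate with respect to the ratio at `c̄`, divided by `h ^ 3`. -/
def growthSlopeRatio (a h : ℝ) : ℝ :=
  alphaFn a h * oddsFn a h * (1 + Real.exp (-h)) * zetaFn a h ^ 2
    * logRatioTwo (h ^ 2 * zetaFn a h)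
    / ((1 + oddsFn a h) * expRatio h * interceptFn a h)

/-- Value at `c̄` of the logarithmic derivative of `1 - F`. -/
def slopeOne (a h : ℝ) : ℝ :=
  1 / cbarFn a h + alphaFn a h + (slopeFn a h - etaFn a h) / cbarFn a h
    - etaFn a h * Real.exp (-h) / cbarFn a h

/-- Value at `c̄` of the second logarithmic derivative of `1 - F`. -/
def slopeTwo (a h : ℝ) : ℝ :=
  -1 / cbarFn a h ^ 2 - alphaFn a h ^ 2
    + slopeFn a h * (slopeFn a h - etaFn a h) / cbarFn a h ^ 2
    + etaFn a h * Real.exp (-h) * (1 / cbarFn a h ^ 2 + alphaFn a h / cbarFn a h)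

/-- Value at `c̄` of the third logarithmic derivative of `1 - F`. -/
def slopeThree (a h : ℝ) : ℝ :=
  2 / cbarFn a h ^ 3 + 2 * alphaFn a h ^ 3
    + 2 * slopeFn a h ^ 2 * (slopeFn a h - etaFn a h) / cbarFn a h ^ 3
    - 2 * etaFn a h * Real.exp (-h) * (1 / cbarFn a h ^ 3 + alphaFn a h / cbarFn a h ^ 2
      + alphaFn a h ^ 2 / cbarFn a h)

/-- The third derivative of the cost function at `c̄`. -/
def thirdCoef (a h : ℝ) : ℝ :=
  -(slopeThree a h + 3 * slopeOne a h * slopeTwo a h + slopeOne a h ^ 3)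

namespace Regime

variable {a h p d : ℝ}

theorem eventually_dom (H : Regime a h p d) {c : ℝ} (hc : Dom p d c) :
    ∀ᶠ t in 𝓝 c, Dom p d t := H.isOpen_dom.mem_nhds hc

theorem logSlope_cbar (H : Regime a h p d) :
    logSlope (alphaFn a h) (slopeFn a h) (interceptFn a h) (etaFn a h) d (cbarFn a h)
      = slopeOne a h := by
  rw [logSlope, H.numFactor_cbar, H.denFactor_cbar, slopeOne, ← H.d_eq]; ring

theorem logSlopeDeriv_cbar (H : Regime a h p d) :
    logSlopeDeriv (alphaFn a h) (slopeFn a h) (interceptFn a h) (etaFn a h) d (cbarFn a h)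
      = slopeTwo a h := by
  rw [logSlopeDeriv, H.numFactor_cbar, H.denFactor_cbar, slopeTwo, ← H.d_eq]; ring

theorem logSlopeDerivTwo_cbar (H : Regime a h p d) :
    logSlopeDerivTwo (alphaFn a h) (slopeFn a h) (interceptFn a h) (etaFn a h) d (cbarFn a h)
      = slopeThree a h := by
  rw [logSlopeDerivTwo, H.numFactor_cbar, H.denFactor_cbar, slopeThree, ← H.d_eq]; ring

/-- The Taylor bounds are stated for the analytic model, the explicit derivatives for `costFn`. Both
functions agree near c, so uniqueness of derivatives transfers the formulas. -/
theorem partialFst_costAn (H : Regime a h p d) {c : ℝ} (hc : Dom p d c)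
    (hF : AnalyticAt ℝ (costAn a) (c, h)) :
    partialFst (costAn a) (c, h) = -((1 - costFn p d c) *
      logSlope (alphaFn a h) (slopeFn a h) (interceptFn a h) (etaFn a h) d c) := by
  refine (hasDerivAt_partialFst hF).unique ((H.hasDerivAt_costFn hc).congr_of_eventuallyEq ?_)
  filter_upwards [H.eventually_dom hc] with t ht using H.costAn_eq ht

theorem eventually_analyticAt_line {f : ℝ × ℝ → ℝ} {c : ℝ} (hF : AnalyticAt ℝ f (c, h)) :
    ∀ᶠ t in 𝓝 c, AnalyticAt ℝ f (t, h) := by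
  have : Tendsto (fun t : ℝ => (t, h)) (𝓝 c) (𝓝 (c, h)) :=
    (continuous_id.prodMk continuous_const).tendsto c
  exact this.eventually hF.eventually_analyticAt

theorem partialFst_two_costAn (H : Regime a h p d) {c : ℝ} (hc : Dom p d c)
    (hF : AnalyticAt ℝ (costAn a) (c, h)) :
    partialFst (partialFst (costAn a)) (c, h) = -((1 - costFn p d c) *
        (logSlopeDeriv (alphaFn a h) (slopeFn a h) (interceptFn a h) (etaFn a h) d c
          + logSlope (alphaFn a h) (slopeFn a h) (interceptFn a h) (etaFn a h) d c ^ 2)) := by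
  refine (hasDerivAt_partialFst (AnalyticAt.partialFst hF)).unique
    ((H.hasDerivAt_costFn_deriv hc).congr_of_eventuallyEq ?_)
  filter_upwards [H.eventually_dom hc, eventually_analyticAt_line hF] with t ht ht'
    using H.partialFst_costAn ht ht'

theorem partialFst_three_costAn (H : Regime a h p d) {c : ℝ} (hc : Dom p d c)
    (hF : AnalyticAt ℝ (costAn a) (c, h)) :
    partialFst (partialFst (partialFst (costAn a))) (c, h) = (-((1 - costFn p d c) *
        (logSlopeDerivTwo (alphaFn a h) (slopeFn a h) (interceptFn a h) (etaFn a h) d c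
          + 3 * logSlope (alphaFn a h) (slopeFn a h) (interceptFn a h) (etaFn a h) d c
            * logSlopeDeriv (alphaFn a h) (slopeFn a h) (interceptFn a h) (etaFn a h) d c
          + logSlope (alphaFn a h) (slopeFn a h) (interceptFn a h) (etaFn a h) d c ^ 3))) := by
  refine (hasDerivAt_partialFst (AnalyticAt.partialFst (AnalyticAt.partialFst hF))).unique
    ((H.hasDerivAt_costFn_deriv_two hc).congr_of_eventuallyEq ?_)
  filter_upwards [H.eventually_dom hc, eventually_analyticAt_line hF] with t ht ht'
    using H.partialFst_two_costAn ht ht'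

theorem partialFst_costAn_cbar (H : Regime a h p d)
    (hF : AnalyticAt ℝ (costAn a) (cbarFn a h, h)) :
    partialFst (costAn a) (cbarFn a h, h) = -slopeOne a h := by
  rw [H.partialFst_costAn H.dom_cbar hF, H.costFn_cbar, H.logSlope_cbar]; ring

theorem partialFst_two_costAn_cbar (H : Regime a h p d)
    (hF : AnalyticAt ℝ (costAn a) (cbarFn a h, h)) :
    partialFst (partialFst (costAn a)) (cbarFn a h, h)
      = -(slopeTwo a h + slopeOne a h ^ 2) := by
  rw [H.partialFst_two_costAn H.dom_cbar hF, H.costFn_cbar, H.logSlope_cbar,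
    H.logSlopeDeriv_cbar]; ring

theorem partialFst_three_costAn_cbar (H : Regime a h p d)
    (hF : AnalyticAt ℝ (costAn a) (cbarFn a h, h)) :
    partialFst (partialFst (partialFst (costAn a))) (cbarFn a h, h) = thirdCoef a h := by
  rw [H.partialFst_three_costAn H.dom_cbar hF, H.costFn_cbar, H.logSlope_cbar,
    H.logSlopeDeriv_cbar, H.logSlopeDerivTwo_cbar, thirdCoef]; ring

theorem deriv_costFn_cbar (H : Regime a h p d) :
    deriv (costFn p d) (cbarFn a h) = -slopeOne a h := by
  rw [(H.hasDerivAt_costFn H.dom_cbar).deriv, H.costFn_cbar, H.logSlope_cbar]; ring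

theorem iteratedDeriv_two_costFn_cbar (H : Regime a h p d) :
    iteratedDeriv 2 (costFn p d) (cbarFn a h) = -(slopeTwo a h + slopeOne a h ^ 2) := by
  have h1 : deriv (costFn p d) =ᶠ[𝓝 (cbarFn a h)] fun c => -((1 - costFn p d c) *
      logSlope (alphaFn a h) (slopeFn a h) (interceptFn a h) (etaFn a h) d c) := by
    filter_upwards [H.eventually_dom H.dom_cbar] with t ht using (H.hasDerivAt_costFn ht).deriv
  rw [iteratedDeriv_succ, iteratedDeriv_one, h1.deriv_eq,
    (H.hasDerivAt_costFn_deriv H.dom_cbar).deriv, H.costFn_cbar, H.logSlope_cbar,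
    H.logSlopeDeriv_cbar]
  ring

/-- At c̄ the logarithm of s̄ vanishes and has slope η(1 + d)/c̄. As η(1 + d) tends to 2, the upper
boundary moves opposite to the lower one, at the same speed in the limit. -/
theorem partialFst_upperAn_cbar (H : Regime a h p d)
    (hF : AnalyticAt ℝ (upperAn a) (cbarFn a h, h)) :
    partialFst (upperAn a) (cbarFn a h, h)
      = -(1 - etaFn a h * (1 + Real.exp (-h))) / (1 + cbarFn a h) ^ 2 := by
  have hq := H.cbarFn_pos
  have h1 := (H.hasDerivAt_stepCount H.dom_cbar).neg.exp
  have h2 := (((hasDerivAt_id (cbarFn a h)).mul h1).const_add 1).inv (by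
    simp [H.stepCount_cbar]; positivity)
  have h3 : HasDerivAt (fun s => upperAn a (s, h))
      (-(1 - etaFn a h * (1 + Real.exp (-h))) / (1 + cbarFn a h) ^ 2) (cbarFn a h) := by
    refine (h2.congr_of_eventuallyEq ?_).congr_deriv ?_
    · filter_upwards [H.eventually_dom H.dom_cbar] with t ht
      simp [upperAn, H.logSBarFn_eq ht.1]
    · rw [H.numFactor_cbar, H.denFactor_cbar, ← H.d_eq]
      simp [H.stepCount_cbar]
      field_simp
      ring
  exact (hasDerivAt_partialFst hF).unique h3

theorem alphaFn_mul_add_exp (H : Regime a h p d) : alphaFn a h * (cbarFn a h + d) = 1 + d := by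
  have h2 : 0 < 1 - d := sub_pos.2 H.d_lt
  have h3 : (alphaFn a h * (cbarFn a h + d) - (1 + d)) * (1 - d) = 0 := by
    rw [mul_add, ← H.interceptFn_eq]
    linear_combination H.interceptFn_mul + d * H.alphaFn_mul
  rcases mul_eq_zero.1 h3 with h | h <;> linarith

theorem alphaFn_mul_add_one (H : Regime a h p d) :
    alphaFn a h * (cbarFn a h + 1) = 1 + oddsFn a h := by
  have h2 : 0 < 1 - d := sub_pos.2 H.d_lt
  have h3 : (alphaFn a h * (cbarFn a h + 1) - (1 + oddsFn a h)) * (1 - d) = 0 := by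
    rw [mul_add, ← H.interceptFn_eq]
    linear_combination H.interceptFn_mul + H.alphaFn_mul
  rcases mul_eq_zero.1 h3 with h | h <;> linarith

theorem sq_mul_zetaFn (H : Regime a h p d) : h ^ 2 * zetaFn a h
    = -((1 - d) ^ 2 * alphaFn a h * interceptFn a h / (oddsFn a h * (1 + d) ^ 2)) := by
  rw [zetaFn, ← H.mul_expRatio_eq, ← H.d_eq]
  ring

theorem one_add_zeta (H : Regime a h p d) : 1 + h ^ 2 * zetaFn a h
    = (1 + oddsFn a h) ^ 2 * d / (oddsFn a h * (1 + d) ^ 2) := by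
  have hd := H.d_pos
  have hβ := H.oddsFn_pos
  have : (1 - d) ^ 2 * alphaFn a h * interceptFn a h
      = (oddsFn a h - d) * (1 - oddsFn a h * d) := by
    rw [← H.alphaFn_mul, ← H.interceptFn_mul]; ring
  rw [H.sq_mul_zetaFn, this]
  field_simp
  ring

/-- At c̄ both c + d and c + 1 are multiples of 1/α, so c disappears from the logarithm, which
becomes that of a quantity 1 + O(h²). -/
theorem log_ratio_cbar (H : Regime a h p d) :
    Real.log ((cbarFn a h + d) / (geomMean a h * (cbarFn a h + 1)))
      = -(Real.log (1 + h ^ 2 * zetaFn a h)) / 2 := by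
  have hd := H.d_pos
  have hβ := H.oddsFn_pos
  have hα := H.alphaFn_pos
  have hg := geomMean_pos a h
  have hq := H.cbarFn_pos
  have e : 1 + h ^ 2 * zetaFn a h
      = (((cbarFn a h + d) / (geomMean a h * (cbarFn a h + 1))) ^ 2)⁻¹ := by
    have e1 : cbarFn a h + d = (1 + d) / alphaFn a h := by
      rw [← H.alphaFn_mul_add_exp]; field_simp
    have e2 : cbarFn a h + 1 = (1 + oddsFn a h) / alphaFn a h := by
      rw [← H.alphaFn_mul_add_one]; field_simp
    have e3 := H.geomMean_sq
    rw [H.one_add_zeta, e1, e2]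
    have e4 : (((1 + d) / alphaFn a h / (geomMean a h * ((1 + oddsFn a h) / alphaFn a h))) ^ 2)⁻¹
        = (1 + oddsFn a h) ^ 2 * (oddsFn a h * geomMean a h ^ 2)
          / (oddsFn a h * (1 + d) ^ 2) := by
      field_simp
    rw [e4, e3]
  rw [e, Real.log_inv, Real.log_pow]
  push_cast
  ring

/-- In the derivative at c̄ the linear part of log(1 + h²ζ) cancels the derivative of the logarithm
exactly; only the quadratic remainder `logRatioTwo` is left. Hence the growth rate loses one further
order in h, and its λ^(1/3) coefficient starts at √δ. -/
theorem partialFst_growthAn_cbar (H : Regime a h p d)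
    (hF : AnalyticAt ℝ (growthAn a) (cbarFn a h, h)) :
    partialFst (growthAn a) (cbarFn a h, h) = h * growthSlopeRatio a h := by
  have hh := H.h_pos
  have hd := H.d_pos
  have h2 : 0 < 1 - d := sub_pos.2 H.d_lt
  have hβ := H.oddsFn_pos
  have hα := H.alphaFn_pos
  have hg := geomMean_pos a h
  have hq := H.cbarFn_pos
  have hb := H.interceptFn_pos
  have hE := H.expRatio_pos
  have e0 := hasDerivAt_id (cbarFn a h)
  have hs0 : geomSum (odds p) d (cbarFn a h) = 0 := by rw [H.geomSum_eq]; simp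
  have es : HasDerivAt (geomSum (odds p) d) (alphaFn a h * (cbarFn a h + d)
      / (cbarFn a h * (1 - d))) (cbarFn a h) := by
    have e1 := (((e0.sub_const (cbarFn a h)).const_mul (alphaFn a h)).mul (e0.add_const d)).div
      (e0.mul_const (1 - d)) (mul_ne_zero hq.ne' h2.ne')
    refine (e1.congr_of_eventuallyEq (Eventually.of_forall fun c => ?_)).congr_deriv ?_
    · rw [H.geomSum_eq]; simp
    · simp; field_simp
  have eℓ : HasDerivAt (fun c => Real.log ((c + d) / (geomMean a h * (c + 1))))
      (1 / (cbarFn a h + d) - 1 / (cbarFn a h + 1)) (cbarFn a h) := by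
    have e1 := ((e0.add_const d).div ((e0.add_const 1).const_mul (geomMean a h))
      (by simp; constructor <;> positivity)).log (by simp; refine ⟨?_, ?_, ?_⟩ <;> positivity)
    refine e1.congr_deriv ?_
    simp
    field_simp
  have hsev : ∀ᶠ t in 𝓝 (cbarFn a h), 0 < 1 + geomSum (odds p) d t := by
    have : Tendsto (fun t => 1 + geomSum (odds p) d t) (𝓝 (cbarFn a h)) (𝓝 (1 + 0)) := by
      rw [← hs0]; exact (es.continuousAt.tendsto).const_add 1
    exact this.eventually (lt_mem_nhds (by norm_num))
  have eG := ((((es.const_mul (1 - oddsFn a h)).const_add (1 + oddsFn a h)).mul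
    (eℓ.div (es.const_add 1) (by rw [hs0]; norm_num))).const_add
      ((1 - oddsFn a h) * Real.log (geomMean a h))).div_const (1 + oddsFn a h)
      |>.div_const (h ^ 2)
  refine (hasDerivAt_partialFst hF).unique ((eG.congr_of_eventuallyEq ?_).congr_deriv ?_)
  · filter_upwards [H.eventually_dom H.dom_cbar, hsev] with t ht hst
    have e1 := H.growthAn_eq ht hst
    rw [H.growthFormula_eq ht hst] at e1
    simp only [Pi.mul_apply, Pi.div_apply]
    rw [e1]
    field_simp
  · have e1 : cbarFn a h + d = (1 + d) / alphaFn a h := by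
      rw [← H.alphaFn_mul_add_exp]; field_simp
    have e2 : cbarFn a h + 1 = (1 + oddsFn a h) / alphaFn a h := by
      rw [← H.alphaFn_mul_add_one]; field_simp
    -- Splits the logarithm into the linear part, which cancels, and the remainder.
    have e3 := logRatioTwo_eq (h ^ 2 * zetaFn a h)
    have e4 : Real.log (1 + h ^ 2 * zetaFn a h)
      = (h ^ 2 * zetaFn a h) ^ 2 * logRatioTwo (h ^ 2 * zetaFn a h) + h ^ 2 * zetaFn a h := by
      linarith
    have e5 : cbarFn a h = interceptFn a h / alphaFn a h := by
      rw [H.interceptFn_eq]; field_simp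
    have e6 : 1 / (cbarFn a h + d) - 1 / (cbarFn a h + 1)
        = alphaFn a h ^ 2 * (h * expRatio h) / ((1 + d) * (1 + oddsFn a h)) := by
      have e7 := H.alphaFn_mul
      rw [e1, e2, H.mul_expRatio_eq]
      field_simp
      linear_combination (-1) * e7
    have e7 : alphaFn a h * (cbarFn a h + d) / (cbarFn a h * (1 - d))
        = alphaFn a h * (1 + d) / (interceptFn a h * (h * expRatio h)) := by
      rw [H.alphaFn_mul_add_exp, e5, H.mul_expRatio_eq]
      field_simp
    have e8 : zetaFn a h = -(expRatio h ^ 2 * alphaFn a h * interceptFn a h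
        / (oddsFn a h * (1 + d) ^ 2)) := by rw [zetaFn, ← H.d_eq]
    simp only [Pi.div_apply]
    rw [H.log_ratio_cbar, hs0, e4, e6, e7, growthSlopeRatio, ← H.d_eq]
    generalize logRatioTwo (h ^ 2 * zetaFn a h) = w at *
    rw [e8]
    field_simp
    ring

end Regime

theorem partialFst_lowerAn {c h : ℝ} (hc : 0 < 1 + c) (hF : AnalyticAt ℝ lowerAn (c, h)) :
    partialFst lowerAn (c, h) = -1 / (1 + c) ^ 2 := by
  refine (hasDerivAt_partialFst hF).unique ?_
  have := ((hasDerivAt_id c).const_add 1).inv hc.ne'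
  refine (this.congr_of_eventuallyEq (Eventually.of_forall fun x => ?_)).congr_deriv (by simp)
  simp [lowerAn]

/-! ### Expansions of the coefficients -/

section

variable {a : ℝ}

theorem analyticAt_cbarFn_inv (h0 : -1 < 2 * a) (h1 : 2 * a < 1) :
    AnalyticAt ℝ (fun h => (cbarFn a h)⁻¹) 0 :=
  (analyticAt_cbarFn h0).inv (cbarFn_zero_pos h0 h1).ne'

theorem hasDerivAt_cbarFn_inv (h0 : -1 < 2 * a) (h1 : 2 * a < 1) :
    HasDerivAt (fun h => (cbarFn a h)⁻¹) 0 0 :=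
  ((hasDerivAt_cbarFn h0).inv (cbarFn_zero_pos h0 h1).ne').congr_deriv (by simp)

theorem analyticAt_slopeOne (h0 : -1 < 2 * a) (h1 : 2 * a < 1) :
    AnalyticAt ℝ (slopeOne a) 0 := by
  have e1 := analyticAt_cbarFn_inv h0 h1
  have e2 := analyticAt_alphaFn a
  have e3 := analyticAt_slopeFn a
  have e4 := analyticAt_etaFn a
  unfold slopeOne
  simp only [div_eq_mul_inv]
  fun_prop

theorem analyticAt_slopeTwo (h0 : -1 < 2 * a) (h1 : 2 * a < 1) :
    AnalyticAt ℝ (slopeTwo a) 0 := by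
  have e1 := analyticAt_cbarFn_inv h0 h1
  have e2 := analyticAt_alphaFn a
  have e3 := analyticAt_slopeFn a
  have e4 := analyticAt_etaFn a
  unfold slopeTwo
  simp only [div_eq_mul_inv, ← inv_pow]
  fun_prop

theorem analyticAt_slopeThree (h0 : -1 < 2 * a) (h1 : 2 * a < 1) :
    AnalyticAt ℝ (slopeThree a) 0 := by
  have e1 := analyticAt_cbarFn_inv h0 h1
  have e2 := analyticAt_alphaFn a
  have e3 := analyticAt_slopeFn a
  have e4 := analyticAt_etaFn a
  unfold slopeThree
  simp only [div_eq_mul_inv, ← inv_pow]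
  fun_prop

theorem analyticAt_thirdCoef (h0 : -1 < 2 * a) (h1 : 2 * a < 1) :
    AnalyticAt ℝ (thirdCoef a) 0 := by
  have e1 := analyticAt_slopeOne h0 h1
  have e2 := analyticAt_slopeTwo h0 h1
  have e3 := analyticAt_slopeThree h0 h1
  unfold thirdCoef
  fun_prop

/-- With `slopeTwo_zero`, the reason for the exponent 1/3: in the limit h = 0 the cost function
starts with a cubic term at c̄. -/
theorem slopeOne_zero (h0 : -1 < 2 * a) (h1 : 2 * a < 1) : slopeOne a 0 = 0 := by
  have h2 : 1 + 2 * a ≠ 0 := by linarith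
  have h3 : 1 - 2 * a ≠ 0 := by linarith
  rw [slopeOne, cbarFn_zero, alphaFn_zero, slopeFn_zero, etaFn_zero]
  simp
  field_simp
  ring

theorem slopeTwo_zero (h0 : -1 < 2 * a) (h1 : 2 * a < 1) : slopeTwo a 0 = 0 := by
  have h2 : 1 + 2 * a ≠ 0 := by linarith
  have h3 : 1 - 2 * a ≠ 0 := by linarith
  rw [slopeTwo, cbarFn_zero, alphaFn_zero, slopeFn_zero, etaFn_zero]
  simp
  field_simp
  ring

theorem thirdCoef_zero (h0 : -1 < 2 * a) (h1 : 2 * a < 1) :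
    thirdCoef a 0 = 2 * (1 + 2 * a) ^ 4 / (1 - 2 * a) ^ 2 := by
  have h2 : 1 + 2 * a ≠ 0 := by linarith
  have h3 : 1 - 2 * a ≠ 0 := by linarith
  rw [thirdCoef, slopeOne_zero h0 h1, slopeTwo_zero h0 h1, slopeThree, cbarFn_zero, alphaFn_zero,
    slopeFn_zero, etaFn_zero]
  simp
  field_simp
  ring

theorem thirdCoef_zero_pos (h0 : -1 < 2 * a) (h1 : 2 * a < 1) : 0 < thirdCoef a 0 := by
  rw [thirdCoef_zero h0 h1]
  have h2 : 0 < 1 + 2 * a := by linarith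
  have h3 : 0 < 1 - 2 * a := by linarith
  positivity

theorem hasDerivAt_slopeThree (h0 : -1 < 2 * a) (h1 : 2 * a < 1) :
    HasDerivAt (slopeThree a) (-(thirdCoef a 0 * (6 * a - 3 / 2))) 0 := by
  have h2 : 1 + 2 * a ≠ 0 := by linarith
  have h3 : 1 - 2 * a ≠ 0 := by linarith
  have e1 := hasDerivAt_cbarFn_inv h0 h1
  have e2 := hasDerivAt_alphaFn a
  have e3 := hasDerivAt_slopeFn a
  have e4 := hasDerivAt_etaFn a
  have e5 := hasDerivAt_exp_neg_zero
  have f1 := (e1.pow 3).const_mul 2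
  have f2 := (e2.pow 3).const_mul 2
  have f3 := (((e3.pow 2).mul (e3.sub e4)).mul (e1.pow 3)).const_mul 2
  have f4 := ((e4.mul e5).mul (((e1.pow 3).add (e2.mul (e1.pow 2))).add
    ((e2.pow 2).mul e1))).const_mul 2
  refine ((((f1.add f2).add f3).sub f4).congr_of_eventuallyEq
    (Eventually.of_forall fun h => ?_)).congr_deriv ?_
  · simp [slopeThree]; ring
  · rw [thirdCoef_zero h0 h1]
    simp [cbarFn_zero, alphaFn_zero, slopeFn_zero, etaFn_zero]
    field_simp
    ring

/-- Only `slopeThree` contributes: the other two terms are products of functions that vanish at h =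
0. -/
theorem hasDerivAt_thirdCoef (h0 : -1 < 2 * a) (h1 : 2 * a < 1) :
    HasDerivAt (thirdCoef a) (thirdCoef a 0 * (6 * a - 3 / 2)) 0 := by
  have e1 := (analyticAt_slopeOne h0 h1).differentiableAt.hasDerivAt
  have e2 := (analyticAt_slopeTwo h0 h1).differentiableAt.hasDerivAt
  have e3 := hasDerivAt_slopeThree h0 h1
  have f := ((e3.add ((e1.const_mul 3).mul e2)).add (e1.pow 3)).neg
  refine (f.congr_of_eventuallyEq (Eventually.of_forall fun h => ?_)).congr_deriv ?_
  · simp [thirdCoef]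
  · simp [slopeOne_zero h0 h1, slopeTwo_zero h0 h1]

/-- The leading coefficient of `c - c̄` as a function of `λ ^ (1/3)`. -/
def rootCoef (a h : ℝ) : ℝ := Real.exp (Real.log (6 / thirdCoef a h) / 3)

theorem rootCoef_pos (a h : ℝ) : 0 < rootCoef a h := Real.exp_pos _

theorem rootCoef_cube {h : ℝ} (ht : 0 < thirdCoef a h) :
    rootCoef a h ^ 3 = 6 / thirdCoef a h := by
  rw [rootCoef, ← Real.exp_nat_mul]
  push_cast
  rw [mul_div_cancel₀ _ (by norm_num), Real.exp_log (by positivity)]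

/-- The cube root is defined through exp and log so that analyticity follows from positivity of
`thirdCoef`. -/
theorem analyticAt_rootCoef (h0 : -1 < 2 * a) (h1 : 2 * a < 1) :
    AnalyticAt ℝ (rootCoef a) 0 := by
  have ht := thirdCoef_zero_pos h0 h1
  have e : AnalyticAt ℝ (fun h => Real.log (6 / thirdCoef a h)) 0 :=
    (AnalyticAt.fun_div analyticAt_const (analyticAt_thirdCoef h0 h1) ht.ne').log (by positivity)
  unfold rootCoef
  fun_prop

theorem hasDerivAt_rootCoef (h0 : -1 < 2 * a) (h1 : 2 * a < 1) :
    HasDerivAt (rootCoef a) (rootCoef a 0 * (1 / 2 - 2 * a)) 0 := by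
  have ht := thirdCoef_zero_pos h0 h1
  have e := (((hasDerivAt_const (0 : ℝ) (6 : ℝ)).div (hasDerivAt_thirdCoef h0 h1) ht.ne').log
    (by simpa using ht.ne')).div_const 3 |>.exp
  refine e.congr_deriv ?_
  simp only [rootCoef, Pi.div_apply]
  field_simp
  ring

theorem zetaFn_zero : zetaFn a 0 = -((1 + 2 * a) * (1 - 2 * a) / 4) := by
  rw [zetaFn, expRatio_zero, alphaFn_zero, interceptFn_zero, oddsFn_zero]
  norm_num

theorem analyticAt_zetaFn : AnalyticAt ℝ (zetaFn a) 0 := by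
  have e1 := analyticAt_oddsFn a
  have e2 := analyticAt_alphaFn a
  have e3 := analyticAt_interceptFn a
  unfold zetaFn
  refine (AnalyticAt.fun_div (by fun_prop) (by fun_prop) ?_).neg
  rw [oddsFn_zero]; norm_num

theorem analyticAt_growthSlopeRatio (h1 : 2 * a < 1) : AnalyticAt ℝ (growthSlopeRatio a) 0 := by
  have e1 := analyticAt_oddsFn a
  have e2 := analyticAt_alphaFn a
  have e3 := analyticAt_interceptFn a
  have e4 := analyticAt_zetaFn (a := a)
  have e5 : AnalyticAt ℝ (fun h => logRatioTwo (h ^ 2 * zetaFn a h)) 0 := by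
    refine AnalyticAt.fun_comp (g := logRatioTwo) ?_ (by fun_prop)
    simpa using analyticAt_logRatioTwo
  unfold growthSlopeRatio
  refine AnalyticAt.fun_div (by fun_prop) (by fun_prop) ?_
  rw [oddsFn_zero, expRatio_zero, interceptFn_zero]
  have : 1 - 2 * a ≠ 0 := by linarith
  simpa using this

theorem growthSlopeRatio_zero (h1 : 2 * a < 1) :
    growthSlopeRatio a 0 = -((1 + 2 * a) ^ 3 * (1 - 2 * a) / 32) := by
  have : 1 - 2 * a ≠ 0 := by linarith
  rw [growthSlopeRatio, oddsFn_zero, expRatio_zero, interceptFn_zero, alphaFn_zero, zetaFn_zero]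
  norm_num [logRatioTwo_zero]
  field_simp
  ring

theorem hasDerivAt_mul_growthSlopeRatio (h1 : 2 * a < 1) :
    HasDerivAt (fun h => h * growthSlopeRatio a h) (-((1 + 2 * a) ^ 3 * (1 - 2 * a) / 32)) 0 := by
  have e := (hasDerivAt_id (0 : ℝ)).mul
    (analyticAt_growthSlopeRatio h1).differentiableAt.hasDerivAt
  refine e.congr_deriv ?_
  simp [growthSlopeRatio_zero h1]

/-- `exp (-h)` up to fourth order. -/
theorem isBigO_exp_neg : (fun h : ℝ => Real.exp (-h) - (1 - h + h ^ 2 / 2 - h ^ 3 / 6 + h ^ 4 / 24))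
    =O[𝓝 0] fun h => h ^ 5 := by
  refine IsBigO.of_bound 1 ?_
  filter_upwards [Metric.ball_mem_nhds (0 : ℝ) one_pos] with h hh
  have hh1 : |(-h)| ≤ 1 := by
    rw [abs_neg]; simpa [Real.dist_eq] using (Metric.mem_ball.1 hh).le
  have := Real.exp_bound hh1 (n := 5) (by norm_num)
  simp [Finset.sum_range_succ, Nat.factorial] at this
  rw [Real.norm_eq_abs, Real.norm_eq_abs, one_mul, abs_pow]
  have h5 : 0 ≤ |h| ^ 5 := by positivity
  refine le_trans (le_of_eq ?_) (this.trans ?_)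
  · congr 1; ring
  · nlinarith

end

theorem isBigO_pow_mul_of_continuousAt {f : ℝ → ℝ} {n m : ℕ} (hnm : n ≤ m)
    (hf : ContinuousAt f 0) : (fun h : ℝ => h ^ m * f h) =O[𝓝 0] fun h => h ^ n := by
  obtain ⟨k, rfl⟩ := Nat.exists_eq_add_of_le hnm
  have e : (fun h : ℝ => h ^ k * f h) =O[𝓝 0] fun _ => (1 : ℝ) :=
    ((by fun_prop : ContinuousAt (fun h : ℝ => h ^ k) 0).mul hf).tendsto.isBigO_one ℝ
  refine ((isBigO_refl (fun h : ℝ => h ^ n) (𝓝 0)).mul e).congr (fun h => ?_) (fun h => ?_)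
  · ring
  · ring

/-- `log (1 - x)` up to fourth order. -/
theorem isBigO_log_one_sub :
    (fun x : ℝ => Real.log (1 - x) - -(x + x ^ 2 / 2 + x ^ 3 / 3 + x ^ 4 / 4))
      =O[𝓝 0] fun x => x ^ 5 := by
  refine IsBigO.of_bound 2 ?_
  filter_upwards [Metric.ball_mem_nhds (0 : ℝ) (show (0 : ℝ) < 1 / 2 by norm_num)] with x hx
  have hx1 : |x| < 1 / 2 := by simpa [Real.dist_eq] using Metric.mem_ball.1 hx
  have := Real.abs_log_sub_add_sum_range_le (x := x) (by linarith) 4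
  norm_num [Finset.sum_range_succ] at this
  rw [Real.norm_eq_abs, Real.norm_eq_abs, abs_pow]
  refine le_trans (le_of_eq ?_) (this.trans ?_)
  · congr 1; ring
  · rw [div_le_iff₀ (by linarith)]
    have : 0 ≤ |x| ^ 5 := by positivity
    nlinarith

theorem isBigO_cosh : (fun h : ℝ => Real.cosh h - (1 + h ^ 2 / 2 + h ^ 4 / 24))
    =O[𝓝 0] fun h => h ^ 5 := by
  have e1 := isBigO_exp_neg
  have t : Tendsto (fun h : ℝ => -h) (𝓝 0) (𝓝 0) := by
    simpa using (continuous_neg.tendsto (0 : ℝ))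
  have e2 : (fun h : ℝ => Real.exp h - (1 + h + h ^ 2 / 2 + h ^ 3 / 6 + h ^ 4 / 24))
      =O[𝓝 0] fun h => h ^ 5 := by
    refine ((e1.comp_tendsto t).neg_right).congr (fun h => ?_) (fun h => ?_)
    · simp; ring
    · simp; ring
  refine ((e1.add e2).const_mul_left (1 / 2)).congr_left fun h => ?_
  rw [Real.cosh_eq]; ring

/-- `(h / 2) coth (h / 2)` up to second order. -/
theorem isBigO_halfCoth :
    (fun h => halfCoth h - (1 + h ^ 2 / 12)) =O[𝓝[>] 0] fun h => h ^ 3 := by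
  -- The claim multiplied by 2h times `expRatio h`. After inserting the fourth order expansion of
  -- exp(-h), all powers below h⁴ cancel, and `f2` bounds the polynomial that is left.
  have e1 : (fun h => h * (1 + Real.exp (-h)) - 2 * (1 - Real.exp (-h)) * (1 + h ^ 2 / 12))
      =O[𝓝 0] fun h => h ^ 4 := by
    have f1 : (fun h : ℝ => (Real.exp (-h) - (1 - h + h ^ 2 / 2 - h ^ 3 / 6 + h ^ 4 / 24))
        * (h + 2 * (1 + h ^ 2 / 12))) =O[𝓝 0] fun h => h ^ 4 := by
      have g1 : (fun h : ℝ => h + 2 * (1 + h ^ 2 / 12)) =O[𝓝 0] fun _ => (1 : ℝ) :=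
        (by fun_prop : ContinuousAt (fun h : ℝ => h + 2 * (1 + h ^ 2 / 12)) 0).tendsto.isBigO_one ℝ
      have g2 : (fun h : ℝ => h ^ 5) =O[𝓝 0] fun h => h ^ 4 := by
        simpa using isBigO_pow_mul_of_continuousAt (f := fun _ => 1) (show 4 ≤ 5 by norm_num)
          continuousAt_const
      simpa using (isBigO_exp_neg.trans g2).mul g1
    have f2 := isBigO_pow_mul_of_continuousAt (n := 4) (m := 4) le_rfl
      (f := fun h => -1/12 + h/24 + 1/12 - h/36 + h^2/144)
      (by fun_prop)
    refine (f1.add f2).congr_left fun h => ?_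
    ring
  have e2 : (fun h : ℝ => (2 * expRatio h)⁻¹) =O[𝓝 0] fun _ => (1 : ℝ) := by
    have : ContinuousAt (fun h : ℝ => (2 * expRatio h)⁻¹) 0 := by
      refine ContinuousAt.inv₀ ((analyticAt_expRatio 0).continuousAt.const_mul 2) ?_
      rw [expRatio_zero]; norm_num
    exact this.tendsto.isBigO_one ℝ
  have e3 := ((e1.mul e2).mono (nhdsWithin_le_nhds (s := Ioi 0))).mul
    (isBigO_refl (fun h : ℝ => h⁻¹) (𝓝[>] 0))
  refine e3.congr' ?_ ?_
  · have hE : ∀ᶠ h in 𝓝[>] (0 : ℝ), expRatio h ≠ 0 :=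
      (((analyticAt_expRatio 0).continuousAt.eventually_ne
        (by rw [expRatio_zero]; norm_num))).filter_mono nhdsWithin_le_nhds
    filter_upwards [hE, self_mem_nhdsWithin] with h hh hpos
    have hpos' : (0 : ℝ) < h := hpos
    have e4 := mul_expRatio h
    rw [← e4, halfCoth]
    field_simp
  · filter_upwards [self_mem_nhdsWithin] with h hpos
    have hpos' : (0 : ℝ) < h := hpos
    field_simp

theorem eventually_one_add_mul (a : ℝ) : ∀ᶠ h in 𝓝 (0 : ℝ), 0 < 1 + a * h := by
  have : Tendsto (fun h => 1 + a * h) (𝓝 0) (𝓝 (1 + a * 0)) :=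
    (by fun_prop : Continuous fun h => 1 + a * h).tendsto 0
  exact this.eventually (lt_mem_nhds (by norm_num))

theorem eventually_regime {a : ℝ} (h0 : -1 < 2 * a) (h1 : 2 * a < 1) :
    ∀ᶠ h in 𝓝[>] (0 : ℝ), Regime a h ((1 + a * h) / 2) (Real.exp (-h)) := by
  have e1 : Tendsto (fun h => 1 + 2 * a * halfCoth h) (𝓝 0) (𝓝 (1 + 2 * a * 1)) := by
    rw [← halfCoth_zero]
    exact (analyticAt_halfCoth.continuousAt.tendsto.const_mul _).const_add _
  have e2 : Tendsto (fun h => 1 - 2 * a * halfCoth h) (𝓝 0) (𝓝 (1 - 2 * a * 1)) := by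
    rw [← halfCoth_zero]
    exact (analyticAt_halfCoth.continuousAt.tendsto.const_mul _).const_sub _
  have f1 := (e1.eventually (lt_mem_nhds (show 0 < 1 + 2 * a * 1 by linarith))).filter_mono
    (nhdsWithin_le_nhds (s := Ioi 0))
  have f2 := (e2.eventually (lt_mem_nhds (show 0 < 1 - 2 * a * 1 by linarith))).filter_mono
    (nhdsWithin_le_nhds (s := Ioi 0))
  have f3 := (eventually_one_add_mul a).filter_mono (nhdsWithin_le_nhds (s := Ioi 0))
  have f4 := (eventually_one_add_mul (-a)).filter_mono (nhdsWithin_le_nhds (s := Ioi 0))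
  filter_upwards [f1, f2, f3, f4, self_mem_nhdsWithin] with h g1 g2 g3 g4 g5
  exact ⟨g5, rfl, rfl, g3, by linarith, g1, g2⟩

/-- The frictionless proportion is 1/2 + a `halfCoth`, so its expansion is that of `halfCoth`. -/
theorem isBigO_lowerCoef {a : ℝ} (h0 : -1 < 2 * a) (h1 : 2 * a < 1) :
    (fun h => 1 / (1 + cbarFn a h) - (a + 1 / 2 + 2 * a * h ^ 2 / 24)) =O[𝓝[>] 0]
      fun h => h ^ 3 := by
  refine (isBigO_halfCoth.const_mul_left a).congr' ?_ EventuallyEq.rfl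
  filter_upwards [eventually_regime h0 h1] with h H
  have := H.num_pos
  unfold cbarFn
  rw [show 1 + (1 - 2 * a * halfCoth h) / (1 + 2 * a * halfCoth h)
    = 2 / (1 + 2 * a * halfCoth h) by field_simp; ring]
  field_simp
  ring

/-- The frictionless growth rate. -/
theorem Regime.growthAn_cbar {a h p d : ℝ} (H : Regime a h p d) :
    h ^ 2 * growthAn a (cbarFn a h, h) = Real.log (1 - (a * h) ^ 2) / 2
      + Real.log (1 - (1 - Real.cosh h) / 2) / 2
      + a * h * (h + (Real.log (1 - -(a * h)) - Real.log (1 - a * h))) / 2 := by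
  have hs0 : geomSum (odds p) d (cbarFn a h) = 0 := by rw [H.geomSum_eq]; simp
  have hd := H.d_pos
  have hβ := H.oddsFn_pos
  have g1 := H.one_add
  have g2 := H.one_sub
  rw [← H.growthAn_eq H.dom_cbar (by rw [hs0]; norm_num),
    H.growthFormula_eq H.dom_cbar (by rw [hs0]; norm_num), hs0, H.log_ratio_cbar, H.log_geomMean,
    H.one_add_zeta]
  have e1 : (1 + oddsFn a h) ^ 2 * d / (oddsFn a h * (1 + d) ^ 2)
      = ((1 - (a * h) ^ 2) * (1 - (1 - Real.cosh h) / 2))⁻¹ := by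
    have f1 : 1 - (1 - Real.cosh h) / 2 = (1 + d) ^ 2 / (4 * d) := by
      rw [Real.cosh_eq, H.d_eq, Real.exp_neg]; field_simp; ring
    have f2 : 1 - (a * h) ^ 2 = (1 + a * h) * (1 - a * h) := by ring
    rw [f1, f2, oddsFn]
    field_simp
    ring
  have e2 : Real.log (oddsFn a h) = Real.log (1 - -(a * h)) - Real.log (1 - a * h) := by
    rw [oddsFn, Real.log_div g1.ne' g2.ne', sub_neg_eq_add]
  have e3 : 0 < 1 - (a * h) ^ 2 := by
    rw [show 1 - (a * h) ^ 2 = (1 + a * h) * (1 - a * h) by ring]; positivity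
  have e4 : 0 < 1 - (1 - Real.cosh h) / 2 := by linarith [Real.one_le_cosh h]
  rw [e1, Real.log_inv, Real.log_mul e3.ne' e4.ne', e2]
  have e5 : oddsFn a h = (1 + a * h) / (1 - a * h) := rfl
  rw [e5]
  generalize Real.log (1 - (a * h) ^ 2) = L₁
  generalize Real.log (1 - (1 - Real.cosh h) / 2) = L₂
  generalize Real.log (1 - -(a * h)) = L₃
  generalize Real.log (1 - a * h) = L₄
  have e6 : 1 + (1 + a * h) / (1 - a * h) = 2 / (1 - a * h) := by field_simp; ring
  rw [e6]
  field_simp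
  ring

theorem tendsto_zero_of_continuous {f : ℝ → ℝ} (hf : Continuous f) (h0 : f 0 = 0) :
    Tendsto f (𝓝 0) (𝓝 0) := by
  have := hf.tendsto 0
  rwa [h0] at this

/-- Each logarithm in `Regime.growthAn_cbar` is needed up to O(h⁵), because the growth rate is
divided by h² at the end. -/
theorem isBigO_growthAn_cbar {a : ℝ} (h0 : -1 < 2 * a) (h1 : 2 * a < 1) :
    (fun h => growthAn a (cbarFn a h, h) - ((a + 1 / 2) ^ 2 / 2 + (16 * a ^ 4 - 1) / 192 * h ^ 2))
      =O[𝓝[>] 0] fun h => h ^ 3 := by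
  have p1 : (fun h : ℝ => Real.log (1 - a * h)
      - -(a * h + (a * h) ^ 2 / 2 + (a * h) ^ 3 / 3 + (a * h) ^ 4 / 4)) =O[𝓝 0] fun h => h ^ 5 := by
    have t : Tendsto (fun h : ℝ => a * h) (𝓝 0) (𝓝 0) :=
      tendsto_zero_of_continuous (by fun_prop) (by simp)
    refine (isBigO_log_one_sub.comp_tendsto t).trans ?_
    simpa [Function.comp_def, mul_pow, mul_comm] using
      isBigO_pow_mul_of_continuousAt (n := 5) (m := 5) le_rfl (f := fun _ => a ^ 5)
        continuousAt_const
  have p2 : (fun h : ℝ => Real.log (1 - -(a * h))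
      - -(-(a * h) + (-(a * h)) ^ 2 / 2 + (-(a * h)) ^ 3 / 3 + (-(a * h)) ^ 4 / 4))
      =O[𝓝 0] fun h => h ^ 5 := by
    have t : Tendsto (fun h : ℝ => -(a * h)) (𝓝 0) (𝓝 0) :=
      tendsto_zero_of_continuous (by fun_prop) (by simp)
    refine (isBigO_log_one_sub.comp_tendsto t).trans ?_
    refine (isBigO_pow_mul_of_continuousAt (n := 5) (m := 5) le_rfl (f := fun _ => -a ^ 5)
        continuousAt_const).congr_left fun h => ?_
    simp; ring
  have p3 : (fun h : ℝ => Real.log (1 - (a * h) ^ 2) - -((a * h) ^ 2 + (a * h) ^ 4 / 2))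
      =O[𝓝 0] fun h => h ^ 5 := by
    have t : Tendsto (fun h : ℝ => (a * h) ^ 2) (𝓝 0) (𝓝 0) :=
      tendsto_zero_of_continuous (by fun_prop) (by simp)
    have q1 := (isBigO_log_one_sub.comp_tendsto t).trans
      ((isBigO_pow_mul_of_continuousAt (n := 5) (m := 10) (by norm_num) (f := fun _ => a ^ 10)
        continuousAt_const).congr_left (f₂ := (fun x : ℝ => x ^ 5) ∘ fun h : ℝ => (a * h) ^ 2)
        fun h => by simp; ring)
    have q2 := isBigO_pow_mul_of_continuousAt (n := 5) (m := 6) (by norm_num)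
      (f := fun h => -(a ^ 6 / 3 + a ^ 8 * h ^ 2 / 4)) (by fun_prop)
    refine (q1.add q2).congr_left fun h => ?_
    simp; ring
  have p4 : (fun h : ℝ => Real.log (1 - (1 - Real.cosh h) / 2) - (h ^ 2 / 4 - h ^ 4 / 96))
      =O[𝓝 0] fun h => h ^ 5 := by
    have t : Tendsto (fun h : ℝ => (1 - Real.cosh h) / 2) (𝓝 0) (𝓝 0) :=
      tendsto_zero_of_continuous (by fun_prop) (by simp)
    have r0 := isBigO_cosh
    have r1 : (fun h : ℝ => (1 - Real.cosh h) / 2) =O[𝓝 0] fun h => h ^ 2 := by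
      have s1 := (r0.trans ((isBigO_pow_mul_of_continuousAt (n := 2) (m := 5) (by norm_num)
        (f := fun _ => 1) continuousAt_const).congr_left fun h => mul_one _)).const_mul_left (-1 / 2)
      have s2 := isBigO_pow_mul_of_continuousAt (n := 2) (m := 2) le_rfl
        (f := fun h => -1 / 4 - h ^ 2 / 48) (by fun_prop)
      refine (s1.add s2).congr_left fun h => ?_
      ring
    have r2 (k : ℕ) (hk : 3 ≤ k) : (fun h : ℝ => ((1 - Real.cosh h) / 2) ^ k)
        =O[𝓝 0] fun h => h ^ 5 := by
      refine (r1.pow k).trans ?_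
      refine (isBigO_pow_mul_of_continuousAt (n := 5) (m := 2 * k) (by omega)
        (f := fun _ => 1) continuousAt_const).congr_left fun h => ?_
      rw [mul_one, pow_mul]
    have q1 := (isBigO_log_one_sub.comp_tendsto t).trans (r2 5 (by norm_num))
    have q2 : (fun h : ℝ => (Real.cosh h - (1 + h ^ 2 / 2 + h ^ 4 / 24))
        * (1 / 2 - (h ^ 2 / 2 + h ^ 4 / 24) / 4
          - (Real.cosh h - (1 + h ^ 2 / 2 + h ^ 4 / 24)) / 8)) =O[𝓝 0] fun h => h ^ 5 := by
      have : (fun h : ℝ => (1 / 2 - (h ^ 2 / 2 + h ^ 4 / 24) / 4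
          - (Real.cosh h - (1 + h ^ 2 / 2 + h ^ 4 / 24)) / 8)) =O[𝓝 0] fun _ => (1 : ℝ) :=
        ((by fun_prop : Continuous _).tendsto (0 : ℝ)).isBigO_one ℝ
      simpa using r0.mul this
    have q3 := isBigO_pow_mul_of_continuousAt (n := 5) (m := 6) (by norm_num)
      (f := fun h => -(1 / 192 + h ^ 2 / 4608)) (by fun_prop)
    refine ((((q1.add ((r2 3 le_rfl).const_mul_left (-1 / 3))).add
      ((r2 4 (by norm_num)).const_mul_left (-1 / 4))).add q2).add q3).congr_left fun h => ?_
    simp only [Function.comp_apply]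
    ring
  have p5 : (fun h : ℝ => a * h * ((Real.log (1 - -(a * h))
      - -(-(a * h) + (-(a * h)) ^ 2 / 2 + (-(a * h)) ^ 3 / 3 + (-(a * h)) ^ 4 / 4))
      - (Real.log (1 - a * h) - -(a * h + (a * h) ^ 2 / 2 + (a * h) ^ 3 / 3 + (a * h) ^ 4 / 4))) / 2)
      =O[𝓝 0] fun h => h ^ 5 := by
    have : (fun h : ℝ => a * h / 2) =O[𝓝 0] fun _ => (1 : ℝ) :=
      ((by fun_prop : Continuous _).tendsto (0 : ℝ)).isBigO_one ℝ
    refine (this.mul (p2.sub p1)).congr (fun h => ?_) (fun h => ?_)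
    · ring
    · simp
  have key := (((p3.const_mul_left (1 / 2)).add (p4.const_mul_left (1 / 2))).add p5).mono
    (nhdsWithin_le_nhds (s := Ioi 0))
  have key2 := key.mul (isBigO_refl (fun h : ℝ => (h ^ 2)⁻¹) (𝓝[>] 0))
  refine key2.congr' ?_ ?_
  · filter_upwards [eventually_regime h0 h1] with h H
    have hpos := H.h_pos
    have e := H.growthAn_cbar
    have e' : growthAn a (cbarFn a h, h) = (Real.log (1 - (a * h) ^ 2) / 2
      + Real.log (1 - (1 - Real.cosh h) / 2) / 2
      + a * h * (h + (Real.log (1 - -(a * h)) - Real.log (1 - a * h))) / 2) * (h ^ 2)⁻¹ := by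
      rw [← e]; field_simp
    rw [e']
    field_simp
    ring
  · filter_upwards [self_mem_nhdsWithin] with h hpos
    have hpos' : (0 : ℝ) < h := hpos
    field_simp

/-! ### The coefficients of the expansions -/

/-- The coefficient of `λ^(1/3)` of the lower boundary. -/
def lowerSlope (a h : ℝ) : ℝ := -1 / (1 + cbarFn a h) ^ 2 * rootCoef a h

/-- The coefficient of `λ^(1/3)` of the upper boundary. -/
def upperSlope (a h : ℝ) : ℝ :=
  -(1 - etaFn a h * (1 + Real.exp (-h))) / (1 + cbarFn a h) ^ 2 * rootCoef a h

/-- The coefficient of `λ^(1/3)` of the growth rate, divided by `σ ^ 2`. -/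
def growthSlope (a h : ℝ) : ℝ := h * growthSlopeRatio a h * rootCoef a h

section

variable {a : ℝ}

theorem one_add_cbarFn_zero (h0 : -1 < 2 * a) : 1 + cbarFn a 0 = (a + 1 / 2)⁻¹ := by
  have : 1 + 2 * a ≠ 0 := by linarith
  rw [cbarFn_zero, show a + 1 / 2 = (1 + 2 * a) / 2 by ring]
  field_simp
  ring

theorem one_add_cbarFn_zero_ne (h0 : -1 < 2 * a) : 1 + cbarFn a 0 ≠ 0 := by
  rw [one_add_cbarFn_zero h0]
  exact inv_ne_zero (by linarith)

theorem hasDerivAt_one_add_cbarFn_sq (h0 : -1 < 2 * a) :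
    HasDerivAt (fun h => (1 + cbarFn a h) ^ 2) 0 0 :=
  (((hasDerivAt_cbarFn h0).const_add 1).pow 2).congr_deriv (by simp)

theorem analyticAt_lowerSlope (h0 : -1 < 2 * a) (h1 : 2 * a < 1) :
    AnalyticAt ℝ (lowerSlope a) 0 := by
  have e1 := analyticAt_cbarFn h0
  have e2 := analyticAt_rootCoef h0 h1
  unfold lowerSlope
  exact (AnalyticAt.fun_div (by fun_prop)
    (analyticAt_const.add e1 |>.fun_pow 2) (pow_ne_zero 2 (one_add_cbarFn_zero_ne h0))).fun_mul e2

theorem analyticAt_upperSlope (h0 : -1 < 2 * a) (h1 : 2 * a < 1) :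
    AnalyticAt ℝ (upperSlope a) 0 := by
  have e1 := analyticAt_cbarFn h0
  have e2 := analyticAt_rootCoef h0 h1
  have e3 := analyticAt_etaFn a
  unfold upperSlope
  exact (AnalyticAt.fun_div (by fun_prop)
    (analyticAt_const.add e1 |>.fun_pow 2) (pow_ne_zero 2 (one_add_cbarFn_zero_ne h0))).fun_mul e2

theorem analyticAt_growthSlope (h0 : -1 < 2 * a) (h1 : 2 * a < 1) :
    AnalyticAt ℝ (growthSlope a) 0 := by
  have e1 := analyticAt_growthSlopeRatio h1
  have e2 := analyticAt_rootCoef h0 h1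
  unfold growthSlope
  fun_prop

theorem lowerSlope_zero (h0 : -1 < 2 * a) :
    lowerSlope a 0 = -((a + 1 / 2) ^ 2 * rootCoef a 0) := by
  rw [lowerSlope, one_add_cbarFn_zero h0, inv_pow, div_inv_eq_mul]; ring

theorem upperSlope_zero (h0 : -1 < 2 * a) :
    upperSlope a 0 = (a + 1 / 2) ^ 2 * rootCoef a 0 := by
  rw [upperSlope, one_add_cbarFn_zero h0, inv_pow, div_inv_eq_mul, etaFn_zero]; norm_num

theorem growthSlope_zero : growthSlope a 0 = 0 := by simp [growthSlope]

theorem hasDerivAt_lowerSlope (h0 : -1 < 2 * a) (h1 : 2 * a < 1) :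
    HasDerivAt (lowerSlope a) ((a + 1 / 2) ^ 2 * rootCoef a 0 * (2 * a - 1 / 2)) 0 := by
  have e := ((hasDerivAt_const (0 : ℝ) (-1 : ℝ)).div (hasDerivAt_one_add_cbarFn_sq h0)
    (pow_ne_zero 2 (one_add_cbarFn_zero_ne h0))).mul (hasDerivAt_rootCoef h0 h1)
  refine e.congr_deriv ?_
  simp only [Pi.div_apply, one_add_cbarFn_zero h0, inv_pow, div_inv_eq_mul]
  ring

theorem hasDerivAt_upperSlope (h0 : -1 < 2 * a) (h1 : 2 * a < 1) :
    HasDerivAt (upperSlope a) ((a + 1 / 2) ^ 2 * rootCoef a 0 / 2) 0 := by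
  have e := (((((hasDerivAt_etaFn a).mul (hasDerivAt_exp_neg_zero.const_add 1)).const_sub 1).neg).div
    (hasDerivAt_one_add_cbarFn_sq h0)
    (pow_ne_zero 2 (one_add_cbarFn_zero_ne h0))).mul (hasDerivAt_rootCoef h0 h1)
  refine e.congr_deriv ?_
  have : 1 + 2 * a ≠ 0 := by linarith
  simp only [Pi.div_apply, Pi.neg_apply, Pi.mul_apply, one_add_cbarFn_zero h0, etaFn_zero, neg_zero,
    Real.exp_zero, show a + 1 / 2 = (1 + 2 * a) / 2 by ring]
  field_simp
  ring

theorem hasDerivAt_growthSlope (h0 : -1 < 2 * a) (h1 : 2 * a < 1) :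
    HasDerivAt (growthSlope a) (-((1 + 2 * a) ^ 3 * (1 - 2 * a) / 32 * rootCoef a 0)) 0 := by
  refine ((hasDerivAt_mul_growthSlopeRatio h1).mul (hasDerivAt_rootCoef h0 h1)).congr_deriv ?_
  simp

theorem rootCoef_zero_cube (h0 : -1 < 2 * a) (h1 : 2 * a < 1) :
    rootCoef a 0 ^ 3 = 3 * (1 / 2 - a) ^ 2 / (4 * (a + 1 / 2) ^ 4) := by
  have h2 : 1 + 2 * a ≠ 0 := by linarith
  have h3 : 1 - 2 * a ≠ 0 := by linarith
  rw [rootCoef_cube (thirdCoef_zero_pos h0 h1), thirdCoef_zero h0 h1,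
    show a + 1 / 2 = (1 + 2 * a) / 2 by ring]
  field_simp
  ring

end

theorem rpow_third_eq {x y : ℝ} (hy : 0 ≤ y) (h : y ^ 3 = x) : x ^ (1 / 3 : ℝ) = y := by
  rw [← h, ← Real.rpow_natCast, ← Real.rpow_mul hy]; norm_num

/-! ### Passing to the time step -/

section

variable {σ : ℝ} {f : ℝ → ℝ}

theorem tendsto_mul_sqrt (hσ : 0 < σ) :
    Tendsto (fun δ : ℝ => σ * √δ) (𝓝[>] 0) (𝓝[>] 0) := by
  refine tendsto_nhdsWithin_iff.2 ⟨?_, ?_⟩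
  · have : Tendsto (fun δ : ℝ => σ * √δ) (𝓝 0) (𝓝 (σ * √0)) :=
      (by fun_prop : Continuous fun δ : ℝ => σ * √δ).tendsto 0
    rw [Real.sqrt_zero, mul_zero] at this
    exact this.mono_left nhdsWithin_le_nhds
  · filter_upwards [self_mem_nhdsWithin] with δ hδ
    have : (0 : ℝ) < δ := hδ
    exact mem_Ioi.2 (by positivity)

theorem isBigO_sq_comp_sqrt (hσ : 0 < σ) (hf : f =O[𝓝[>] 0] fun h => h ^ 2) :
    (fun δ => f (σ * √δ)) =O[𝓝[>] 0] fun δ : ℝ => δ := by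
  refine (hf.comp_tendsto (tendsto_mul_sqrt hσ)).trans ?_
  refine (((isBigO_refl (fun δ : ℝ => δ) _).const_mul_left (σ ^ 2))).congr' ?_ EventuallyEq.rfl
  filter_upwards [self_mem_nhdsWithin] with δ hδ
  have : (0 : ℝ) < δ := hδ
  simp [mul_pow, Real.sq_sqrt this.le]

theorem isBigO_cube_comp_sqrt (hσ : 0 < σ) (hf : f =O[𝓝[>] 0] fun h => h ^ 3) :
    (fun δ => f (σ * √δ)) =O[𝓝[>] 0] fun δ : ℝ => δ ^ (3 / 2 : ℝ) := by
  refine (hf.comp_tendsto (tendsto_mul_sqrt hσ)).trans ?_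
  refine (((isBigO_refl (fun δ : ℝ => δ ^ (3 / 2 : ℝ)) _).const_mul_left (σ ^ 3))).congr' ?_
    EventuallyEq.rfl
  filter_upwards [self_mem_nhdsWithin] with δ hδ
  have : (0 : ℝ) < δ := hδ
  simp only [Function.comp_apply, mul_pow]
  rw [Real.sqrt_eq_rpow, ← Real.rpow_natCast (δ ^ (1 / 2 : ℝ)), ← Real.rpow_mul this.le]
  norm_num

end

section

variable {σ θ : ℝ}

/-- The cube roots in the statement are identified by comparing cubes, with θ = a + 1/2 in
`rootCoef_zero_cube`. -/
theorem sq_mul_rootCoef (h0 : 0 < θ) (h1 : θ < 1) :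
    (3 * θ ^ 2 * (1 - θ) ^ 2 / 4) ^ (1 / 3 : ℝ) = θ ^ 2 * rootCoef (θ - 1 / 2) 0 := by
  have := rootCoef_pos (θ - 1 / 2) 0
  refine rpow_third_eq (by positivity) ?_
  rw [mul_pow, rootCoef_zero_cube (by linarith) (by linarith)]
  rw [sub_add_cancel]
  field_simp
  ring

theorem half_sq_mul_rootCoef (h0 : 0 < θ) (h1 : θ < 1) :
    (3 * θ ^ 2 * (1 - θ) ^ 2 / 32) ^ (1 / 3 : ℝ) = θ ^ 2 * rootCoef (θ - 1 / 2) 0 / 2 := by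
  have := rootCoef_pos (θ - 1 / 2) 0
  refine rpow_third_eq (by positivity) ?_
  rw [div_pow, mul_pow, rootCoef_zero_cube (by linarith) (by linarith)]
  rw [sub_add_cancel]
  field_simp
  ring

theorem two_sq_mul_rootCoef (h0 : 0 < θ) (h1 : θ < 1) :
    (6 * θ ^ 2 * (1 - θ) ^ 2) ^ (1 / 3 : ℝ) = 2 * (θ ^ 2 * rootCoef (θ - 1 / 2) 0) := by
  have := rootCoef_pos (θ - 1 / 2) 0
  refine rpow_third_eq (by positivity) ?_
  rw [mul_pow, mul_pow, rootCoef_zero_cube (by linarith) (by linarith)]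
  rw [sub_add_cancel]
  field_simp
  ring

theorem growth_const_eq (h0 : 0 < θ) (h1 : θ < 1) :
    (3 / 32 : ℝ) ^ (1 / 3 : ℝ) * (θ * (1 - θ)) ^ (5 / 3 : ℝ)
      = θ ^ 3 * (1 - θ) * rootCoef (θ - 1 / 2) 0 / 2 := by
  have h2 : 0 < 1 - θ := sub_pos.2 h1
  have := rootCoef_pos (θ - 1 / 2) 0
  have e : (θ * (1 - θ)) ^ (5 / 3 : ℝ) = ((θ * (1 - θ)) ^ 5) ^ (1 / 3 : ℝ) := by
    rw [← Real.rpow_natCast, ← Real.rpow_mul (by positivity)]; norm_num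
  rw [e, ← Real.mul_rpow (by norm_num) (by positivity)]
  refine rpow_third_eq (by positivity) ?_
  rw [div_pow, mul_pow, mul_pow, rootCoef_zero_cube (by linarith) (by linarith)]
  rw [sub_add_cancel]
  field_simp
  ring

theorem isBigO_lowerCoef_sqrt (hσ : 0 < σ) (h0 : 0 < θ) (h1 : θ < 1) :
    (fun δ => 1 / (1 + cbarFn (θ - 1 / 2) (σ * √δ)) - (θ + σ ^ 2 / 24 * (2 * θ - 1) * δ))
      =O[𝓝[>] 0] fun δ : ℝ => δ ^ (3 / 2 : ℝ) := by
  refine (isBigO_cube_comp_sqrt hσ (isBigO_lowerCoef (a := θ - 1 / 2) (by linarith)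
    (by linarith))).congr' ?_ EventuallyEq.rfl
  filter_upwards [self_mem_nhdsWithin] with δ hδ
  have : (0 : ℝ) < δ := hδ
  rw [mul_pow, Real.sq_sqrt this.le]; ring

theorem isBigO_lowerSlope_sqrt (hσ : 0 < σ) (h0 : 0 < θ) (h1 : θ < 1) :
    (fun δ => lowerSlope (θ - 1 / 2) (σ * √δ) - (-(3 * θ ^ 2 * (1 - θ) ^ 2 / 4) ^ (1 / 3 : ℝ)
          + (3 * θ ^ 2 * (1 - θ) ^ 2 / 32) ^ (1 / 3 : ℝ) * (4 * θ - 3) * σ * √δ))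
      =O[𝓝[>] 0] fun δ : ℝ => δ := by
  have e0 : -1 < 2 * (θ - 1 / 2) := by linarith
  have e1 : 2 * (θ - 1 / 2) < 1 := by linarith
  refine (isBigO_sq_comp_sqrt hσ ((isBigO_sub_of_hasDerivAt (analyticAt_lowerSlope e0 e1)
    (hasDerivAt_lowerSlope e0 e1)).mono nhdsWithin_le_nhds)).congr_left fun δ => ?_
  rw [lowerSlope_zero e0, sq_mul_rootCoef h0 h1, half_sq_mul_rootCoef h0 h1, sub_add_cancel]
  ring

theorem isBigO_upperSlope_sqrt (hσ : 0 < σ) (h0 : 0 < θ) (h1 : θ < 1) :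
    (fun δ => upperSlope (θ - 1 / 2) (σ * √δ) - ((3 * θ ^ 2 * (1 - θ) ^ 2 / 4) ^ (1 / 3 : ℝ)
          + (3 * θ ^ 2 * (1 - θ) ^ 2 / 32) ^ (1 / 3 : ℝ) * σ * √δ))
      =O[𝓝[>] 0] fun δ : ℝ => δ := by
  have e0 : -1 < 2 * (θ - 1 / 2) := by linarith
  have e1 : 2 * (θ - 1 / 2) < 1 := by linarith
  refine (isBigO_sq_comp_sqrt hσ ((isBigO_sub_of_hasDerivAt (analyticAt_upperSlope e0 e1)
    (hasDerivAt_upperSlope e0 e1)).mono nhdsWithin_le_nhds)).congr_left fun δ => ?_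
  rw [upperSlope_zero e0, sq_mul_rootCoef h0 h1, half_sq_mul_rootCoef h0 h1, sub_add_cancel]
  ring

theorem isBigO_width_sqrt (hσ : 0 < σ) (h0 : 0 < θ) (h1 : θ < 1) :
    (fun δ => (upperSlope (θ - 1 / 2) (σ * √δ) - lowerSlope (θ - 1 / 2) (σ * √δ))
        / (6 * θ ^ 2 * (1 - θ) ^ 2) ^ (1 / 3 : ℝ) - (1 + (1 - θ) * σ * √δ))
      =O[𝓝[>] 0] fun δ : ℝ => δ := by
  have hr := rootCoef_pos (θ - 1 / 2) 0
  refine (((isBigO_upperSlope_sqrt hσ h0 h1).sub (isBigO_lowerSlope_sqrt hσ h0 h1)).const_mul_left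
    (2 * (θ ^ 2 * rootCoef (θ - 1 / 2) 0))⁻¹).congr_left fun δ => ?_
  rw [sq_mul_rootCoef h0 h1, half_sq_mul_rootCoef h0 h1, two_sq_mul_rootCoef h0 h1]
  generalize rootCoef (θ - 1 / 2) 0 = r at *
  field_simp
  ring

theorem isBigO_growthCoef_sqrt {μ : ℝ} (hσ : 0 < σ) (h0 : 0 < θ) (h1 : θ < 1)
    (hμ : θ = μ / σ ^ 2) :
    (fun δ => σ ^ 2 * growthAn (θ - 1 / 2) (cbarFn (θ - 1 / 2) (σ * √δ), σ * √δ)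
        - (μ ^ 2 / (2 * σ ^ 2) + σ ^ 4 / 24 * (θ * (θ - 1) * (2 * θ ^ 2 - 2 * θ + 1)) * δ))
      =O[𝓝[>] 0] fun δ : ℝ => δ ^ (3 / 2 : ℝ) := by
  have hμ' : μ = θ * σ ^ 2 := by rw [hμ]; field_simp
  refine ((isBigO_cube_comp_sqrt hσ (isBigO_growthAn_cbar (a := θ - 1 / 2) (by linarith)
    (by linarith))).const_mul_left (σ ^ 2)).congr' ?_ EventuallyEq.rfl
  filter_upwards [self_mem_nhdsWithin] with δ hδ
  have : (0 : ℝ) < δ := hδ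
  rw [mul_pow, Real.sq_sqrt this.le, hμ']
  field_simp
  ring

theorem isBigO_growthSlope_sqrt (hσ : 0 < σ) (h0 : 0 < θ) (h1 : θ < 1) :
    (fun δ => σ ^ 2 * growthSlope (θ - 1 / 2) (σ * √δ)
        - (-((3 / 32 : ℝ) ^ (1 / 3 : ℝ) * σ ^ 3 * (θ * (1 - θ)) ^ (5 / 3 : ℝ)) * √δ))
      =O[𝓝[>] 0] fun δ : ℝ => δ := by
  have e0 : -1 < 2 * (θ - 1 / 2) := by linarith
  have e1 : 2 * (θ - 1 / 2) < 1 := by linarith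
  refine ((isBigO_sq_comp_sqrt hσ ((isBigO_sub_of_hasDerivAt (analyticAt_growthSlope e0 e1)
    (hasDerivAt_growthSlope e0 e1)).mono nhdsWithin_le_nhds)).const_mul_left
    (σ ^ 2)).congr_left fun δ => ?_
  rw [growthSlope_zero, mul_right_comm ((3 / 32 : ℝ) ^ (1 / 3 : ℝ)), growth_const_eq h0 h1]
  ring

end

/-! ### Estimates for small x = c - c̄ and h, uniform in both -/

/-- The filter of pairs `(x, h)` of small positive numbers, where `x = c - c̄`. -/
def corner : Filter (ℝ × ℝ) := 𝓝[>] 0 ×ˢ 𝓝[>] 0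

theorem eventually_corner_iff {P : ℝ × ℝ → Prop} : (∀ᶠ q in corner, P q) ↔
    ∃ ρ > 0, ∀ x ∈ Ioo (0 : ℝ) ρ, ∀ h ∈ Ioo (0 : ℝ) ρ, P (x, h) := by
  have hb := (nhdsGT_basis (0 : ℝ)).prod_self
  rw [corner, hb.eventually_iff]
  constructor
  · rintro ⟨ρ, hρ, h⟩
    exact ⟨ρ, hρ, fun x hx y hy => h ⟨hx, hy⟩⟩
  · rintro ⟨ρ, hρ, h⟩
    exact ⟨ρ, hρ, fun q hq => h q.1 hq.1 q.2 hq.2⟩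

theorem eventually_corner_of_snd {P : ℝ → Prop} (h : ∀ᶠ t in 𝓝[>] (0 : ℝ), P t) :
    ∀ᶠ q in corner, P q.2 := tendsto_snd.eventually h

theorem eventually_corner_of_fst {P : ℝ → Prop} (h : ∀ᶠ t in 𝓝[>] (0 : ℝ), P t) :
    ∀ᶠ q in corner, P q.1 := tendsto_fst.eventually h

theorem eventually_fst_pos : ∀ᶠ q in corner, 0 < q.1 :=
  eventually_corner_of_fst self_mem_nhdsWithin

theorem eventually_fst_lt {r : ℝ} (hr : 0 < r) : ∀ᶠ q in corner, q.1 < r :=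
  eventually_corner_of_fst (nhdsWithin_le_nhds (Iio_mem_nhds hr))

section

variable {a : ℝ}

theorem tendsto_corner_cbar (h0 : -1 < 2 * a) :
    Tendsto (fun q : ℝ × ℝ => (cbarFn a q.2, q.2)) corner (𝓝 (cbarFn a 0, 0)) := by
  have e : Tendsto (fun q : ℝ × ℝ => q.2) corner (𝓝 0) :=
    tendsto_snd.mono_right nhdsWithin_le_nhds
  exact ((analyticAt_cbarFn h0).continuousAt.tendsto.comp e).prodMk_nhds e

theorem tendsto_corner_shift (h0 : -1 < 2 * a) :
    Tendsto (fun q : ℝ × ℝ => (cbarFn a q.2 + q.1, q.2)) corner (𝓝 (cbarFn a 0, 0)) := by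
  have e : Tendsto (fun q : ℝ × ℝ => q.2) corner (𝓝 0) :=
    tendsto_snd.mono_right nhdsWithin_le_nhds
  have e' : Tendsto (fun q : ℝ × ℝ => q.1) corner (𝓝 0) :=
    tendsto_fst.mono_right nhdsWithin_le_nhds
  have := ((analyticAt_cbarFn h0).continuousAt.tendsto.comp e).add e'
  rw [add_zero] at this
  exact this.prodMk_nhds e

theorem eventually_corner_regime (h0 : -1 < 2 * a) (h1 : 2 * a < 1) :
    ∀ᶠ q in corner, Regime a q.2 ((1 + a * q.2) / 2) (Real.exp (-q.2)) :=
  eventually_corner_of_snd (eventually_regime h0 h1)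

theorem eventually_corner_dom (h0 : -1 < 2 * a) (h1 : 2 * a < 1) :
    ∀ᶠ q in corner, Dom ((1 + a * q.2) / 2) (Real.exp (-q.2)) (cbarFn a q.2 + q.1) := by
  have e1 := (analyticAt_alphaFn a).comp_snd (cbarFn a 0)
  have e2 := (analyticAt_slopeFn a).comp_snd (cbarFn a 0)
  have e3 := (analyticAt_interceptFn a).comp_snd (cbarFn a 0)
  have hc := cbarFn_zero_pos h0 h1
  have f1 : AnalyticAt ℝ (fun q : ℝ × ℝ => alphaFn a q.2 * q.1 + Real.exp (-q.2) * slopeFn a q.2)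
      (cbarFn a 0, 0) := by fun_prop
  have f2 : AnalyticAt ℝ (fun q : ℝ × ℝ => interceptFn a q.2 - slopeFn a q.2 * q.1)
      (cbarFn a 0, 0) := by fun_prop
  have h2 : 1 + 2 * a ≠ 0 := by linarith
  have g1 := f1.continuousAt.eventually (lt_mem_nhds (a := 0) (by
    simp only [alphaFn_zero, slopeFn_zero, cbarFn_zero, neg_zero, Real.exp_zero]
    rw [show (1 + 2 * a) * ((1 - 2 * a) / (1 + 2 * a)) + 1 * (2 * a) = 1 by field_simp; ring]
    exact one_pos))
  have g2 := f2.continuousAt.eventually (lt_mem_nhds (a := 0) (by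
    simp only [interceptFn_zero, slopeFn_zero]
    rw [show 1 - 2 * a - 2 * a * cbarFn a 0 = cbarFn a 0 by rw [cbarFn_zero]; field_simp; ring]
    exact hc))
  have g3 := (continuous_fst (X := ℝ) (Y := ℝ)).continuousAt.eventually
    (lt_mem_nhds (a := 0) (b := ((cbarFn a 0, 0) : ℝ × ℝ).1) hc)
  have t := tendsto_corner_shift h0
  filter_upwards [t.eventually g1, t.eventually g2, t.eventually g3,
    eventually_corner_regime h0 h1] with q q1 q2 q3 H
  refine ⟨q3, ?_, ?_⟩
  · rw [H.numFactor_eq]; exact q1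
  · rw [H.denFactor_eq]; exact q2

theorem exists_bound_cbar {f : ℝ × ℝ → ℝ} (h0 : -1 < 2 * a)
    (hf : AnalyticAt ℝ f (cbarFn a 0, 0)) :
    ∃ G > 0, ∀ᶠ q in corner, |f (cbarFn a q.2, q.2)| ≤ G := by
  have e := (hf.continuousAt.tendsto.comp (tendsto_corner_cbar h0)).abs
  refine ⟨|f (cbarFn a 0, 0)| + 1, by positivity, ?_⟩
  filter_upwards [e.eventually (gt_mem_nhds (lt_add_one _))] with q hq using hq.le

theorem eventually_corner_near (h0 : -1 < 2 * a) {ρ : ℝ} (hρ : 0 < ρ) :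
    ∀ᶠ q in corner, |q.2| < ρ ∧ |cbarFn a q.2 - cbarFn a 0| < ρ
      ∧ |cbarFn a q.2 + q.1 - cbarFn a 0| < ρ := by
  have e1 := (tendsto_corner_cbar h0).eventually (Metric.ball_mem_nhds _ hρ)
  have e2 := (tendsto_corner_shift h0).eventually (Metric.ball_mem_nhds _ hρ)
  filter_upwards [e1, e2] with q q1 q2
  simp only [Prod.dist_eq, Real.dist_eq, max_lt_iff, sub_zero] at q1 q2
  exact ⟨q1.2, q1.1, q2.1⟩

theorem exists_corner_taylor_one {f : ℝ × ℝ → ℝ} (h0 : -1 < 2 * a)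
    (hf : AnalyticAt ℝ f (cbarFn a 0, 0)) :
    ∃ M > 0, ∀ᶠ q in corner, |f (cbarFn a q.2 + q.1, q.2) - f (cbarFn a q.2, q.2)
      - partialFst f (cbarFn a q.2, q.2) * q.1| ≤ M * q.1 ^ 2 := by
  obtain ⟨ρ, hρ, M, hM, h⟩ := exists_taylor_one hf
  refine ⟨M, hM, ?_⟩
  filter_upwards [eventually_corner_near h0 hρ] with q hq
  simpa using h q.2 _ _ hq.1 hq.2.1 hq.2.2

theorem exists_corner_taylor_three {f : ℝ × ℝ → ℝ} (h0 : -1 < 2 * a)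
    (hf : AnalyticAt ℝ f (cbarFn a 0, 0)) :
    ∃ M > 0, ∀ᶠ q in corner, |f (cbarFn a q.2 + q.1, q.2) - f (cbarFn a q.2, q.2)
      - partialFst f (cbarFn a q.2, q.2) * q.1
      - partialFst (partialFst f) (cbarFn a q.2, q.2) / 2 * q.1 ^ 2
      - partialFst (partialFst (partialFst f)) (cbarFn a q.2, q.2) / 6 * q.1 ^ 3|
      ≤ M * q.1 ^ 4 := by
  obtain ⟨ρ, hρ, M, hM, h⟩ := exists_taylor_three hf
  refine ⟨M, hM, ?_⟩
  filter_upwards [eventually_corner_near h0 hρ, eventually_fst_pos] with q hq hx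
  simpa [abs_of_pos hx] using h q.2 _ _ hq.1 hq.2.1 hq.2.2

theorem Regime.truncCostFn_eq {h p d : ℝ} (H : Regime a h p d) (c : ℝ) :
    truncCostFn p d c = costFn p d c + slopeOne a h * (c - cbarFn a h)
      + (slopeTwo a h + slopeOne a h ^ 2) / 2 * (c - cbarFn a h) ^ 2 := by
  rw [truncCostFn, H.cBar_eq, H.deriv_costFn_cbar, H.iteratedDeriv_two_costFn_cbar]
  ring

theorem Regime.truncCostFn_cbar {h p d : ℝ} (H : Regime a h p d) :
    truncCostFn p d (cbarFn a h) = 0 := by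
  rw [H.truncCostFn_eq, H.costFn_cbar]; ring

theorem Regime.continuousAt_truncCostFn {h p d c : ℝ} (H : Regime a h p d) (hc : Dom p d c) :
    ContinuousAt (truncCostFn p d) c := by
  have e := (H.hasDerivAt_costFn hc).continuousAt
  rw [show truncCostFn p d = _ from funext H.truncCostFn_eq]
  fun_prop

/-- The truncated cost function is `t x ^ 3 / 6` up to fourth order. -/
theorem exists_truncCostFn_bound (h0 : -1 < 2 * a) (h1 : 2 * a < 1) :
    ∃ M > 0, ∀ᶠ q in corner,
      |truncCostFn ((1 + a * q.2) / 2) (Real.exp (-q.2)) (cbarFn a q.2 + q.1)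
        - thirdCoef a q.2 / 6 * q.1 ^ 3| ≤ M * q.1 ^ 4 := by
  have hF := analyticAt_costAn h0 h1
  obtain ⟨M, hM, h⟩ := exists_corner_taylor_three h0 hF
  refine ⟨M, hM, ?_⟩
  filter_upwards [h, eventually_corner_regime h0 h1, eventually_corner_dom h0 h1,
    (tendsto_corner_cbar h0).eventually hF.eventually_analyticAt] with q hq H hD hF'
  rw [H.costAn_eq hD, H.costAn_eq H.dom_cbar, H.costFn_cbar, H.partialFst_costAn_cbar hF',
    H.partialFst_two_costAn_cbar hF', H.partialFst_three_costAn_cbar hF'] at hq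
  rw [H.truncCostFn_eq]
  refine le_trans (le_of_eq ?_) hq
  congr 1
  ring

theorem exists_corner_bigO {f : ℝ → ℝ} (hf : AnalyticAt ℝ f 0) (hz : f 0 = 0) :
    ∃ M > 0, ∀ᶠ q in corner, |f q.2| ≤ M * q.2 := by
  obtain ⟨M, hM, h⟩ := (isBigO_id_of_zero hf hz).exists_pos
  refine ⟨M, hM, ?_⟩
  filter_upwards [eventually_corner_of_snd (h.bound.filter_mono nhdsWithin_le_nhds),
    eventually_corner_of_snd self_mem_nhdsWithin] with q hq hpos
  rwa [Real.norm_eq_abs, Real.norm_eq_abs, abs_of_pos (show 0 < q.2 from hpos)] at hq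

/-- The omitted linear and quadratic terms have coefficients that vanish at h = 0, hence are O(h);
x² ≤ x absorbs the quadratic one. -/
theorem exists_costFn_sub_truncCostFn_bound (h0 : -1 < 2 * a) (h1 : 2 * a < 1) :
    ∃ M > 0, ∀ᶠ q in corner,
      |costFn ((1 + a * q.2) / 2) (Real.exp (-q.2)) (cbarFn a q.2 + q.1)
        - truncCostFn ((1 + a * q.2) / 2) (Real.exp (-q.2)) (cbarFn a q.2 + q.1)|
        ≤ M * q.2 * q.1 := by
  have e1 := analyticAt_slopeOne h0 h1
  have e2 := analyticAt_slopeTwo h0 h1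
  obtain ⟨M₁, hM₁, b₁⟩ := exists_corner_bigO e1 (slopeOne_zero h0 h1)
  obtain ⟨M₂, hM₂, b₂⟩ := exists_corner_bigO
    (f := fun h => (slopeTwo a h + slopeOne a h ^ 2) / 2) (by fun_prop)
    (by simp [slopeOne_zero h0 h1, slopeTwo_zero h0 h1])
  refine ⟨M₁ + M₂, by positivity, ?_⟩
  filter_upwards [b₁, b₂, eventually_corner_regime h0 h1, eventually_fst_pos,
    eventually_fst_lt one_pos] with q q1 q2 H hx hx1
  rw [H.truncCostFn_eq, add_sub_cancel_left]
  have e : costFn ((1 + a * q.2) / 2) (Real.exp (-q.2)) (cbarFn a q.2 + q.1)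
      - (costFn ((1 + a * q.2) / 2) (Real.exp (-q.2)) (cbarFn a q.2 + q.1) + slopeOne a q.2 * q.1
        + (slopeTwo a q.2 + slopeOne a q.2 ^ 2) / 2 * q.1 ^ 2)
      = -(slopeOne a q.2 * q.1 + (slopeTwo a q.2 + slopeOne a q.2 ^ 2) / 2 * q.1 ^ 2) := by ring
  rw [e, abs_neg]
  refine (abs_add_le _ _).trans ?_
  rw [abs_mul, abs_mul, abs_of_pos hx, abs_of_pos (pow_pos hx 2)]
  have hh := H.h_pos
  have f1 : |slopeOne a q.2| * q.1 ≤ M₁ * q.2 * q.1 := by gcongr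
  have f2 : |(slopeTwo a q.2 + slopeOne a q.2 ^ 2) / 2| * q.1 ^ 2 ≤ M₂ * q.2 * q.1 := by
    have : q.1 ^ 2 ≤ q.1 := by nlinarith
    gcongr
  linarith

theorem eventually_thirdCoef (h0 : -1 < 2 * a) (h1 : 2 * a < 1) :
    ∀ᶠ q in corner, thirdCoef a 0 / 2 < thirdCoef a q.2 ∧ thirdCoef a q.2 < 2 * thirdCoef a 0 := by
  have ht := thirdCoef_zero_pos h0 h1
  have e := (analyticAt_thirdCoef h0 h1).continuousAt
  have e1 := e.eventually (lt_mem_nhds (half_lt_self ht))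
  have e2 := e.eventually (gt_mem_nhds (show thirdCoef a 0 < 2 * thirdCoef a 0 by linarith))
  exact eventually_corner_of_snd ((e1.and e2).filter_mono nhdsWithin_le_nhds)

theorem eventually_rootCoef (h0 : -1 < 2 * a) (h1 : 2 * a < 1) :
    ∀ᶠ q in corner, rootCoef a 0 / 2 < rootCoef a q.2 ∧ rootCoef a q.2 < 2 * rootCoef a 0 := by
  have ht := rootCoef_pos a 0
  have e := (analyticAt_rootCoef h0 h1).continuousAt
  have e1 := e.eventually (lt_mem_nhds (half_lt_self ht))
  have e2 := e.eventually (gt_mem_nhds (show rootCoef a 0 < 2 * rootCoef a 0 by linarith))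
  exact eventually_corner_of_snd ((e1.and e2).filter_mono nhdsWithin_le_nhds)

/-- The derivative of the truncated cost function is positive to the right of `c̄`. -/
theorem eventually_hasDerivAt_truncCostFn (h0 : -1 < 2 * a) (h1 : 2 * a < 1) :
    ∀ᶠ q in corner, ∃ D > 0,
      HasDerivAt (truncCostFn ((1 + a * q.2) / 2) (Real.exp (-q.2))) D (cbarFn a q.2 + q.1) := by
  have hF := analyticAt_costAn h0 h1
  have hF1 := AnalyticAt.partialFst hF
  obtain ⟨M, hM, h⟩ := exists_corner_taylor_three h0 hF1
  obtain ⟨G, hG, hg⟩ := exists_bound_cbar h0 (AnalyticAt.partialFst (AnalyticAt.partialFst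
    (AnalyticAt.partialFst hF1)))
  have ht := thirdCoef_zero_pos h0 h1
  -- The derivative is t x²/2 plus terms of size at most (G + M)x³. As t > t(0)/2, the main term
  -- exceeds them for x below this threshold.
  have hr : 0 < thirdCoef a 0 / (4 * (M + G)) := by positivity
  filter_upwards [h, hg, eventually_corner_regime h0 h1, eventually_corner_dom h0 h1,
    (tendsto_corner_cbar h0).eventually hF.eventually_analyticAt,
    (tendsto_corner_shift h0).eventually hF.eventually_analyticAt,
    eventually_fst_pos, eventually_fst_lt one_pos, eventually_fst_lt hr,
    eventually_thirdCoef h0 h1] with q hq hg H hD hF' hF'' hx hx1 hx2 ht'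
  have e1 := H.hasDerivAt_costFn hD
  rw [← H.partialFst_costAn hD hF''] at e1
  rw [H.partialFst_costAn_cbar hF', H.partialFst_two_costAn_cbar hF',
    H.partialFst_three_costAn_cbar hF'] at hq
  have e2 := (hasDerivAt_id (cbarFn a q.2 + q.1)).sub_const (cbarFn a q.2)
  have e3 := (e1.add (e2.const_mul (slopeOne a q.2))).add
    ((e2.pow 2).const_mul ((slopeTwo a q.2 + slopeOne a q.2 ^ 2) / 2))
  rw [show truncCostFn _ _ = _ from funext H.truncCostFn_eq]
  refine ⟨_, ?_, e3⟩
  have f1 := (abs_le.1 hq).1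
  have f2 := (abs_le.1 hg).1
  simp only [id, add_sub_cancel_left]
  have f3 : q.1 * (4 * (M + G)) < thirdCoef a 0 := by
    rwa [lt_div_iff₀ (by positivity)] at hx2
  have f4 : 0 < q.1 ^ 2 := by positivity
  have f5 : q.1 ^ 2 * (q.1 * (4 * (M + G))) < q.1 ^ 2 * thirdCoef a 0 := by gcongr
  have f6 : q.1 ^ 2 * (thirdCoef a 0 / 2) < q.1 ^ 2 * thirdCoef a q.2 := by
    have := ht'.1
    gcongr
  have f7 : q.1 ^ 3 * -G ≤ q.1 ^ 3 *
      partialFst (partialFst (partialFst (partialFst (costAn a)))) (cbarFn a q.2, q.2) := by gcongr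
  have f8 : M * q.1 ^ 4 ≤ M * q.1 ^ 3 := by
    have : q.1 ^ 4 ≤ q.1 ^ 3 := pow_le_pow_of_le_one hx.le hx1.le (by norm_num)
    gcongr
  have f9 : 0 < G * q.1 ^ 3 := by positivity
  norm_num
  nlinarith

end

/-! ### From the cubic equation to the expansions in λ^(1/3) -/

/-- Approximate solutions of `t x ^ 3 / 6 = y ^ 3`. -/
theorem abs_sub_mul_le_of_cube {t t₀ X X₀ x y M K : ℝ} (ht₀ : 0 < t₀) (ht : t₀ ≤ t)
    (hX : X ^ 3 = 6 / t) (hX₀ : 0 < X₀) (hXX : X₀ ≤ X) (hx : 0 < x) (hy : 0 < y) (hM : 0 < M)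
    (hx1 : M * x ≤ t₀ / 12) (hx2 : M * x ≤ 1 / 2) (hK : 0 < K) (hK3 : 18 / t₀ ≤ K ^ 3)
    (hE : |y ^ 3 - t / 6 * x ^ 3| ≤ M * x * (x ^ 3 + y ^ 3)) :
    |x - X * y| ≤ 6 / t₀ * M * K * (K ^ 3 + 1) / X₀ ^ 2 * y ^ 2 := by
  have hx3 : 0 < x ^ 3 := by positivity
  have hy3 : 0 < y ^ 3 := by positivity
  -- A crude bound first: since Mx is small, the error is absorbed into x³ and y³, which gives t₀ x³
  -- ≤ 18 y³. This then turns the error term into a multiple of y⁴.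
  have hxK : x ≤ K * y := by
    have f1 := (abs_le.1 hE).1
    have f2 : M * x * x ^ 3 ≤ t₀ / 12 * x ^ 3 := by gcongr
    have f3 : M * x * y ^ 3 ≤ 1 / 2 * y ^ 3 := by gcongr
    have f4 : t₀ / 6 * x ^ 3 ≤ t / 6 * x ^ 3 := by gcongr
    have f5 : t₀ * x ^ 3 ≤ 18 * y ^ 3 := by linarith
    have f6 : x ^ 3 ≤ (K * y) ^ 3 := by
      rw [mul_pow]
      calc x ^ 3 ≤ 18 / t₀ * y ^ 3 := by
            rw [div_mul_eq_mul_div, le_div_iff₀ ht₀]; linarith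
        _ ≤ K ^ 3 * y ^ 3 := by gcongr
    exact le_of_pow_le_pow_left₀ (by norm_num) (by positivity) f6
  have ht' : 0 < t := ht₀.trans_le ht
  have hXpos : 0 < X := hX₀.trans_le hXX
  -- Difference of cubes; the second factor is at least X₀² y², and dividing by it leaves an error
  -- of order y².
  have g1 : |x - X * y| * (X ^ 2 * y ^ 2 + X * y * x + x ^ 2)
      = 6 / t * |y ^ 3 - t / 6 * x ^ 3| := by
    have e1 : 0 < X ^ 2 * y ^ 2 + X * y * x + x ^ 2 := by positivity
    have e2 : 0 < 6 / t := by positivity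
    have e4 (u v : ℝ) (hv : 0 < v) : |u| * v = |u * v| := by rw [abs_mul, abs_of_pos hv]
    rw [e4 _ _ e1, mul_comm (6 / t), e4 _ _ e2, ← abs_neg]
    congr 1
    have e3 : t * X ^ 3 = 6 := by rw [hX]; field_simp
    field_simp
    linear_combination y ^ 3 * e3
  have g2 : |x - X * y| * (X₀ ^ 2 * y ^ 2) ≤ 6 / t₀ * (M * (K * y) * ((K * y) ^ 3 + y ^ 3)) := by
    calc |x - X * y| * (X₀ ^ 2 * y ^ 2)
        ≤ |x - X * y| * (X ^ 2 * y ^ 2 + X * y * x + x ^ 2) := by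
          have : X₀ ^ 2 * y ^ 2 ≤ X ^ 2 * y ^ 2 := by gcongr
          have : 0 < X * y * x + x ^ 2 := by positivity
          gcongr
          linarith
      _ = 6 / t * |y ^ 3 - t / 6 * x ^ 3| := g1
      _ ≤ 6 / t₀ * (M * x * (x ^ 3 + y ^ 3)) := by gcongr
      _ ≤ _ := by gcongr
  rw [div_mul_eq_mul_div, le_div_iff₀ (by positivity)]
  have hy2 : 0 < y ^ 2 := by positivity
  refine le_of_mul_le_mul_right ?_ hy2
  calc |x - X * y| * X₀ ^ 2 * y ^ 2 = |x - X * y| * (X₀ ^ 2 * y ^ 2) := by ring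
    _ ≤ _ := g2
    _ = _ := by ring

section

variable {a : ℝ}

/-- Roots of the truncated equation, up to a relative error of the order of the root. -/
theorem exists_root_estimate (h0 : -1 < 2 * a) (h1 : 2 * a < 1) (M₀ : ℝ) :
    ∃ C > 0, ∀ᶠ q in corner, ∀ y > 0,
      |y ^ 3 - truncCostFn ((1 + a * q.2) / 2) (Real.exp (-q.2)) (cbarFn a q.2 + q.1)|
        ≤ M₀ * q.1 * y ^ 3 →
      |q.1 - rootCoef a q.2 * y| ≤ C * y ^ 2 := by
  obtain ⟨M₁, hM₁, hb⟩ := exists_truncCostFn_bound h0 h1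
  have ht := thirdCoef_zero_pos h0 h1
  have hX := rootCoef_pos a 0
  set M := M₁ + |M₀| with hM
  have hMpos : 0 < M := by positivity
  -- Here t₀ is t(0)/2, so 18/t₀ = 36/t(0); the added 1 makes K at least 1, whence K³ ≥ K.
  set K := 36 / thirdCoef a 0 + 1
  have hK0 : 0 < 36 / thirdCoef a 0 := by positivity
  have hK : 1 ≤ K := by linarith
  have hK3 : 18 / (thirdCoef a 0 / 2) ≤ K ^ 3 := by
    calc 18 / (thirdCoef a 0 / 2) = 36 / thirdCoef a 0 := by field_simp; norm_num
      _ ≤ K := by linarith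
      _ ≤ K ^ 3 := le_self_pow₀ hK (by norm_num)
  refine ⟨6 / (thirdCoef a 0 / 2) * M * K * (K ^ 3 + 1) / (rootCoef a 0 / 2) ^ 2,
    by positivity, ?_⟩
  filter_upwards [hb, eventually_thirdCoef h0 h1, eventually_rootCoef h0 h1, eventually_fst_pos,
    eventually_fst_lt (show 0 < thirdCoef a 0 / 2 / 12 / M by positivity),
    eventually_fst_lt (show 0 < 1 / 2 / M by positivity)] with q q1 q2 q3 q4 q5 q6 y hy hE
  have hx1 : M * q.1 ≤ thirdCoef a 0 / 2 / 12 := by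
    rw [lt_div_iff₀ hMpos] at q5; linarith
  have hx2 : M * q.1 ≤ 1 / 2 := by
    rw [lt_div_iff₀ hMpos] at q6; linarith
  refine abs_sub_mul_le_of_cube (by positivity) q2.1.le (rootCoef_cube (by linarith [q2.1]))
    (by positivity) q3.1.le q4 hy hMpos hx1 hx2 (by linarith) hK3 ?_
  refine (abs_sub_le _ _ _).trans ((add_le_add hE q1).trans ?_)
  have hy3 : 0 < y ^ 3 := by positivity
  have f1 : M₀ * q.1 * y ^ 3 ≤ |M₀| * q.1 * y ^ 3 := by
    have := le_abs_self M₀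
    gcongr
  have f2 : 0 ≤ M₁ * q.1 * y ^ 3 := by positivity
  have f3 : 0 ≤ |M₀| * q.1 * q.1 ^ 3 := by positivity
  have f4 : M * q.1 * (q.1 ^ 3 + y ^ 3) = M₁ * q.1 ^ 4 + |M₀| * q.1 * q.1 ^ 3
    + M₁ * q.1 * y ^ 3 + |M₀| * q.1 * y ^ 3 := by rw [hM]; ring
  rw [f4]
  linarith

/-- First order expansion of an analytic function along the roots. -/
theorem exists_estimate {f : ℝ × ℝ → ℝ} (h0 : -1 < 2 * a) (h1 : 2 * a < 1)
    (hf : AnalyticAt ℝ f (cbarFn a 0, 0)) {C₀ : ℝ} (hC₀ : 0 < C₀) :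
    ∃ C > 0, ∀ᶠ q in corner, ∀ y > 0, y < 1 → |q.1 - rootCoef a q.2 * y| ≤ C₀ * y ^ 2 →
      |f (cbarFn a q.2 + q.1, q.2) - (f (cbarFn a q.2, q.2)
        + partialFst f (cbarFn a q.2, q.2) * rootCoef a q.2 * y)| ≤ C * y ^ 2 := by
  obtain ⟨M, hM, hb⟩ := exists_corner_taylor_one h0 hf
  obtain ⟨G, hG, hg⟩ := exists_bound_cbar h0 (AnalyticAt.partialFst hf)
  have hX := rootCoef_pos a 0
  refine ⟨M * (2 * rootCoef a 0 + C₀) ^ 2 + G * C₀, by positivity, ?_⟩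
  filter_upwards [hb, hg, eventually_rootCoef h0 h1, eventually_fst_pos]
    with q q1 q2 q3 q4 y hy hy1 hE
  -- As y < 1, the approximation already implies x = O(y), so the Taylor remainder O(x²) is O(y²).
  have hx : q.1 ≤ (2 * rootCoef a 0 + C₀) * y := by
    have e1 := (abs_le.1 hE).2
    have e2 : rootCoef a q.2 * y ≤ 2 * rootCoef a 0 * y := by
      have := q3.2
      gcongr
    have e3 : C₀ * y ^ 2 ≤ C₀ * y := by
      have : y ^ 2 ≤ y := by nlinarith
      gcongr
    linarith
  have e : f (cbarFn a q.2 + q.1, q.2) - (f (cbarFn a q.2, q.2)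
        + partialFst f (cbarFn a q.2, q.2) * rootCoef a q.2 * y)
      = (f (cbarFn a q.2 + q.1, q.2) - f (cbarFn a q.2, q.2)
        - partialFst f (cbarFn a q.2, q.2) * q.1)
        + partialFst f (cbarFn a q.2, q.2) * (q.1 - rootCoef a q.2 * y) := by ring
  rw [e]
  refine (abs_add_le _ _).trans ?_
  rw [abs_mul]
  have f1 : M * q.1 ^ 2 ≤ M * ((2 * rootCoef a 0 + C₀) * y) ^ 2 := by gcongr
  have f2 : |partialFst f (cbarFn a q.2, q.2)| * |q.1 - rootCoef a q.2 * y|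
      ≤ G * (C₀ * y ^ 2) := by gcongr
  refine (add_le_add (q1.trans f1) f2).trans (le_of_eq ?_)
  ring

/-- The estimates for the boundaries, the width and the growth rate. -/
theorem exists_estimates (h0 : -1 < 2 * a) (h1 : 2 * a < 1) {C₀ : ℝ} (hC₀ : 0 < C₀) :
    ∃ C > 0, ∀ᶠ q in corner, ∀ y > 0, y < 1 → |q.1 - rootCoef a q.2 * y| ≤ C₀ * y ^ 2 →
      |lowerBd (cbarFn a q.2 + q.1) - (1 / (1 + cbarFn a q.2) + lowerSlope a q.2 * y)|
        ≤ C * y ^ 2 ∧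
      |upperBd ((1 + a * q.2) / 2) (Real.exp (-q.2)) (cbarFn a q.2 + q.1)
        - (1 / (1 + cbarFn a q.2) + upperSlope a q.2 * y)| ≤ C * y ^ 2 ∧
      |(upperBd ((1 + a * q.2) / 2) (Real.exp (-q.2)) (cbarFn a q.2 + q.1)
        - lowerBd (cbarFn a q.2 + q.1)) - (upperSlope a q.2 - lowerSlope a q.2) * y|
        ≤ C * y ^ 2 ∧
      |growthFormula ((1 + a * q.2) / 2) (Real.exp (-q.2)) (cbarFn a q.2 + q.1) / q.2 ^ 2
        - (growthAn a (cbarFn a q.2, q.2) + growthSlope a q.2 * y)| ≤ C * y ^ 2 := by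
  have a1 := analyticAt_lowerAn h0 h1
  have a2 := analyticAt_upperAn h0 h1
  have a3 := analyticAt_growthAn h0 h1
  obtain ⟨C₁, hC₁, b₁⟩ := exists_estimate h0 h1 a1 hC₀
  obtain ⟨C₂, hC₂, b₂⟩ := exists_estimate h0 h1 a2 hC₀
  obtain ⟨C₃, hC₃, b₃⟩ := exists_estimate h0 h1 a3 hC₀
  refine ⟨C₁ + C₂ + C₃, by positivity, ?_⟩
  have t := tendsto_corner_cbar h0
  filter_upwards [b₁, b₂, b₃, eventually_corner_regime h0 h1, eventually_corner_dom h0 h1,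
    t.eventually a1.eventually_analyticAt, t.eventually a2.eventually_analyticAt,
    t.eventually a3.eventually_analyticAt, eventually_fst_pos]
    with q q1 q2 q3 H hD g1 g2 g3 hx y hy hy1 hE
  have hc := H.cbarFn_pos
  have hh := H.h_pos
  have e1 := q1 y hy hy1 hE
  have e2 := q2 y hy hy1 hE
  have e3 := q3 y hy hy1 hE
  rw [partialFst_lowerAn (by linarith) g1] at e1
  rw [H.partialFst_upperAn_cbar g2, H.upperAn_eq hD.1] at e2
  rw [H.partialFst_growthAn_cbar g3] at e3
  have hu : upperAn a (cbarFn a q.2, q.2) = 1 / (1 + cbarFn a q.2) := by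
    simp [upperAn, logSBarFn, excessFn]
  rw [hu] at e2
  have hgs : 0 < 1 + geomSum (odds ((1 + a * q.2) / 2)) (Real.exp (-q.2)) (cbarFn a q.2 + q.1) := by
    rw [H.geomSum_eq, add_sub_cancel_left]
    have := H.alphaFn_pos
    have := H.d_pos
    have : 0 < 1 - Real.exp (-q.2) := sub_pos.2 H.d_lt
    positivity
  have hg : growthAn a (cbarFn a q.2 + q.1, q.2)
      = growthFormula ((1 + a * q.2) / 2) (Real.exp (-q.2)) (cbarFn a q.2 + q.1) / q.2 ^ 2 := by
    rw [H.growthAn_eq hD hgs]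
    field_simp
  rw [hg] at e3
  have hy2 : 0 < y ^ 2 := by positivity
  have k1 : C₁ * y ^ 2 ≤ (C₁ + C₂ + C₃) * y ^ 2 := by gcongr; linarith
  have k2 : C₂ * y ^ 2 ≤ (C₁ + C₂ + C₃) * y ^ 2 := by gcongr; linarith
  have k3 : C₃ * y ^ 2 ≤ (C₁ + C₂ + C₃) * y ^ 2 := by gcongr; linarith
  have k4 : C₂ * y ^ 2 + C₁ * y ^ 2 ≤ (C₁ + C₂ + C₃) * y ^ 2 := by
    have := mul_pos hC₃ hy2
    linarith
  refine ⟨e1.trans k1, e2.trans k2, ?_, e3.trans k3⟩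
  refine le_trans (le_of_eq ?_) ((abs_sub _ _).trans ((add_le_add e2 e1).trans k4))
  congr 1
  unfold lowerAn lowerBd lowerSlope upperSlope
  ring

end

/-- The four estimates, with `y` in place of `λ^(1/3)` and the growth rate divided by `h ^ 2`. -/
def Estimates (a h c y C : ℝ) : Prop :=
  |lowerBd c - (1 / (1 + cbarFn a h) + lowerSlope a h * y)| ≤ C * y ^ 2 ∧
  |upperBd ((1 + a * h) / 2) (Real.exp (-h)) c
    - (1 / (1 + cbarFn a h) + upperSlope a h * y)| ≤ C * y ^ 2 ∧
  |(upperBd ((1 + a * h) / 2) (Real.exp (-h)) c - lowerBd c)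
    - (upperSlope a h - lowerSlope a h) * y| ≤ C * y ^ 2 ∧
  |growthFormula ((1 + a * h) / 2) (Real.exp (-h)) c / h ^ 2
    - (growthAn a (cbarFn a h, h) + growthSlope a h * y)| ≤ C * y ^ 2

/-- Only continuity is asked at the left end because it is applied at c̄, where the derivative of F₂
is zero. -/
theorem strictMonoOn_Ico_of_hasDerivAt_pos {f : ℝ → ℝ} {u v : ℝ} (hu : ContinuousAt f u)
    (hf : ∀ c ∈ Ioo u v, ∃ D > 0, HasDerivAt f D c) : StrictMonoOn f (Ico u v) := by
  refine strictMonoOn_of_deriv_pos (convex_Ico u v) (fun c hc => ?_) (fun c hc => ?_)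
  · rcases eq_or_lt_of_le hc.1 with rfl | h
    · exact hu.continuousWithinAt
    · obtain ⟨D, -, hD⟩ := hf c ⟨h, hc.2⟩
      exact hD.continuousAt.continuousWithinAt
  · rw [interior_Ico] at hc
    obtain ⟨D, hD, hd⟩ := hf c hc
    rwa [hd.deriv]

/-! ### Existence, uniqueness and expansion of the roots -/

section

variable {a : ℝ}

/-- The main term is at least t(0)x³/12, and half of it pays for the fourth order error. This bound
at a fixed distance from c̄ feeds the intermediate value theorem with a constant independent of h.
-/
theorem eventually_truncCostFn_ge (h0 : -1 < 2 * a) (h1 : 2 * a < 1) :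
    ∀ᶠ q in corner, thirdCoef a 0 / 24 * q.1 ^ 3
      ≤ truncCostFn ((1 + a * q.2) / 2) (Real.exp (-q.2)) (cbarFn a q.2 + q.1) := by
  obtain ⟨M, hM, hb⟩ := exists_truncCostFn_bound h0 h1
  have ht := thirdCoef_zero_pos h0 h1
  filter_upwards [hb, eventually_thirdCoef h0 h1, eventually_fst_pos,
    eventually_fst_lt (show 0 < thirdCoef a 0 / 24 / M by positivity)] with q q1 q2 q3 q4
  rw [lt_div_iff₀ hM] at q4
  have f1 := (abs_le.1 q1).1
  have hx3 : 0 < q.1 ^ 3 := by positivity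
  have f2 : M * q.1 ^ 4 ≤ thirdCoef a 0 / 24 * q.1 ^ 3 := by
    rw [show M * q.1 ^ 4 = q.1 * M * q.1 ^ 3 by ring]; gcongr
  have f3 : thirdCoef a 0 / 2 * q.1 ^ 3 ≤ thirdCoef a q.2 * q.1 ^ 3 := by
    have := q2.1
    gcongr
  linarith

/-- The truncated equation has exactly one root near `c̄`, with the stated expansions. -/
theorem exists_truncCostFn_expansion (h0 : -1 < 2 * a) (h1 : 2 * a < 1) :
    ∃ ρ > 0, ∃ h₁ > 0, ∃ lam₀ > 0, ∃ C > 0, ∀ h ∈ Ioo 0 h₁, ∀ lam ∈ Ioo 0 lam₀, ∀ y > 0,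
      y ^ 3 = lam →
      ∃ c ∈ Ioo (cBar ((1 + a * h) / 2) (Real.exp (-h)))
          (cBar ((1 + a * h) / 2) (Real.exp (-h)) + ρ),
        truncCostFn ((1 + a * h) / 2) (Real.exp (-h)) c = lam ∧
        (∀ c' ∈ Ioo (cBar ((1 + a * h) / 2) (Real.exp (-h)))
            (cBar ((1 + a * h) / 2) (Real.exp (-h)) + ρ),
          truncCostFn ((1 + a * h) / 2) (Real.exp (-h)) c' = lam → c' = c) ∧
        Estimates a h c y C := by
  obtain ⟨C₀, hC₀, b1⟩ := exists_root_estimate h0 h1 0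
  obtain ⟨C, hC, b2⟩ := exists_estimates h0 h1 hC₀
  have ht := thirdCoef_zero_pos h0 h1
  obtain ⟨ρ, hρ, hq⟩ := eventually_corner_iff.1 (b1.and (b2.and
    ((eventually_hasDerivAt_truncCostFn h0 h1).and ((eventually_truncCostFn_ge h0 h1).and
      (eventually_corner_regime h0 h1)))))
  -- The bound 1 on λ gives y < 1; the other one puts λ below the value of F₂ at c̄ + ρ/2.
  refine ⟨ρ, hρ, ρ, hρ, min 1 (thirdCoef a 0 / 24 * (ρ / 2) ^ 3), by positivity, C, hC,
    fun h hh lam hlam y hy hy3 => ?_⟩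
  have hmid : ρ / 2 ∈ Ioo 0 ρ := ⟨by positivity, by linarith⟩
  have H : Regime a h ((1 + a * h) / 2) (Real.exp (-h)) := (hq _ hmid h hh).2.2.2.2
  have hmono : StrictMonoOn (truncCostFn ((1 + a * h) / 2) (Real.exp (-h)))
      (Ico (cbarFn a h) (cbarFn a h + ρ)) := by
    refine strictMonoOn_Ico_of_hasDerivAt_pos (H.continuousAt_truncCostFn H.dom_cbar)
      fun c hc => ?_
    have := (hq (c - cbarFn a h) ⟨by linarith [hc.1], by linarith [hc.2]⟩ h hh).2.2.1
    simpa using this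
  have hcont : ContinuousOn (truncCostFn ((1 + a * h) / 2) (Real.exp (-h)))
      (Icc (cbarFn a h) (cbarFn a h + ρ / 2)) := by
    intro c hc
    rcases eq_or_lt_of_le hc.1 with rfl | hlt
    · exact (H.continuousAt_truncCostFn H.dom_cbar).continuousWithinAt
    · obtain ⟨D, -, hD⟩ := (hq (c - cbarFn a h) ⟨by linarith, by linarith [hc.2]⟩ h hh).2.2.1
      rw [add_sub_cancel] at hD
      exact hD.continuousAt.continuousWithinAt
  obtain ⟨c, hc, hcl⟩ := intermediate_value_Ioo (by linarith) hcont (show lam ∈ Ioo _ _ by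
    rw [H.truncCostFn_cbar]
    exact ⟨hlam.1, (hlam.2.trans_le (min_le_right _ _)).trans_le (hq _ hmid h hh).2.2.2.1⟩)
  rw [H.cBar_eq]
  have hy1 : y < 1 := by
    have := hlam.2.trans_le (min_le_left _ _)
    by_contra hcon
    have := one_le_pow₀ (not_lt.1 hcon) (n := 3)
    linarith
  have hx : c - cbarFn a h ∈ Ioo 0 ρ := ⟨by linarith [hc.1], by linarith [hc.2]⟩
  have e1 := (hq _ hx h hh).1 y hy (by simp [hcl, hy3])
  have e2 := (hq _ hx h hh).2.1 y hy hy1 e1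
  simp only [add_sub_cancel] at e2
  exact ⟨c, ⟨hc.1, by linarith [hc.2]⟩, hcl, fun c' hc' hcl' =>
    hmono.injOn ⟨hc'.1.le, hc'.2⟩ ⟨hc.1.le, by linarith [hc.2]⟩ (hcl'.trans hcl.symm), e2⟩

/-- The interval in the definition is exactly the part of the domain of F to the right of c̄. There
A is automatically positive, and B > 0 restricts c only for p > 1/2, where it is the stated upper
limit. -/
theorem Regime.isOptimalRatio_iff {h p d lam c : ℝ} (H : Regime a h p d) :
    IsOptimalRatio p d lam c ↔ cbarFn a h < c ∧ Dom p d c ∧ costFn p d c = lam := by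
  have hp : 0 < 1 - p := sub_pos.2 H.p_lt
  have hd : 0 < 1 - d := sub_pos.2 H.d_lt
  have hB : denFactor (odds p) d c = (1 - p - p * d - c * (2 * p - 1)) / ((1 - d) * (1 - p)) := by
    rw [denFactor, odds]; field_simp; ring
  have hcb := H.cbarFn_pos
  rw [IsOptimalRatio, H.cBar_eq]
  constructor
  · rintro ⟨hc, hlt, hF⟩
    refine ⟨hc, ⟨hcb.trans hc, ?_, ?_⟩, hF⟩
    · rw [H.numFactor_eq, ← sub_add_cancel c (cbarFn a h), mul_add, add_assoc, H.numFactor_cbar]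
      have := H.alphaFn_pos
      have : 0 < c - cbarFn a h := sub_pos.2 hc
      positivity
    · rcases le_or_gt p (1 / 2) with hp2 | hp2
      · have h1 : interceptFn a h - slopeFn a h * c
            = cbarFn a h - slopeFn a h * (c - cbarFn a h) := by
          linear_combination H.denFactor_cbar
        have h2 : slopeFn a h ≤ 0 := by
          have h3 := H.slopeFn_mul
          rw [← H.odds_eq] at h3
          have h4 : odds p ≤ 1 := by
            rw [odds, div_le_one hp]; linarith
          by_contra hcon
          have := mul_pos (not_le.1 hcon) hd
          linarith
        rw [H.denFactor_eq, h1]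
        have := mul_nonneg (neg_nonneg.2 h2) (sub_pos.2 hc).le
        linarith
      · rw [hB]
        have h1 := hlt hp2
        rw [lt_div_iff₀ (by linarith)] at h1
        have h2 : 0 < 1 - p - p * d - c * (2 * p - 1) := by linarith
        positivity
  · rintro ⟨hc, hD, hF⟩
    refine ⟨hc, fun hp2 => ?_, hF⟩
    have h1 := hD.2.2
    rw [hB, div_pos_iff_of_pos_right (by positivity)] at h1
    rw [lt_div_iff₀ (by linarith)]
    linarith

theorem Regime.dom_of_mem_Icc {h p d c c₁ c₂ : ℝ} (H : Regime a h p d) (hD₁ : Dom p d c₁)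
    (hD₂ : Dom p d c₂) (hc : c ∈ Icc c₁ c₂) : Dom p d c := by
  obtain ⟨h1, h2, h3⟩ := hD₁
  obtain ⟨-, -, k3⟩ := hD₂
  rw [H.numFactor_eq] at h2
  rw [H.denFactor_eq] at h3 k3
  refine ⟨h1.trans_le hc.1, ?_, ?_⟩
  · rw [H.numFactor_eq]
    have := mul_le_mul_of_nonneg_left hc.1 H.alphaFn_pos.le
    linarith
  · rw [H.denFactor_eq]
    rcases le_total 0 (slopeFn a h) with hs | hs
    · have := mul_le_mul_of_nonneg_left hc.2 hs
      linarith
    · have := mul_le_mul_of_nonpos_left hc.1 hs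
      linarith

/-- Away from `c̄` the cost function is increasing. -/
theorem exists_logSlope_neg (h0 : -1 < 2 * a) {κ : ℝ} (hκ : 0 < κ) :
    ∃ ε > 0, ∀ h ∈ Ioo 0 ε, ∀ p d, Regime a h p d → ∀ c, cbarFn a h < c → Dom p d c →
      κ * h ≤ (c - cbarFn a h) ^ 3 →
      logSlope (alphaFn a h) (slopeFn a h) (interceptFn a h) (etaFn a h) d c < 0 := by
  have e1 := analyticAt_cbarFn h0
  have e2 := analyticAt_oddsFn a
  have e3 := analyticAt_etaFn a
  have e4 := analyticAt_interceptFn a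
  have e5 := analyticAt_alphaFn a
  have e6 := analyticAt_slopeFn a
  obtain ⟨M₁, hM₁, b₁⟩ := (isBigO_id_of_zero (f := fun h => cbarFn a h
    * (1 + oddsFn a h - etaFn a h * (1 + Real.exp (-h)))) (by fun_prop)
    (by simp [oddsFn_zero, etaFn_zero])).exists_pos
  obtain ⟨M₂, hM₂, b₂⟩ := (isBigO_id_of_zero (f := fun h => 2 * interceptFn a h * (1 - etaFn a h))
    (by fun_prop) (by simp [etaFn_zero])).exists_pos
  have e7 : AnalyticAt ℝ (fun h => alphaFn a h * (slopeFn a h + etaFn a h)) 0 := by fun_prop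
  have hν : 0 < (1 + 2 * a) ^ 2 / 2 := by
    have : 0 < 1 + 2 * a := by linarith
    positivity
  have b₃ := e7.continuousAt.eventually (lt_mem_nhds (a := (1 + 2 * a) ^ 2 / 2) (by
    simp only [alphaFn_zero, slopeFn_zero, etaFn_zero]; linarith))
  obtain ⟨ε₁, hε₁, hb⟩ := Metric.eventually_nhds_iff_ball.1 (b₁.bound.and (b₂.bound.and b₃))
  set ν := (1 + 2 * a) ^ 2 / 2
  set M := M₁ + M₂
  have hM : 0 < M := by positivity
  -- The threshold between small x, where h ≤ x³/κ controls the O(h) terms, and larger x, where the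
  -- smallness of h itself does.
  set r := min 1 (ν * κ / (4 * M)) with hr
  have hr0 : 0 < r := by positivity
  have hr1 : r ≤ 1 := min_le_left _ _
  have hr2 : r * (4 * M) ≤ ν * κ := by
    rw [← le_div_iff₀ (by positivity)]; exact min_le_right _ _
  refine ⟨min ε₁ (ν * r ^ 2 / (4 * M)), by positivity, fun h hh p d H c hc hD hx3 => ?_⟩
  have hhpos := hh.1
  have hhr : h * (4 * M) < ν * r ^ 2 := by
    rw [← lt_div_iff₀ (by positivity)]; exact hh.2.trans_le (min_le_right _ _)
  obtain ⟨q1, q2, q3⟩ := hb h (by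
    rw [Metric.mem_ball, Real.dist_eq, sub_zero, abs_of_pos hhpos]
    exact hh.2.trans_le (min_le_left _ _))
  rw [Real.norm_eq_abs, Real.norm_eq_abs, abs_of_pos hhpos, ← H.d_eq] at q1
  rw [Real.norm_eq_abs, Real.norm_eq_abs, abs_of_pos hhpos] at q2
  rw [H.logSlope_eq hD]
  obtain ⟨hc0, hA, hB⟩ := hD
  rw [H.numFactor_eq, mul_comm d] at hA
  rw [H.denFactor_eq] at hB
  rw [mul_comm d] at *
  refine div_neg_of_neg_of_pos ?_ (by positivity)
  set x := c - cbarFn a h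
  have hx : 0 < x := sub_pos.2 hc
  have f1 := (abs_le.1 q1).2
  have f2 := mul_le_mul_of_nonneg_right (abs_le.1 q2).2 hx.le
  have f3 : ν * x ^ 2 ≤ alphaFn a h * (slopeFn a h + etaFn a h) * x ^ 2 := by gcongr
  -- The numerator is at most M h (1 + x) - ν x². For x ≤ r the first term is at most ν x²/2; for x
  -- > r both of its parts are below ν x²/4, the part with x because r ≤ 1.
  have key : M * h * (1 + x) < ν * x ^ 2 := by
    rcases le_or_gt x r with hxr | hxr
    · have g1 : M * h * (1 + x) ≤ M * h * 2 := by gcongr; linarith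
      have g2 : κ * (M * h * 2) ≤ 2 * M * x ^ 3 := by
        have := mul_le_mul_of_nonneg_left hx3 (show 0 ≤ 2 * M by positivity)
        linarith
      have g3 : 2 * M * x ^ 3 ≤ 2 * M * r * x ^ 2 := by
        rw [show 2 * M * x ^ 3 = 2 * M * x * x ^ 2 by ring]; gcongr
      have g4 : 2 * M * r * x ^ 2 ≤ ν * κ / 2 * x ^ 2 := by gcongr; linarith
      have g5 : 0 < ν * κ / 2 * x ^ 2 := by positivity
      refine lt_of_le_of_lt g1 (lt_of_mul_lt_mul_left (a := κ) ?_ hκ.le)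
      linarith
    · have g1 : ν * r ^ 2 ≤ ν * x ^ 2 := by gcongr
      have g2 : ν * r ^ 2 * x ≤ ν * x ^ 2 := by
        have : r * (r * x) ≤ 1 * (x * x) := by gcongr
        nlinarith
      have g3 := mul_lt_mul_of_pos_right hhr hx
      have g4 : 0 < ν * x ^ 2 := by positivity
      linarith
  have hM' : M * h * (1 + x) = M₁ * h + M₂ * h + (M₁ * h * x + M₂ * h * x) := by ring
  have g6 : 0 < M₁ * h * x := by positivity
  have g7 : 0 < M₂ * h := by positivity
  linarith

end

section

variable {a : ℝ}

/-- Solutions of `F(c) = λ` are not too close to `c̄` if `h ≤ λ`. -/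
theorem exists_root_lower_bound (h0 : -1 < 2 * a) (h1 : 2 * a < 1) :
    ∃ κ > 0, ∃ ε > 0, ∀ lam ∈ Ioo 0 ε, ∀ h > 0, h ≤ lam → ∀ x > 0,
      costFn ((1 + a * h) / 2) (Real.exp (-h)) (cbarFn a h + x) = lam → κ * lam ≤ x ^ 3 := by
  obtain ⟨M₁, hM₁, b₁⟩ := exists_truncCostFn_bound h0 h1
  obtain ⟨M₂, hM₂, b₂⟩ := exists_costFn_sub_truncCostFn_bound h0 h1
  have ht := thirdCoef_zero_pos h0 h1
  obtain ⟨ρ, hρ, hq⟩ := eventually_corner_iff.1 (b₁.and (b₂.and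
    ((eventually_thirdCoef h0 h1).and ((eventually_fst_lt one_pos).and
      (eventually_fst_lt (show 0 < 1 / 2 / M₂ by positivity))))))
  set B := 2 * thirdCoef a 0 + M₁
  have hB : 0 < B := by positivity
  -- Near c̄, λ = F(c) is at most B x³ plus the error M₂hx ≤ λ/2, so λ ≤ 2B x³. Away from c̄ the
  -- bound on λ makes this trivial.
  refine ⟨1 / (2 * B), by positivity, min ρ (ρ ^ 3 * (2 * B)), by positivity,
    fun lam hlam h hh hhl x hx hF => ?_⟩
  rw [one_div, inv_mul_le_iff₀ (by positivity)]
  rcases lt_or_ge x ρ with hxρ | hxρ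
  · obtain ⟨q1, q2, q3, q4, q5⟩ := hq x ⟨hx, hxρ⟩ h
      ⟨hh, hhl.trans_lt (hlam.2.trans_le (min_le_left _ _))⟩
    simp only at q1 q2 q3 q4 q5
    rw [hF] at q2
    rw [lt_div_iff₀ hM₂] at q5
    have f1 := (abs_le.1 q1).2
    have f2 := (abs_le.1 q2).2
    have f3 : M₂ * h * x ≤ lam / 2 := by
      have : M₂ * h * x ≤ M₂ * lam * x := by gcongr
      have := mul_le_mul_of_nonneg_right q5.le hlam.1.le
      linarith
    have hx3 : 0 < x ^ 3 := by positivity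
    have f4 : M₁ * x ^ 4 ≤ M₁ * x ^ 3 := by
      have : x ^ 4 ≤ x ^ 3 := pow_le_pow_of_le_one hx.le q4.le (by norm_num)
      gcongr
    have f5 : thirdCoef a h * x ^ 3 ≤ 2 * thirdCoef a 0 * x ^ 3 := by
      have := q3.2
      gcongr
    have f6 : 0 < thirdCoef a 0 * x ^ 3 := by positivity
    have f7 : B * x ^ 3 = 2 * thirdCoef a 0 * x ^ 3 + M₁ * x ^ 3 := add_mul _ _ _
    linarith
  · calc lam ≤ ρ ^ 3 * (2 * B) := (hlam.2.trans_le (min_le_right _ _)).le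
      _ = 2 * B * ρ ^ 3 := mul_comm _ _
      _ ≤ 2 * B * x ^ 3 := by gcongr

/-- If `h ≤ λ`, then the optimal ratio exists, is unique, and has the stated expansions. -/
theorem exists_costFn_expansion (h0 : -1 < 2 * a) (h1 : 2 * a < 1) :
    ∃ ε > 0, ∃ C > 0, ∀ lam ∈ Ioo 0 ε, ∀ h > 0, h ≤ lam → ∀ y > 0, y ^ 3 = lam →
      Regime a h ((1 + a * h) / 2) (Real.exp (-h)) ∧
      ∃ c, IsOptimalRatio ((1 + a * h) / 2) (Real.exp (-h)) lam c ∧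
        (∀ c', IsOptimalRatio ((1 + a * h) / 2) (Real.exp (-h)) lam c' → c' = c) ∧
        Estimates a h c y C := by
  obtain ⟨κ, hκ, ε₁, hε₁, hroot⟩ := exists_root_lower_bound h0 h1
  obtain ⟨ε₂, hε₂, hslope⟩ := exists_logSlope_neg h0 hκ
  obtain ⟨M, hM, b₀⟩ := exists_costFn_sub_truncCostFn_bound h0 h1
  obtain ⟨C₀, hC₀, b₁⟩ := exists_root_estimate h0 h1 M
  obtain ⟨C, hC, b₂⟩ := exists_estimates h0 h1 hC₀
  have ht := thirdCoef_zero_pos h0 h1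
  obtain ⟨ρ, hρ, hq⟩ := eventually_corner_iff.1 (b₀.and (b₁.and (b₂.and
    ((eventually_truncCostFn_ge h0 h1).and ((eventually_corner_regime h0 h1).and
      (eventually_corner_dom h0 h1))))))
  -- For λ < A and h ≤ λ, the lower bound for F₂ at c̄ + ρ/2 exceeds λ even after subtracting the
  -- error M h ρ/2.
  set A := thirdCoef a 0 / 24 * (ρ / 2) ^ 3 / (1 + M * (ρ / 2)) with hA
  have hA0 : 0 < A := by positivity
  refine ⟨min (min 1 ρ) (min A (min ε₁ ε₂)), by positivity, C, hC,
    fun lam hlam h hh hhl y hy hy3 => ?_⟩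
  have hlam1 : lam < 1 := hlam.2.trans_le ((min_le_left _ _).trans (min_le_left _ _))
  have hlamρ : lam < ρ := hlam.2.trans_le ((min_le_left _ _).trans (min_le_right _ _))
  have hlamA : lam < A := hlam.2.trans_le ((min_le_right _ _).trans (min_le_left _ _))
  have hlam₁ : lam < ε₁ :=
    hlam.2.trans_le ((min_le_right _ _).trans ((min_le_right _ _).trans (min_le_left _ _)))
  have hlam₂ : lam < ε₂ :=
    hlam.2.trans_le ((min_le_right _ _).trans ((min_le_right _ _).trans (min_le_right _ _)))
  have hhρ : h ∈ Ioo 0 ρ := ⟨hh, hhl.trans_lt hlamρ⟩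
  have hmid : ρ / 2 ∈ Ioo 0 ρ := ⟨by positivity, by linarith⟩
  have H : Regime a h ((1 + a * h) / 2) (Real.exp (-h)) := (hq _ hmid h hhρ).2.2.2.2.1
  refine ⟨H, ?_⟩
  have hdom : ∀ c ∈ Icc (cbarFn a h) (cbarFn a h + ρ / 2),
      Dom ((1 + a * h) / 2) (Real.exp (-h)) c := fun c hc =>
    H.dom_of_mem_Icc H.dom_cbar (hq _ hmid h hhρ).2.2.2.2.2 hc
  have hcont : ContinuousOn (costFn ((1 + a * h) / 2) (Real.exp (-h)))
      (Icc (cbarFn a h) (cbarFn a h + ρ / 2)) := fun c hc =>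
    (H.hasDerivAt_costFn (hdom c hc)).continuousAt.continuousWithinAt
  obtain ⟨c, hc, hcl⟩ := intermediate_value_Ioo (by linarith) hcont (show lam ∈ Ioo _ _ by
    rw [H.costFn_cbar]
    refine ⟨hlam.1, ?_⟩
    have f1 := (abs_le.1 (hq _ hmid h hhρ).1).1
    have f2 := (hq _ hmid h hhρ).2.2.2.1
    rw [hA, lt_div_iff₀ (by positivity)] at hlamA
    have f3 : M * h * (ρ / 2) ≤ M * lam * (ρ / 2) := by gcongr
    simp only at f1 f2
    linarith)
  have hD := hdom c ⟨hc.1.le, hc.2.le⟩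
  have hy1 : y < 1 := by
    by_contra hcon
    have := one_le_pow₀ (not_lt.1 hcon) (n := 3)
    linarith
  have hx : c - cbarFn a h ∈ Ioo 0 ρ := ⟨by linarith [hc.1], by linarith [hc.2]⟩
  refine ⟨c, H.isOptimalRatio_iff.2 ⟨hc.1, hD, hcl⟩, fun c' hc' => ?_, ?_⟩
  -- F need not be monotone close to c̄, but to the right of any root c₁ it increases strictly: (c₁
  -- - c̄)³ ≥ κλ ≥ κh, and this persists for larger c. Hence there cannot be a second root anywhere
  -- in the domain.
  · have hmono : ∀ c₁ c₂, cbarFn a h < c₁ → Dom ((1 + a * h) / 2) (Real.exp (-h)) c₁ →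
        costFn ((1 + a * h) / 2) (Real.exp (-h)) c₁ = lam →
        Dom ((1 + a * h) / 2) (Real.exp (-h)) c₂ → c₁ < c₂ →
        lam < costFn ((1 + a * h) / 2) (Real.exp (-h)) c₂ := by
      intro c₁ c₂ hc₁ hD₁ hF₁ hD₂ h12
      have hder : ∀ t ∈ Icc c₁ c₂, ∃ D > 0,
          HasDerivAt (costFn ((1 + a * h) / 2) (Real.exp (-h))) D t := by
        intro t htc
        have hDt := H.dom_of_mem_Icc hD₁ hD₂ htc
        have htb : cbarFn a h < t := hc₁.trans_le htc.1
        have e := hroot lam ⟨hlam.1, hlam₁⟩ h hh hhl (c₁ - cbarFn a h) (sub_pos.2 hc₁)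
          (by rwa [add_sub_cancel])
        have e' : κ * h ≤ (t - cbarFn a h) ^ 3 := by
          calc κ * h ≤ κ * lam := by gcongr
            _ ≤ (c₁ - cbarFn a h) ^ 3 := e
            _ ≤ (t - cbarFn a h) ^ 3 := by
              have := sub_pos.2 hc₁
              have := htc.1
              gcongr
        have hs := hslope h ⟨hh, hhl.trans_lt hlam₂⟩ _ _ H t htb hDt e'
        exact ⟨_, neg_pos.2 (mul_neg_of_pos_of_neg (H.one_sub_costFn_pos hDt) hs),
          H.hasDerivAt_costFn hDt⟩
      have hsm : StrictMonoOn (costFn ((1 + a * h) / 2) (Real.exp (-h))) (Icc c₁ c₂) := by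
        refine strictMonoOn_of_deriv_pos (convex_Icc _ _) (fun t ht => ?_) (fun t ht => ?_)
        · obtain ⟨D, -, hd⟩ := hder t ht
          exact hd.continuousAt.continuousWithinAt
        · obtain ⟨D, hD, hd⟩ := hder t (interior_subset ht)
          rwa [hd.deriv]
      have := hsm (left_mem_Icc.2 h12.le) (right_mem_Icc.2 h12.le) h12
      rwa [hF₁] at this
    obtain ⟨k1, k2, k3⟩ := H.isOptimalRatio_iff.1 hc'
    rcases lt_trichotomy c' c with hlt | heq | hgt
    · exact absurd hcl (hmono c' c k1 k2 k3 hD hlt).ne'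
    · exact heq
    · exact absurd k3 (hmono c c' hc.1 hD hcl k2 hgt).ne'
  · have e0 := (hq _ hx h hhρ).1
    have e1 := (hq _ hx h hhρ).2.1 y hy
    have e2 := (hq _ hx h hhρ).2.2.1 y hy hy1
    simp only [add_sub_cancel] at e0 e1 e2
    -- The hypothesis h ≤ λ is decisive here: |F - F₂| ≤ Mhx ≤ Mxλ, the relative error of order x
    -- that `exists_root_estimate` tolerates.
    refine e2 (e1 ?_)
    rw [hy3, ← hcl]
    refine e0.trans ?_
    rw [hcl]
    have := hx.1
    calc M * h * (c - cbarFn a h) ≤ M * lam * (c - cbarFn a h) := by gcongr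
      _ = M * (c - cbarFn a h) * lam := by ring

/-- If the number of steps is an integer, the growth rate is given by the closed form. -/
theorem Regime.optimalGrowthRate_eq {h p d lam c x : ℝ} {n : ℕ} (H : Regime a h p d)
    (hl0 : 0 < lam) (hl1 : lam < 1) (hc : IsOptimalRatio p d lam c) (hn : 0 < n)
    (hk : stepCount p d c = n) (hx : 0 < x) :
    optimalGrowthRate p d lam x = (growthFormula p d c : EReal) := by
  obtain ⟨-, hD, hF⟩ := H.isOptimalRatio_iff.1 hc
  rw [← meanReward_eq_growthFormula H.p_pos H.p_lt H.d_pos H.d_lt hD.1 hk]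
  exact (IntegerStep.of_stepCount H.p_pos H.p_lt H.d_pos H.d_lt hD.1 hD.2.1 hD.2.2 hl0 hl1 hn hk
    hF).optimalGrowthRate_eq hx

end

/-! ### Return to the parameters μ, σ, δ and λ -/

theorem upProb_eq {μ σ θ δ : ℝ} (hσ : 0 < σ) (hθ : θ = μ / σ ^ 2) :
    upProb μ σ δ = (1 + (θ - 1 / 2) * (σ * √δ)) / 2 := by
  rw [upProb, hθ]
  field_simp

theorem downFactor_eq (σ δ : ℝ) : downFactor σ δ = Real.exp (-(σ * √δ)) := by
  rw [downFactor, neg_mul]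

/-- The estimates in terms of the time step and the transaction cost. -/
theorem Estimates.of_sqrt {σ θ δ lam c C : ℝ} (hσ : 0 < σ) (h0 : 0 < θ) (h1 : θ < 1) (hδ : 0 < δ)
    (hl : 0 < lam)
    (hE : Estimates (θ - 1 / 2) (σ * √δ) c (lam ^ (1 / 3 : ℝ)) C) (hC : 0 < C) :
    |lowerBd c - (1 / (1 + cbarFn (θ - 1 / 2) (σ * √δ))
        + lowerSlope (θ - 1 / 2) (σ * √δ) * lam ^ (1 / 3 : ℝ))|
      ≤ (1 + σ ^ 2) * C * lam ^ (2 / 3 : ℝ) ∧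
    |upperBd ((1 + (θ - 1 / 2) * (σ * √δ)) / 2) (Real.exp (-(σ * √δ))) c
        - (1 / (1 + cbarFn (θ - 1 / 2) (σ * √δ))
        + upperSlope (θ - 1 / 2) (σ * √δ) * lam ^ (1 / 3 : ℝ))|
      ≤ (1 + σ ^ 2) * C * lam ^ (2 / 3 : ℝ) ∧
    |(upperBd ((1 + (θ - 1 / 2) * (σ * √δ)) / 2) (Real.exp (-(σ * √δ))) c - lowerBd c)
        - (6 * θ ^ 2 * (1 - θ) ^ 2) ^ (1 / 3 : ℝ)
          * ((upperSlope (θ - 1 / 2) (σ * √δ) - lowerSlope (θ - 1 / 2) (σ * √δ))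
            / (6 * θ ^ 2 * (1 - θ) ^ 2) ^ (1 / 3 : ℝ)) * lam ^ (1 / 3 : ℝ)|
      ≤ (1 + σ ^ 2) * C * lam ^ (2 / 3 : ℝ) ∧
    |growthFormula ((1 + (θ - 1 / 2) * (σ * √δ)) / 2) (Real.exp (-(σ * √δ))) c / δ
        - (σ ^ 2 * growthAn (θ - 1 / 2) (cbarFn (θ - 1 / 2) (σ * √δ), σ * √δ)
          + σ ^ 2 * growthSlope (θ - 1 / 2) (σ * √δ) * lam ^ (1 / 3 : ℝ))|
      ≤ (1 + σ ^ 2) * C * lam ^ (2 / 3 : ℝ) := by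
  obtain ⟨e1, e2, e3, e4⟩ := hE
  have hy2 : (lam ^ (1 / 3 : ℝ)) ^ 2 = lam ^ (2 / 3 : ℝ) := by
    rw [← Real.rpow_natCast, ← Real.rpow_mul hl.le]; norm_num
  rw [hy2] at e1 e2 e3 e4
  have hl2 : 0 < lam ^ (2 / 3 : ℝ) := by positivity
  have hs : 0 < σ ^ 2 := by positivity
  have k1 : C * lam ^ (2 / 3 : ℝ) ≤ (1 + σ ^ 2) * C * lam ^ (2 / 3 : ℝ) := by
    have : 0 < σ ^ 2 * (C * lam ^ (2 / 3 : ℝ)) := by positivity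
    linarith
  have hw : (6 * θ ^ 2 * (1 - θ) ^ 2) ^ (1 / 3 : ℝ) ≠ 0 := by
    have : 0 < 1 - θ := sub_pos.2 h1
    positivity
  refine ⟨e1.trans k1, e2.trans k1, ?_, ?_⟩
  · rw [mul_div_cancel₀ _ hw]; exact e3.trans k1
  · rw [mul_pow, Real.sq_sqrt hδ.le] at e4
    generalize growthFormula _ _ c = G at *
    have e5 : G / δ - (σ ^ 2 * growthAn (θ - 1 / 2) (cbarFn (θ - 1 / 2) (σ * √δ), σ * √δ)
          + σ ^ 2 * growthSlope (θ - 1 / 2) (σ * √δ) * lam ^ (1 / 3 : ℝ))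
        = σ ^ 2 * (G / (σ ^ 2 * δ) - (growthAn (θ - 1 / 2) (cbarFn (θ - 1 / 2) (σ * √δ), σ * √δ)
          + growthSlope (θ - 1 / 2) (σ * √δ) * lam ^ (1 / 3 : ℝ))) := by
      field_simp
    rw [e5, abs_mul, abs_of_pos hs]
    have := mul_le_mul_of_nonneg_left e4 hs.le
    have : 0 < C * lam ^ (2 / 3 : ℝ) := by positivity
    linarith

end ShadowBinomial

end

theorem theorem8p2 (μ σ θ : ℝ) (hσ : 0 < σ) (hμ : 0 < μ) (hμσ : μ < σ ^ 2)
    (hθ : θ = μ / σ ^ 2) :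
    ∃ lo₀ lo₁ up₀ up₁ wd R₀ R₁ : ℝ → ℝ,
      -- expansions of the coefficients as the time step tends to zero
      ((fun δ => lo₀ δ - (θ + σ ^ 2 / 24 * (2 * θ - 1) * δ))
        =O[𝓝[>] 0] fun δ : ℝ => δ ^ (3 / 2 : ℝ)) ∧
      ((fun δ => lo₁ δ - (-(3 * θ ^ 2 * (1 - θ) ^ 2 / 4) ^ (1 / 3 : ℝ)
          + (3 * θ ^ 2 * (1 - θ) ^ 2 / 32) ^ (1 / 3 : ℝ) * (4 * θ - 3) * σ * √δ))
        =O[𝓝[>] 0] fun δ : ℝ => δ) ∧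
      ((fun δ => up₀ δ - (θ + σ ^ 2 / 24 * (2 * θ - 1) * δ))
        =O[𝓝[>] 0] fun δ : ℝ => δ ^ (3 / 2 : ℝ)) ∧
      ((fun δ => up₁ δ - ((3 * θ ^ 2 * (1 - θ) ^ 2 / 4) ^ (1 / 3 : ℝ)
          + (3 * θ ^ 2 * (1 - θ) ^ 2 / 32) ^ (1 / 3 : ℝ) * σ * √δ))
        =O[𝓝[>] 0] fun δ : ℝ => δ) ∧
      ((fun δ => wd δ - (1 + (1 - θ) * σ * √δ)) =O[𝓝[>] 0] fun δ : ℝ => δ) ∧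
      ((fun δ => R₀ δ - (μ ^ 2 / (2 * σ ^ 2)
          + σ ^ 4 / 24 * (θ * (θ - 1) * (2 * θ ^ 2 - 2 * θ + 1)) * δ))
        =O[𝓝[>] 0] fun δ : ℝ => δ ^ (3 / 2 : ℝ)) ∧
      ((fun δ => R₁ δ
          - (-((3 / 32 : ℝ) ^ (1 / 3 : ℝ) * σ ^ 3 * (θ * (1 - θ)) ^ (5 / 3 : ℝ)) * √δ))
        =O[𝓝[>] 0] fun δ : ℝ => δ) ∧
      -- they are the coefficients of the truncated series, uniformly in the time step
      (∃ ρ > 0, ∃ δ₀ > 0, ∃ lam₀ > 0, ∃ C > 0, ∀ δ ∈ Ioo 0 δ₀, ∀ lam ∈ Ioo 0 lam₀,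
        ∀ p, p = upProb μ σ δ → ∀ d, d = downFactor σ δ →
        ∃ c ∈ Ioo (cBar p d) (cBar p d + ρ), truncCostFn p d c = lam ∧
          (∀ c' ∈ Ioo (cBar p d) (cBar p d + ρ), truncCostFn p d c' = lam → c' = c) ∧
          |lowerBd c - (lo₀ δ + lo₁ δ * lam ^ (1 / 3 : ℝ))| ≤ C * lam ^ (2 / 3 : ℝ) ∧
          |upperBd p d c - (up₀ δ + up₁ δ * lam ^ (1 / 3 : ℝ))| ≤ C * lam ^ (2 / 3 : ℝ) ∧
          |(upperBd p d c - lowerBd c)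
              - (6 * θ ^ 2 * (1 - θ) ^ 2) ^ (1 / 3 : ℝ) * wd δ * lam ^ (1 / 3 : ℝ)|
            ≤ C * lam ^ (2 / 3 : ℝ) ∧
          |growthFormula p d c / δ - (R₀ δ + R₁ δ * lam ^ (1 / 3 : ℝ))|
            ≤ C * lam ^ (2 / 3 : ℝ)) ∧
      -- and they give the expansions of the actual quantities when `δ ≪ lam ^ 2`
      (∃ ε > 0, ∃ C > 0, ∀ lam ∈ Ioo 0 ε, ∀ δ ∈ Ioo 0 (ε * lam ^ 2),
        ∀ p, p = upProb μ σ δ → ∀ d, d = downFactor σ δ →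
        ∃ c, IsOptimalRatio p d lam c ∧ (∀ c', IsOptimalRatio p d lam c' → c' = c) ∧
          |lowerBd c - (lo₀ δ + lo₁ δ * lam ^ (1 / 3 : ℝ))| ≤ C * lam ^ (2 / 3 : ℝ) ∧
          |upperBd p d c - (up₀ δ + up₁ δ * lam ^ (1 / 3 : ℝ))| ≤ C * lam ^ (2 / 3 : ℝ) ∧
          |(upperBd p d c - lowerBd c)
              - (6 * θ ^ 2 * (1 - θ) ^ 2) ^ (1 / 3 : ℝ) * wd δ * lam ^ (1 / 3 : ℝ)|
            ≤ C * lam ^ (2 / 3 : ℝ) ∧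
          ((∃ n : ℕ, 0 < n ∧ stepCount p d c = n) →
            ∀ x > 0, ∃ R : ℝ, optimalGrowthRate p d lam x = (R : EReal) ∧
              |R / δ - (R₀ δ + R₁ δ * lam ^ (1 / 3 : ℝ))| ≤ C * lam ^ (2 / 3 : ℝ))) := by
  have h0 : 0 < θ := by rw [hθ]; positivity
  have h1 : θ < 1 := by rw [hθ, div_lt_one (by positivity)]; exact hμσ
  have e0 : -1 < 2 * (θ - 1 / 2) := by linarith
  have e1 : 2 * (θ - 1 / 2) < 1 := by linarith
  -- The seven functions are read off from the expansions: value at c̄(h) and λ^(1/3)-coefficient of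
  -- each quantity at h = σ√δ, with a factor σ² for the growth rate because h² = σ²δ. Both
  -- boundaries share the value 1/(1 + c̄).
  refine ⟨_, _, _, _, _, _, _, isBigO_lowerCoef_sqrt hσ h0 h1, isBigO_lowerSlope_sqrt hσ h0 h1,
    isBigO_lowerCoef_sqrt hσ h0 h1, isBigO_upperSlope_sqrt hσ h0 h1, isBigO_width_sqrt hσ h0 h1,
    isBigO_growthCoef_sqrt hσ h0 h1 hθ, isBigO_growthSlope_sqrt hσ h0 h1, ?_, ?_⟩
  · obtain ⟨ρ, hρ, h₁, hh₁, lam₀, hlam₀, C, hC, H⟩ := exists_truncCostFn_expansion e0 e1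
    refine ⟨ρ, hρ, (h₁ / σ) ^ 2, by positivity, lam₀, hlam₀, (1 + σ ^ 2) * C, by positivity, ?_⟩
    rintro δ hδ lam hlam p rfl d rfl
    have hδ0 := hδ.1
    have hl0 := hlam.1
    have hh : σ * √δ ∈ Ioo 0 h₁ := by
      refine ⟨by positivity, ?_⟩
      have := (Real.sqrt_lt_sqrt hδ0.le hδ.2).trans_eq (Real.sqrt_sq (by positivity))
      rw [lt_div_iff₀ hσ] at this
      linarith
    rw [upProb_eq hσ hθ, downFactor_eq]
    obtain ⟨c, hc, hcl, hu, hE⟩ := H (σ * √δ) hh lam hlam (lam ^ (1 / 3 : ℝ)) (by positivity)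
      (by rw [← Real.rpow_natCast, ← Real.rpow_mul hl0.le]; norm_num)
    exact ⟨c, hc, hcl, hu, hE.of_sqrt hσ h0 h1 hδ0 hl0 hC⟩
  · obtain ⟨ε, hε, C, hC, H⟩ := exists_costFn_expansion e0 e1
    -- The bound 1/σ² turns δ < ελ² into σ√δ ≤ λ, the form in which the regime is used.
    refine ⟨min (min 1 ε) (1 / σ ^ 2), by positivity, (1 + σ ^ 2) * C, by positivity, ?_⟩
    rintro lam hlam δ hδ p rfl d rfl
    have hδ0 := hδ.1
    have hl0 := hlam.1
    have hl1 : lam < 1 := hlam.2.trans_le ((min_le_left _ _).trans (min_le_left _ _))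
    have hlε : lam < ε := hlam.2.trans_le ((min_le_left _ _).trans (min_le_right _ _))
    have hh : σ * √δ ≤ lam := by
      have k1 : δ ≤ (lam / σ) ^ 2 := by
        refine hδ.2.le.trans ?_
        calc min (min 1 ε) (1 / σ ^ 2) * lam ^ 2 ≤ 1 / σ ^ 2 * lam ^ 2 := by
              gcongr; exact min_le_right _ _
          _ = (lam / σ) ^ 2 := by rw [div_pow]; ring
      have k2 := (Real.sqrt_le_sqrt k1).trans_eq (Real.sqrt_sq (by positivity))
      rw [le_div_iff₀ hσ] at k2
      linarith
    rw [upProb_eq hσ hθ, downFactor_eq]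
    obtain ⟨hR, c, hc, hu, hE⟩ := H lam ⟨hl0, hlε⟩ (σ * √δ) (by positivity) hh (lam ^ (1 / 3 : ℝ))
      (by positivity) (by rw [← Real.rpow_natCast, ← Real.rpow_mul hl0.le]; norm_num)
    obtain ⟨k1, k2, k3, k4⟩ := hE.of_sqrt hσ h0 h1 hδ0 hl0 hC
    refine ⟨c, hc, hu, k1, k2, k3, ?_⟩
    rintro ⟨n, hn, hk⟩ x hx
    exact ⟨_, hR.optimalGrowthRate_eq hl0 hl1 hc hn hk hx, k4⟩
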